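/- Let $X$ be a complex manifold, $G$ a complex Lie group with Lie algebra $\mathfrak g$, and $\pi\colon P\to X$ a holomorphic principal $G$-bundle ($G$ acting on the right of $P$). Let $\operatorname{ad}P=P\times^G\mathfrak g$ be the adjoint bundle, $\operatorname{At}P=T_P/G$ the Atiyah bundle, whose fibre at $x$ consists of the $G$-invariant families of vectors $(v_p\in T_pP)_{p\in\pi^{-1}(x)}$, and $$0\to \operatorname{ad}P\xrightarrow{\ \iota\ }\operatorname{At}P\xrightarrow{\ d\pi\ }T_X\to 0$$ the Atiyah sequence. For $\lambda\in\mathbb C$, a (holomorphic) $\lambda$-connection on $P$ is an $\mathcal O_X$-linear map $s\colon\operatorname{At}P\to\operatorname{ad}P$ with $s\circ\iota=\lambda\cdot\mathrm{id}$, or equivalently a $G$-equivariant holomorphic $\mathfrak g$-valued $1$-form on $P$ whose value on the vertical vector defined by $\xi\in\mathfrak g$ is $\lambda\xi$. For a holomorphic map $f\colon Y\to X$ with canonical map $F\colon f^*P\to P$, a $\lambda$-connection on $f^*P$ with $1$-form $D$ is called trivial on the fibres of $f$ if $D=s'\circ dF$ for some holomorphic $G$-equivariant homomorphism $s'\colon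 F^*T_P\to\mathfrak g$ (that is, for some homomorphism $f^*\operatorname{At}P\to f^*\operatorname{ad}P$). Let $$C_\lambda(P)=\{(x,h): x\in X,\ h\in(\operatorname{At}P\otimes\Omega_X)_x=\operatorname{Hom}(T_xX,(\operatorname{At}P)_x),\ d\pi\circ h=\lambda\cdot\mathrm{id}_{T_xX}\},\qquad q\colon C_\lambda(P)\to X,\ (x,h)\mapsto x .$$ Then the following hold. 1. $C_\lambda(P)$ is a complex manifold (Hausdorff, respectively second countable, if $X$ is), and $q\colon C_\lambda(P)\to X$ is a holomorphic affine bundle with bundle of translations $\operatorname{ad}P\otimes\Omega_X=\operatorname{Hom}(T_X,\operatorname{ad}P)$, acting by $(\varphi,h)\mapsto \iota\circ\varphi+h$: the action on each (nonempty) fibre is simply transitive, and locally over $X$ there are translation-equivariant biholomorphic maps over $X$ from $C_\lambda(P)$ to the total space of $\operatorname{ad}P\otimes\Omega_X$. 2. The bundle $q^*P$ carries a canonical $\lambda$-connection $\nabla$ that is trivial on the fibres of $q$. Its $1$-form at a point $(h,p)\in q^*P$, with $h\in C_\lambda(P)_x$ and $p\in\pi^{-1}(x)$, is determined as follows: if $v$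 is a tangent vector of $q^*P$ at $(h,p)$ and $u\in T_pP$ is its image under the differential of $q^*P\to P$, then the vertical vector at $p$ defined by $\nabla(v)\in\mathfrak g$ is $\lambda u-h(d\pi(u))_p$. 3. $(C_\lambda(P),\nabla)$ is universal: for every complex manifold $Y$, every holomorphic submersion $f\colon Y\to X$ and every $\lambda$-connection $D$ on $f^*P$ that is trivial on the fibres of $f$, there is exactly one holomorphic map $\psi\colon Y\to C_\lambda(P)$ such that $q\circ\psi=f$ and such that there is an isomorphism $f^*P\cong\psi^*q^*P$ of holomorphic principal $G$-bundles over $Y$, compatible with the canonical maps of both bundles to $P$, that carries $D$ to the pullback $\psi^*\nabla$. -/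

import Mathlib

set_option linter.unusedSectionVars false
set_option linter.overlappingInstances false
set_option linter.unusedVariables false

open Bundle Set Topology
open scoped Manifold ContDiff Bundle

noncomputable section

namespace HolPrin

section Comp
variable {𝕜 : Type*} [NontriviallyNormedField 𝕜] {E : Type*} [NormedAddCommGroup E]
  [NormedSpace 𝕜 E] {H : Type*} [TopologicalSpace H] {I : ModelWithCorners 𝕜 E H}
  {n : ℕ∞ω}

/-- The partial homeomorphisms of `M` that are `C^n` in both directions. -/
def contMDiffPregroupoid (I : ModelWithCorners 𝕜 E H) (n : ℕ∞ω) (M : Type*) [TopologicalSpace M]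
    [ChartedSpace H M] : Pregroupoid M where
  property f s := ContMDiffOn I I n f s
  comp hf hg _ _ _ := hg.comp (hf.mono inter_subset_left) inter_subset_right
  id_mem := contMDiffOn_id
  locality _ h := contMDiffOn_of_locally_contMDiffOn h
  congr _ h hf := hf.congr h

theorem isManifold_comp {M M' : Type*} [TopologicalSpace M] [ChartedSpace H M] [IsManifold I n M]
    [TopologicalSpace M'] [ChartedSpace M M']
    (h : ∀ e ∈ atlas M M', ∀ e' ∈ atlas M M', ContMDiffOn I I n (e.symm ≫ₕ e') (e.symm ≫ₕ e').source) :
    @IsManifold 𝕜 _ E _ _ H _ I n M' _ (ChartedSpace.comp H M M') := by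
  have : HasGroupoid M' (contMDiffPregroupoid I n M).groupoid := by
    refine ⟨fun {e e'} he he' => ⟨h e he e' he', ?_⟩⟩
    have := h e' he' e he
    simpa [contMDiffPregroupoid] using this
  let _ := ChartedSpace.comp H M M'
  refine { StructureGroupoid.HasGroupoid.comp (contMDiffPregroupoid I n M).groupoid ?_ with }
  intro e he
  rw [isLocalStructomorphOn_contDiffGroupoid_iff]
  exact he
end Comp

section PB

variable {EB : Type*} [NormedAddCommGroup EB] [NormedSpace ℂ EB] {HB : Type*} [TopologicalSpace HB]
  (IB : ModelWithCorners ℂ EB HB) {B : Type*} [TopologicalSpace B] [ChartedSpace HB B]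
  (EG : Type*) [NormedAddCommGroup EG] [NormedSpace ℂ EG]
  (G : Type*) [TopologicalSpace G] [ChartedSpace EG G] [Group G]
  (P : B → Type*) [TopologicalSpace (TotalSpace G P)] [∀ x, TopologicalSpace (P x)]
  [FiberBundle G P] [∀ x, MulAction Gᵐᵒᵖ (P x)]

/-- The fibre bundle `P → B` with fibre `G` and a right action of `G` on its fibres (written as a
left action of the opposite group) is a holomorphic principal `G`-bundle: its local trivializations
are `G`-equivariant, where `G` acts on `B × G` by right translation, and the transition functions
are holomorphic maps to `G`. In particular the action is simply transitive on the fibres. -/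
class IsHolomorphicPrincipalBundle : Prop where
  equivariant : ∀ (e : Trivialization G (π G P)) [MemTrivializationAtlas e],
    ∀ x ∈ e.baseSet, ∀ (p : P x) (g : G), (e ⟨x, MulOpposite.op g • p⟩).2 = (e ⟨x, p⟩).2 * g
  holomorphic : ∀ (e e' : Trivialization G (π G P)) [MemTrivializationAtlas e]
    [MemTrivializationAtlas e'],
    ContMDiffOn IB 𝓘(ℂ, EG) ω (fun x => (e' (e.toOpenPartialHomeomorph.symm (x, 1))).2)
      (e.baseSet ∩ e'.baseSet)

/-- The charts of the total space of `P`: a local trivialization followed by a chart of `B × G`. -/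
instance totalChartedSpace [Group G] : ChartedSpace (ModelProd HB EG) (TotalSpace G P) :=
  ChartedSpace.comp (ModelProd HB EG) (B × G) (TotalSpace G P)

end PB
section PB2
variable {EB : Type*} [NormedAddCommGroup EB] [NormedSpace ℂ EB] {HB : Type*} [TopologicalSpace HB]
  {IB : ModelWithCorners ℂ EB HB} {B : Type*} [TopologicalSpace B] [ChartedSpace HB B]
  {EG : Type*} [NormedAddCommGroup EG] [NormedSpace ℂ EG]
  {G : Type*} [TopologicalSpace G] [ChartedSpace EG G] [Group G] [LieGroup 𝓘(ℂ, EG) ω G]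
  {P : B → Type*} [TopologicalSpace (TotalSpace G P)] [∀ x, TopologicalSpace (P x)]
  [FiberBundle G P] [∀ x, MulAction Gᵐᵒᵖ (P x)] [IsManifold IB ω B]

theorem symm_op_smul [hP : IsHolomorphicPrincipalBundle IB EG G P] (e : Trivialization G (π G P))
    [MemTrivializationAtlas e] {x : B} (hx : x ∈ e.baseSet) (g : G) :
    e.toOpenPartialHomeomorph.symm (x, g) = ⟨(e.toOpenPartialHomeomorph.symm (x, 1)).1,
      MulOpposite.op g • (e.toOpenPartialHomeomorph.symm (x, 1)).2⟩ := by
  have h1 : (x, (1:G)) ∈ e.target := by simp [e.mem_target, hx]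
  have h0 : (x, (g:G)) ∈ e.target := by simp [e.mem_target, hx]
  have h2 : (e.toOpenPartialHomeomorph.symm (x, 1)).proj = x := e.proj_symm_apply h1
  have h3 : (e.toOpenPartialHomeomorph.symm (x, g)).proj = x := e.proj_symm_apply h0
  have h4 := hP.equivariant e _ (by rw [h2]; exact hx) (e.toOpenPartialHomeomorph.symm (x, 1)).2 g
  apply e.injOn
  · rw [e.mem_source, h3]; exact hx
  · rw [e.mem_source]; simp only [h2]; exact hx
  · change e (e.toOpenPartialHomeomorph.symm (x, g)) = e _
    rw [e.apply_symm_apply h0]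
    refine Prod.ext ?_ ?_
    · rw [e.coe_fst' (by simp only [h2]; exact hx)]; exact h2.symm
    · rw [h4]
      have : e ⟨_, (e.toOpenPartialHomeomorph.symm (x, 1)).2⟩ = (x, 1) := e.apply_symm_apply h1
      rw [this]; simp

theorem trivChange_eq [hP : IsHolomorphicPrincipalBundle IB EG G P]
    (e e' : Trivialization G (π G P))
    [MemTrivializationAtlas e] [MemTrivializationAtlas e'] {x : B} (hx : x ∈ e.baseSet)
    (hx' : x ∈ e'.baseSet) (g : G) :
    e' (e.toOpenPartialHomeomorph.symm (x, g)) =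
      (x, (e' (e.toOpenPartialHomeomorph.symm (x, 1))).2 * g) := by
  have h1 : (x, (1:G)) ∈ e.target := by simp [e.mem_target, hx]
  have h0 : (x, (g:G)) ∈ e.target := by simp [e.mem_target, hx]
  have h2 : (e.toOpenPartialHomeomorph.symm (x, 1)).proj = x := e.proj_symm_apply h1
  have h3 : (e.toOpenPartialHomeomorph.symm (x, g)).proj = x := e.proj_symm_apply h0
  refine Prod.ext ?_ ?_
  · rw [e'.coe_fst' (by rw [h3]; exact hx')]; exact h3
  · rw [symm_op_smul (IB := IB) (EG := EG) e hx g]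
    exact hP.equivariant e' _ (by rw [h2]; exact hx') _ g

instance total_isManifold [hP : IsHolomorphicPrincipalBundle IB EG G P] :
    IsManifold (IB.prod 𝓘(ℂ, EG)) ω (TotalSpace G P) := by
  refine isManifold_comp (I := IB.prod 𝓘(ℂ, EG)) (M := B × G) ?_
  rintro _ ⟨e, he, rfl⟩ _ ⟨e', he', rfl⟩
  have : MemTrivializationAtlas e := ⟨he⟩
  have : MemTrivializationAtlas e' := ⟨he'⟩
  have key : ContMDiffOn (IB.prod 𝓘(ℂ, EG)) (IB.prod 𝓘(ℂ, EG)) ω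
      (fun z : B × G => (z.1, (e' (e.toOpenPartialHomeomorph.symm (z.1, 1))).2 * z.2))
      ((e.baseSet ∩ e'.baseSet) ×ˢ univ) := by
    refine contMDiffOn_fst.prodMk (ContMDiffOn.mul ?_ contMDiffOn_snd)
    exact (hP.holomorphic e e').comp contMDiffOn_fst (fun z hz => hz.1)
  have hs : (e.toOpenPartialHomeomorph.symm ≫ₕ e'.toOpenPartialHomeomorph).source ⊆
      (e.baseSet ∩ e'.baseSet) ×ˢ univ := by
    rintro ⟨x, g⟩ hz
    simp only [OpenPartialHomeomorph.trans_source, OpenPartialHomeomorph.symm_source] at hz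
    obtain ⟨hz1, hz2⟩ := hz
    have h0 : x ∈ e.baseSet := (e.mem_target.1 hz1)
    refine ⟨⟨h0, ?_⟩, mem_univ _⟩
    have := (e'.mem_source).1 hz2
    rwa [e.proj_symm_apply hz1] at this
  refine (key.mono hs).congr ?_
  rintro ⟨x, g⟩ hz
  exact trivChange_eq (IB := IB) (EG := EG) e e' (hs hz).1.1 (hs hz).1.2 g

end PB2

section Pull
variable {EB : Type*} [NormedAddCommGroup EB] [NormedSpace ℂ EB] {HB : Type*} [TopologicalSpace HB]
  {IB : ModelWithCorners ℂ EB HB} {B : Type*} [TopologicalSpace B] [ChartedSpace HB B]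
  {EC : Type*} [NormedAddCommGroup EC] [NormedSpace ℂ EC] {HC : Type*} [TopologicalSpace HC]
  {IC : ModelWithCorners ℂ EC HC} {C : Type*} [TopologicalSpace C] [ChartedSpace HC C]
  {EG : Type*} [NormedAddCommGroup EG] [NormedSpace ℂ EG]
  {G : Type*} [TopologicalSpace G] [ChartedSpace EG G] [Group G] [LieGroup 𝓘(ℂ, EG) ω G]
  {P : B → Type*} [TopologicalSpace (TotalSpace G P)] [∀ x, TopologicalSpace (P x)]
  [∀ x, Nonempty (P x)]
  [FiberBundle G P] [∀ x, MulAction Gᵐᵒᵖ (P x)]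

instance pullbackMulAction (f : C → B) (y : C) : MulAction Gᵐᵒᵖ ((f *ᵖ P) y) :=
  inferInstanceAs (MulAction Gᵐᵒᵖ (P (f y)))

instance pullbackNonempty (f : C → B) (y : C) : Nonempty ((f *ᵖ P) y) :=
  inferInstanceAs (Nonempty (P (f y)))

instance pullback_isHolomorphicPrincipalBundle [hP : IsHolomorphicPrincipalBundle IB EG G P]
    (f : C^ω⟮IC, C; IB, B⟯) : IsHolomorphicPrincipalBundle IC EG G ((f : C → B) *ᵖ P) where
  equivariant := by
    rintro _ ⟨e, he, rfl⟩ y hy p g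
    exact hP.equivariant e (f y) hy p g
  holomorphic := by
    rintro _ _ ⟨e, he, rfl⟩ ⟨e', he', rfl⟩
    have h := (hP.holomorphic e e').comp (s := f ⁻¹' (e.baseSet ∩ e'.baseSet))
      f.contMDiff.contMDiffOn (fun y hy => hy)
    refine h.congr ?_
    intro y hy
    change (e' ⟨f y, e.symm (f y) 1⟩).2 = _
    rw [e.mk_symm hy.1]
    rfl
end Pull

section CompAtlas
variable {𝕜 : Type*} [NontriviallyNormedField 𝕜] {E : Type*} [NormedAddCommGroup E]
  [NormedSpace 𝕜 E] {H : Type*} [TopologicalSpace H] {I : ModelWithCorners 𝕜 E H}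
  {n : ℕ∞ω}

theorem contMDiffOn_of_mem_atlas_comp {M M' : Type*} [TopologicalSpace M] [ChartedSpace H M]
    [IsManifold I n M] [TopologicalSpace M'] [ChartedSpace M M']
    [cs : ChartedSpace H M'] (hcs : cs = ChartedSpace.comp H M M') [IsManifold I n M']
    {e : OpenPartialHomeomorph M' M} (he : e ∈ atlas M M') :
    ContMDiffOn I I n e e.source ∧ ContMDiffOn I I n e.symm e.target := by
  subst hcs
  let _ := ChartedSpace.comp H M M'
  constructor
  · intro z hz
    apply ContMDiffAt.contMDiffWithinAt
    let c := chartAt H (e z)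
    have hc : e ≫ₕ c ∈ atlas H M' := ⟨e, he, c, chart_mem_atlas H _, rfl⟩
    have hz' : z ∈ (e ≫ₕ c).source := by simp [hz, c]
    have h1 : ContMDiffAt I I n (e ≫ₕ c) z := contMDiffAt_of_mem_maximalAtlas
      (IsManifold.subset_maximalAtlas hc) hz'
    have h2 : ContMDiffAt I I n c.symm (c (e z)) := contMDiffAt_symm_of_mem_maximalAtlas
      (IsManifold.subset_maximalAtlas (chart_mem_atlas H _)) (by simp [c])
    refine (ContMDiffAt.comp z h2 h1).congr_of_eventuallyEq ?_
    filter_upwards [(e ≫ₕ c).open_source.mem_nhds hz'] with y hy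
    simp only [OpenPartialHomeomorph.trans_source] at hy
    exact (c.left_inv hy.2).symm
  · intro z hz
    apply ContMDiffAt.contMDiffWithinAt
    let c := chartAt H z
    have hc : e ≫ₕ c ∈ atlas H M' := ⟨e, he, c, chart_mem_atlas H _, rfl⟩
    have hz' : c z ∈ (e ≫ₕ c).target := by simp [hz, c]
    have h1 : ContMDiffAt I I n (e ≫ₕ c).symm (c z) := contMDiffAt_symm_of_mem_maximalAtlas
      (IsManifold.subset_maximalAtlas hc) hz'
    have h2 : ContMDiffAt I I n c z := contMDiffAt_of_mem_maximalAtlas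
      (IsManifold.subset_maximalAtlas (chart_mem_atlas H _)) (by simp [c])
    refine (ContMDiffAt.comp z h1 h2).congr_of_eventuallyEq ?_
    filter_upwards [c.open_source.mem_nhds (mem_chart_source H z)] with y hy
    simp only [Function.comp, OpenPartialHomeomorph.coe_trans_symm]
    rw [c.left_inv hy]
end CompAtlas

section Calc
variable {EB : Type*} [NormedAddCommGroup EB] [NormedSpace ℂ EB] {HB : Type*} [TopologicalSpace HB]
  (IB : ModelWithCorners ℂ EB HB) {B : Type*} [TopologicalSpace B] [ChartedSpace HB B]
  (EG : Type*) [NormedAddCommGroup EG] [NormedSpace ℂ EG]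
  {G : Type*} [TopologicalSpace G] [ChartedSpace EG G] [Group G]
  {P : B → Type*} [TopologicalSpace (TotalSpace G P)] [∀ x, TopologicalSpace (P x)]
  [FiberBundle G P] [∀ x, MulAction Gᵐᵒᵖ (P x)]

variable (G) in
/-- The Lie algebra of `G`, that is the tangent space at `1`. -/
def LieAlg : Type _ := GroupLieAlgebra 𝓘(ℂ, EG) G

instance : NormedAddCommGroup (LieAlg EG G) := inferInstanceAs (NormedAddCommGroup EG)

instance : NormedSpace ℂ (LieAlg EG G) := inferInstanceAs (NormedSpace ℂ EG)

instance [FiniteDimensional ℂ EG] : FiniteDimensional ℂ (LieAlg EG G) :=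
  inferInstanceAs (FiniteDimensional ℂ EG)

/-- The adjoint action of `G` on its Lie algebra. -/
def Ad (g : G) : LieAlg EG G →L[ℂ] LieAlg EG G :=
  mfderiv 𝓘(ℂ, EG) 𝓘(ℂ, EG) (fun h : G => g * h * g⁻¹) 1

/-- Right translation `z ↦ z g` by `g` on the total space of `P`. -/
def rightMul (g : G) (z : TotalSpace G P) : TotalSpace G P := ⟨z.1, MulOpposite.op g • z.2⟩

/-- The vertical tangent vectors at `z`: the differential at `1` of `g ↦ z g`, which identifies the
Lie algebra with the kernel of the differential of the projection. -/
def vert (z : TotalSpace G P) :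
    LieAlg EG G →L[ℂ] TangentSpace (IB.prod 𝓘(ℂ, EG)) z :=
  mfderiv 𝓘(ℂ, EG) (IB.prod 𝓘(ℂ, EG)) (fun g : G => rightMul g z) 1

/-- The differential at `z` of the right translation by `g`. -/
def rightMulDeriv (g : G) (z : TotalSpace G P) :
    TangentSpace (IB.prod 𝓘(ℂ, EG)) z →L[ℂ] TangentSpace (IB.prod 𝓘(ℂ, EG)) (rightMul g z) :=
  mfderiv (IB.prod 𝓘(ℂ, EG)) (IB.prod 𝓘(ℂ, EG)) (rightMul g) z

variable (P) in
/-- The fibre at `x` of the Atiyah bundle `At P = T_P / G`: the `G`-invariant families of tangent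
vectors of the total space of `P` along the fibre of `P` over `x`. -/
def atFibre (x : B) :
    Submodule ℂ (∀ p : P x, TangentSpace (IB.prod 𝓘(ℂ, EG)) (⟨x, p⟩ : TotalSpace G P)) where
  carrier := {v | ∀ (p : P x) (g : G),
    v (MulOpposite.op g • p) = rightMulDeriv IB EG g ⟨x, p⟩ (v p)}
  add_mem' {v w} hv hw p g := by
    simp only [Pi.add_apply, hv p g, hw p g, map_add]
    rfl
  zero_mem' p g := by simp only [Pi.zero_apply, map_zero]; rfl
  smul_mem' c v hv p g := by
    simp only [Pi.smul_apply, hv p g, map_smul]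
    rfl

variable (G P) in
/-- The fibre at `x` of the adjoint bundle `ad P = P ×^G 𝔤`: the `G`-equivariant maps from the fibre
of `P` over `x` to the Lie algebra. -/
def adFibre (x : B) : Submodule ℂ (P x → LieAlg EG G) where
  carrier := {ξ | ∀ (p : P x) (g : G), ξ (MulOpposite.op g • p) = Ad EG g⁻¹ (ξ p)}
  add_mem' {v w} hv hw p g := by simp only [Pi.add_apply, hv p g, hw p g, map_add]
  zero_mem' p g := by simp only [Pi.zero_apply, map_zero]
  smul_mem' c v hv p g := by simp only [Pi.smul_apply, hv p g, map_smul]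

variable (G P) in
/-- The fibre at `x` of `C_λ(P) ⊂ At P ⊗ Ω`: the elements of `(At P ⊗ Ω)_x = Hom(T_x B, (At P)_x)`
whose composition with the differential `(At P)_x → T_x B` of the projection is `λ` times the
identity of `T_x B`. -/
def CFibre (lam : ℂ) (x : B) : Type _ :=
  {h : TangentSpace IB x →ₗ[ℂ] atFibre IB EG (G := G) P x // ∀ (w : TangentSpace IB x) (p : P x),
    mfderiv (IB.prod 𝓘(ℂ, EG)) IB (π G P) ⟨x, p⟩ ((h w).1 p) = lam • w}

end Calc

section Calc2
variable {EB : Type*} [NormedAddCommGroup EB] [NormedSpace ℂ EB] {HB : Type*} [TopologicalSpace HB]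
  {IB : ModelWithCorners ℂ EB HB} {B : Type*} [TopologicalSpace B] [ChartedSpace HB B]
  {EG : Type*} [NormedAddCommGroup EG] [NormedSpace ℂ EG]
  {G : Type*} [TopologicalSpace G] [ChartedSpace EG G] [Group G] [LieGroup 𝓘(ℂ, EG) ω G]
  {P : B → Type*} [TopologicalSpace (TotalSpace G P)] [∀ x, TopologicalSpace (P x)]
  [FiberBundle G P] [∀ x, MulAction Gᵐᵒᵖ (P x)]

theorem rightMul_one (z : TotalSpace G P) : rightMul (1 : G) z = z := by
  simp [rightMul]

theorem rightMul_mul (g h : G) (z : TotalSpace G P) :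
    rightMul (g * h) z = rightMul h (rightMul g z) := by
  simp only [rightMul, MulOpposite.op_mul, mul_smul]
  rfl

theorem Ad_mul (g h : G) : Ad EG (g * h) = (Ad EG g).comp (Ad EG h) := by
  have h1 : ∀ (g k : G), MDifferentiableAt 𝓘(ℂ, EG) 𝓘(ℂ, EG) (fun h : G => g * h * g⁻¹) k := by
    intro g k
    have : ContMDiff 𝓘(ℂ, EG) 𝓘(ℂ, EG) ω (fun h : G => g * h * g⁻¹) :=
      (contMDiff_const.mul contMDiff_id).mul contMDiff_const
    exact this.mdifferentiableAt (by simp)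
  have h2 : (fun k : G => (g * h) * k * (g * h)⁻¹) =
      (fun k : G => g * k * g⁻¹) ∘ (fun k : G => h * k * h⁻¹) := by
    funext k; simp [mul_assoc]
  have h3 := mfderiv_comp (I := 𝓘(ℂ, EG)) (I' := 𝓘(ℂ, EG)) (I'' := 𝓘(ℂ, EG)) (1 : G)
    (h1 g (h * 1 * h⁻¹)) (h1 h 1)
  rw [← h2] at h3
  have h4 : h * 1 * h⁻¹ = 1 := by simp
  unfold Ad
  refine h3.trans ?_
  ext v
  change mfderiv 𝓘(ℂ, EG) 𝓘(ℂ, EG) (fun k : G => g * k * g⁻¹) (h * 1 * h⁻¹) _ = _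
  rw [h4]
  rfl

theorem Ad_one : Ad EG (1 : G) = ContinuousLinearMap.id ℂ _ := by
  unfold Ad
  have : (fun h : G => 1 * h * 1⁻¹) = id := by funext; simp
  rw [this]
  exact mfderiv_id

variable [IsManifold IB ω B]

theorem triv_contMDiffOn [hP : IsHolomorphicPrincipalBundle IB EG G P]
    (e : Trivialization G (π G P)) [he : MemTrivializationAtlas e] :
    ContMDiffOn (IB.prod 𝓘(ℂ, EG)) (IB.prod 𝓘(ℂ, EG)) ω e e.source ∧
    ContMDiffOn (IB.prod 𝓘(ℂ, EG)) (IB.prod 𝓘(ℂ, EG)) ω e.toOpenPartialHomeomorph.symm e.target :=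
  contMDiffOn_of_mem_atlas_comp (I := IB.prod 𝓘(ℂ, EG)) (M := B × G)
    (e := e.toOpenPartialHomeomorph) rfl ⟨e, he.out, rfl⟩

theorem contMDiffAt_triv [hP : IsHolomorphicPrincipalBundle IB EG G P]
    (e : Trivialization G (π G P)) [he : MemTrivializationAtlas e] {z : TotalSpace G P}
    (hz : z.1 ∈ e.baseSet) :
    ContMDiffAt (IB.prod 𝓘(ℂ, EG)) (IB.prod 𝓘(ℂ, EG)) ω e z :=
  (triv_contMDiffOn e).1.contMDiffAt (e.open_source.mem_nhds (e.mem_source.2 hz))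

theorem contMDiffAt_triv_symm [hP : IsHolomorphicPrincipalBundle IB EG G P]
    (e : Trivialization G (π G P)) [he : MemTrivializationAtlas e] {z : B × G}
    (hz : z.1 ∈ e.baseSet) :
    ContMDiffAt (IB.prod 𝓘(ℂ, EG)) (IB.prod 𝓘(ℂ, EG)) ω e.toOpenPartialHomeomorph.symm z :=
  (triv_contMDiffOn e).2.contMDiffAt (e.open_target.mem_nhds (e.mem_target.2 hz))

theorem contMDiff_projP [hP : IsHolomorphicPrincipalBundle IB EG G P] :
    ContMDiff (IB.prod 𝓘(ℂ, EG)) IB ω (π G P) := by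
  intro z
  let e := trivializationAt G P z.1
  have hz : z.1 ∈ e.baseSet := mem_baseSet_trivializationAt G P z.1
  refine (contMDiffAt_fst.comp z (contMDiffAt_triv e hz)).congr_of_eventuallyEq ?_
  filter_upwards [e.open_source.mem_nhds (e.mem_source.2 hz)] with y hy
  exact (e.coe_fst hy).symm

/-- The action `P × G → P` is holomorphic. -/
theorem contMDiff_action [hP : IsHolomorphicPrincipalBundle IB EG G P] :
    ContMDiff ((IB.prod 𝓘(ℂ, EG)).prod 𝓘(ℂ, EG)) (IB.prod 𝓘(ℂ, EG)) ω
      (fun a : TotalSpace G P × G => rightMul a.2 a.1) := by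
  rintro ⟨z, g⟩
  let e := trivializationAt G P z.1
  have hz : z.1 ∈ e.baseSet := mem_baseSet_trivializationAt G P z.1
  have h1 : ContMDiffAt ((IB.prod 𝓘(ℂ, EG)).prod 𝓘(ℂ, EG)) (IB.prod 𝓘(ℂ, EG)) ω
      (fun a : TotalSpace G P × G => e a.1) (z, g) :=
    (contMDiffAt_triv e hz).comp (z, g) contMDiffAt_fst
  have h2 : ContMDiffAt ((IB.prod 𝓘(ℂ, EG)).prod 𝓘(ℂ, EG)) (IB.prod 𝓘(ℂ, EG)) ω
      (fun a : TotalSpace G P × G => ((e a.1).1, (e a.1).2 * a.2)) (z, g) :=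
    (contMDiffAt_fst.comp _ h1).prodMk ((contMDiffAt_snd.comp _ h1).mul contMDiffAt_snd)
  have h3 : ContMDiffAt (IB.prod 𝓘(ℂ, EG)) (IB.prod 𝓘(ℂ, EG)) ω e.toOpenPartialHomeomorph.symm
      ((e z).1, (e z).2 * g) := by
    apply contMDiffAt_triv_symm e
    rw [e.coe_fst' hz]; exact hz
  refine (ContMDiffAt.comp (z, g) h3 h2).congr_of_eventuallyEq ?_
  have : ∀ᶠ a : TotalSpace G P × G in 𝓝 (z, g), a.1 ∈ e.source :=
    continuousAt_fst.eventually (e.open_source.mem_nhds (e.mem_source.2 hz))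
  filter_upwards [this] with a ha
  have ha' := e.mem_source.1 ha
  have hb : (e a.1).1 ∈ e.baseSet := by rw [e.coe_fst' ha']; exact ha'
  have ht : ((e a.1).1, (e a.1).2 * a.2) ∈ e.target := e.mem_target.2 hb
  apply e.injOn
  · exact e.mem_source.2 ha'
  · rw [Function.comp, e.mem_source, e.proj_symm_apply ht]; exact hb
  · change e _ = e (e.toOpenPartialHomeomorph.symm ((e a.1).1, (e a.1).2 * a.2))
    rw [e.apply_symm_apply ht]
    refine Prod.ext ?_ ?_
    · rw [e.coe_fst' ha', e.coe_fst' (by exact ha')]; rfl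
    · exact hP.equivariant e _ ha' _ _

theorem contMDiff_rightMul [hP : IsHolomorphicPrincipalBundle IB EG G P] (g : G) :
    ContMDiff (IB.prod 𝓘(ℂ, EG)) (IB.prod 𝓘(ℂ, EG)) ω
      (rightMul g : TotalSpace G P → TotalSpace G P) :=
  (contMDiff_action (IB := IB) (EG := EG) (P := P)).comp (contMDiff_id.prodMk contMDiff_const)

theorem contMDiff_orbit [hP : IsHolomorphicPrincipalBundle IB EG G P] (z : TotalSpace G P) :
    ContMDiff 𝓘(ℂ, EG) (IB.prod 𝓘(ℂ, EG)) ω (fun g : G => rightMul g z) :=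
  (contMDiff_action (IB := IB) (EG := EG) (P := P)).comp (contMDiff_const.prodMk contMDiff_id)

theorem rightMulDeriv_mul [hP : IsHolomorphicPrincipalBundle IB EG G P] (g h : G)
    (z : TotalSpace G P) (v : TangentSpace (IB.prod 𝓘(ℂ, EG)) z) :
    rightMulDeriv IB EG (g * h) z v = rightMulDeriv IB EG h (rightMul g z)
      (rightMulDeriv IB EG g z v) := by
  have h2 : (rightMul (g * h) : TotalSpace G P → TotalSpace G P) = rightMul h ∘ rightMul g := by
    funext z; exact rightMul_mul g h z
  have h3 := mfderiv_comp (I := IB.prod 𝓘(ℂ, EG)) (I' := IB.prod 𝓘(ℂ, EG))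
    (I'' := IB.prod 𝓘(ℂ, EG)) z
    ((contMDiff_rightMul (IB := IB) (EG := EG) (P := P) h).mdifferentiableAt (by simp))
    ((contMDiff_rightMul (IB := IB) (EG := EG) (P := P) g).mdifferentiableAt (by simp))
  rw [← h2] at h3
  exact congrArg (fun L => L v) h3

theorem rightMulDeriv_one (z : TotalSpace G P) (v : TangentSpace (IB.prod 𝓘(ℂ, EG)) z) :
    rightMulDeriv IB EG (1 : G) z v = v := by
  have : (rightMul (1 : G) : TotalSpace G P → TotalSpace G P) = id := by
    funext z; exact rightMul_one z
  unfold rightMulDeriv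
  rw [this, mfderiv_id]
  rfl

theorem rightMulDeriv_vert [hP : IsHolomorphicPrincipalBundle IB EG G P] (g : G)
    (z : TotalSpace G P) (ξ : LieAlg EG G) :
    rightMulDeriv IB EG g z (vert IB EG z ξ) = vert IB EG (rightMul g z) (Ad EG g⁻¹ ξ) := by
  have h1 : MDifferentiableAt 𝓘(ℂ, EG) 𝓘(ℂ, EG) (fun h : G => g⁻¹ * h * g⁻¹⁻¹) 1 := by
    have : ContMDiff 𝓘(ℂ, EG) 𝓘(ℂ, EG) ω (fun h : G => g⁻¹ * h * g⁻¹⁻¹) :=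
      (contMDiff_const.mul contMDiff_id).mul contMDiff_const
    exact this.mdifferentiableAt (by simp)
  have e1 := mfderiv_comp (I := 𝓘(ℂ, EG)) (I' := IB.prod 𝓘(ℂ, EG))
    (I'' := IB.prod 𝓘(ℂ, EG)) (1 : G)
    ((contMDiff_rightMul (IB := IB) (EG := EG) (P := P) g).mdifferentiableAt (by simp))
    ((contMDiff_orbit (IB := IB) (EG := EG) z).mdifferentiableAt (x := (1 : G)) (by simp))
  have e2 := mfderiv_comp (I := 𝓘(ℂ, EG)) (I' := 𝓘(ℂ, EG))
    (I'' := IB.prod 𝓘(ℂ, EG)) (1 : G)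
    ((contMDiff_orbit (IB := IB) (EG := EG) (rightMul g z)).mdifferentiableAt
      (x := g⁻¹ * 1 * g⁻¹⁻¹) (by simp)) h1
  have h2 : (rightMul g : TotalSpace G P → TotalSpace G P) ∘ (fun k : G => rightMul k z) =
      (fun k : G => rightMul k (rightMul g z)) ∘ (fun h : G => g⁻¹ * h * g⁻¹⁻¹) := by
    funext k
    simp only [Function.comp, ← rightMul_mul]
    congr 1
    group
  rw [h2, e2] at e1
  have h3 : rightMul (1 : G) z = z := rightMul_one z
  have h4 : g⁻¹ * 1 * g⁻¹⁻¹ = 1 := by simp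
  have e3 := congrArg (fun L => L ξ) e1
  have e4 : mfderiv (IB.prod 𝓘(ℂ, EG)) (IB.prod 𝓘(ℂ, EG)) (rightMul g) (rightMul (1 : G) z)
      (mfderiv 𝓘(ℂ, EG) (IB.prod 𝓘(ℂ, EG)) (fun g : G => rightMul g z) 1 ξ) =
      (rightMulDeriv IB EG g z (vert IB EG z ξ) : EB × EG) := by
    unfold rightMulDeriv vert
    rw [h3]
    rfl
  have e5 : mfderiv 𝓘(ℂ, EG) (IB.prod 𝓘(ℂ, EG)) (fun k : G => rightMul k (rightMul g z))
      (g⁻¹ * 1 * g⁻¹⁻¹) (Ad EG g⁻¹ ξ) = (vert IB EG (rightMul g z) (Ad EG g⁻¹ ξ) : EB × EG) := by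
    unfold vert
    rw [h4]
    rfl
  exact e4.symm.trans (e3.symm.trans e5)

end Calc2

section AdBundle
variable {EB : Type*} [NormedAddCommGroup EB] [NormedSpace ℂ EB] {HB : Type*} [TopologicalSpace HB]
  {IB : ModelWithCorners ℂ EB HB} {B : Type*} [TopologicalSpace B] [ChartedSpace HB B]
  {EG : Type*} [NormedAddCommGroup EG] [NormedSpace ℂ EG]
  {G : Type*} [TopologicalSpace G] [ChartedSpace EG G] [Group G] [LieGroup 𝓘(ℂ, EG) ω G]

/-- Holomorphic dependence on parameters of a derivative whose values are in the Lie algebra. -/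
theorem contMDiffAt_mfderiv_toLie {N : Type*} {EN HN : Type*} [NormedAddCommGroup EN]
    [NormedSpace ℂ EN] [TopologicalSpace HN] {IN : ModelWithCorners ℂ EN HN} [TopologicalSpace N]
    [ChartedSpace HN N] [IsManifold IN ω N] [IsManifold IB ω B] {f : N → B → G} {g : N → B} {x₀ : N}
    (hf : ContMDiffAt (IN.prod IB) 𝓘(ℂ, EG) ω (Function.uncurry f) (x₀, g x₀))
    (hg : ContMDiffAt IN IB ω g x₀) (h1 : ∀ x, f x (g x) = 1) (L : N → EB →L[ℂ] LieAlg EG G)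
    (hL : ∀ x v, L x v = mfderiv IB 𝓘(ℂ, EG) (f x) (g x)
      ((tangentBundleCore IB B).coordChange (achart HB (g x₀)) (achart HB (g x)) (g x) v)) :
    ContMDiffAt IN 𝓘(ℂ, EB →L[ℂ] LieAlg EG G) ω L x₀ := by
  have : IsManifold IB 1 B := IsManifold.of_le (n := ω) le_top
  have : IsManifold IN 1 N := IsManifold.of_le (n := ω) le_top
  have : IsManifold 𝓘(ℂ, EG) ω G := ContMDiffMul.toIsManifold
  have : IsManifold 𝓘(ℂ, EG) 1 G := IsManifold.of_le (n := ω) le_top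
  have h := ContMDiffAt.mfderiv (m := ω) f g hf hg (by simp)
  refine ContMDiffAt.congr_of_eventuallyEq (by exact h) ?_
  filter_upwards [hg.continuousAt.preimage_mem_nhds ((chartAt HB (g x₀)).open_source.mem_nhds
    (mem_chart_source HB (g x₀)))] with x hx
  have h5 := inTangentCoordinates_eq (I := IB) (I' := 𝓘(ℂ, EG)) g (fun x => f x (g x))
    (fun x => mfderiv IB 𝓘(ℂ, EG) (f x) (g x)) hx
    (by rw [h1 x, h1 x₀]; exact mem_chart_source EG 1)
  refine Eq.trans ?_ h5.symm
  ext v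
  refine (hL x v).trans ?_
  have h2 : ∀ a b c : G, a = 1 → b = 1 → c = 1 → ∀ v : EG,
      (tangentBundleCore 𝓘(ℂ, EG) G).coordChange (achart EG a) (achart EG b) c v = v := by
    rintro _ _ _ rfl rfl rfl v
    exact (tangentBundleCore 𝓘(ℂ, EG) G).coordChange_self _ _ (mem_chart_source EG (1 : G)) v
  exact (h2 _ _ _ (h1 x) (h1 x₀) (h1 x) _).symm

theorem contMDiff_Ad : ContMDiff 𝓘(ℂ, EG) 𝓘(ℂ, LieAlg EG G →L[ℂ] LieAlg EG G) ω
    (fun g : G => Ad EG g) := by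
  have : IsManifold 𝓘(ℂ, EG) ω G := ContMDiffMul.toIsManifold
  intro g₀
  exact contMDiffAt_mfderiv_toLie (IB := 𝓘(ℂ, EG)) (IN := 𝓘(ℂ, EG)) (EG := EG)
    (f := fun g h : G => g * h * g⁻¹) (g := fun _ => 1) (x₀ := g₀)
    (by
      have : ContMDiff (𝓘(ℂ, EG).prod 𝓘(ℂ, EG)) 𝓘(ℂ, EG) ω (fun a : G × G => a.1 * a.2 * a.1⁻¹) :=
        (contMDiff_fst.mul contMDiff_snd).mul contMDiff_fst.inv
      exact this _)
    contMDiffAt_const (by simp) (fun g => Ad EG g) (fun g v => by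
      rw [(tangentBundleCore 𝓘(ℂ, EG) G).coordChange_self _ _ (mem_chart_source EG (1 : G)) v]
      rfl)

variable
  {P : B → Type*} [TopologicalSpace (TotalSpace G P)] [∀ x, TopologicalSpace (P x)]
  [∀ x, Nonempty (P x)]
  [FiberBundle G P] [∀ x, MulAction Gᵐᵒᵖ (P x)]

theorem eq_smul_sec [hP : IsHolomorphicPrincipalBundle IB EG G P] (e : Trivialization G (π G P))
    [MemTrivializationAtlas e] {x : B} (hx : x ∈ e.baseSet) (p : P x) :
    p = MulOpposite.op (e ⟨x, p⟩).2 • e.symm x (1 : G) := by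
  have h1 : e ⟨x, e.symm x (1 : G)⟩ = (x, 1) := e.apply_mk_symm hx 1
  have h2 : (⟨x, p⟩ : TotalSpace G P) = ⟨x, MulOpposite.op (e ⟨x, p⟩).2 • e.symm x (1 : G)⟩ := by
    refine e.injOn (x₁ := ⟨x, p⟩) (x₂ := ⟨x, MulOpposite.op (e ⟨x, p⟩).2 • e.symm x (1 : G)⟩)
      (e.mem_source.2 hx) (e.mem_source.2 hx) ?_
    refine Prod.ext ?_ ?_
    · have ha : ∀ q : P x, (e ⟨x, q⟩).1 = x := fun q =>
        e.coe_fst' (show (⟨x, q⟩ : TotalSpace G P).proj ∈ e.baseSet from hx)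
      exact (ha _).trans (ha _).symm
    · refine Eq.trans ?_ (hP.equivariant e x hx _ _).symm
      rw [h1]; exact (one_mul _).symm
  exact eq_of_heq (TotalSpace.mk.inj h2).2

open Classical in
/-- The local trivialization of `ad P` given by a local trivialization `e` of `P`: the value of an
equivariant map at the point where `e` is `1`. -/
def adPretrivialization [hP : IsHolomorphicPrincipalBundle IB EG G P]
    (e : Trivialization G (π G P)) [he : MemTrivializationAtlas e] :
    Pretrivialization (LieAlg EG G) (π (LieAlg EG G) (fun x => adFibre EG G P x)) where
  toFun z := (z.1, z.2.1 (e.symm z.1 (1 : G)))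
  invFun y := ⟨y.1, if h : y.1 ∈ e.baseSet then
    ⟨fun p => Ad EG (e ⟨y.1, p⟩).2⁻¹ y.2, fun p g => by
      beta_reduce
      rw [hP.equivariant e _ h, mul_inv_rev, Ad_mul]
      rfl⟩ else 0⟩
  source := π (LieAlg EG G) (fun x => adFibre EG G P x) ⁻¹' e.baseSet
  target := e.baseSet ×ˢ univ
  map_source' z hz := ⟨hz, mem_univ _⟩
  map_target' y hy := hy.1
  left_inv' := by
    rintro ⟨x, ξ⟩ hx
    have hx' : x ∈ e.baseSet := hx
    simp only [dif_pos hx']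
    congr 1
    apply Subtype.ext
    funext p
    conv_rhs => rw [eq_smul_sec (IB := IB) (EG := EG) e hx' p]
    exact (ξ.2 _ _).symm
  right_inv' := by
    rintro ⟨x, v⟩ ⟨hx, -⟩
    have hx' : x ∈ e.baseSet := hx
    simp only [dif_pos hx']
    have h1 : e ⟨x, e.symm x (1 : G)⟩ = (x, 1) := e.apply_mk_symm hx 1
    rw [h1, inv_one, Ad_one]
    rfl
  open_target := e.open_baseSet.prod isOpen_univ
  baseSet := e.baseSet
  open_baseSet := e.open_baseSet
  source_eq := rfl
  target_eq := rfl
  proj_toFun _ _ := rfl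

theorem adPretrivialization_symm [hP : IsHolomorphicPrincipalBundle IB EG G P]
    (e : Trivialization G (π G P)) [he : MemTrivializationAtlas e] {x : B} (hx : x ∈ e.baseSet)
    (v : LieAlg EG G) (p : P x) :
    ((adPretrivialization (IB := IB) (EG := EG) e).symm x v).1 p = Ad EG (e ⟨x, p⟩).2⁻¹ v := by
  have h := (adPretrivialization (IB := IB) (EG := EG) e).mk_symm (b := x) hx v
  have h2 : (adPretrivialization (IB := IB) (EG := EG) e).toPartialEquiv.symm (x, v) =
    ⟨x, ⟨fun p => Ad EG (e ⟨x, p⟩).2⁻¹ v, fun p g => by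
      beta_reduce
      rw [hP.equivariant e _ hx, mul_inv_rev, Ad_mul]
      rfl⟩⟩ := by
    change TotalSpace.mk x _ = _
    simp only [dif_pos hx]
  rw [h2] at h
  have h3 := eq_of_heq (TotalSpace.mk.inj h).2
  exact congrArg (fun s : adFibre EG G P x => s.1 p) h3

theorem ad_coordChange [hP : IsHolomorphicPrincipalBundle IB EG G P]
    (e e' : Trivialization G (π G P)) [he : MemTrivializationAtlas e]
    [he' : MemTrivializationAtlas e'] :
    ∃ f : B → LieAlg EG G →L[ℂ] LieAlg EG G, ContMDiffOn IB 𝓘(ℂ, LieAlg EG G →L[ℂ] LieAlg EG G) ω f (e.baseSet ∩ e'.baseSet) ∧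
      ∀ (b : B) (_ : b ∈ e.baseSet ∩ e'.baseSet) (v : LieAlg EG G),
        f b v = (adPretrivialization (IB := IB) (EG := EG) e'
          ⟨b, (adPretrivialization (IB := IB) (EG := EG) e).symm b v⟩).2 := by
  refine ⟨fun x => Ad EG (e (e'.toOpenPartialHomeomorph.symm (x, 1))).2⁻¹,
    ?_, ?_⟩
  · have h := (hP.holomorphic e' e).inv
    rw [inter_comm] at h
    exact (contMDiff_Ad (EG := EG) (G := G)).comp_contMDiffOn h
  · intro x hx v
    refine Eq.trans ?_ (adPretrivialization_symm (IB := IB) (EG := EG) e hx.1 v _).symm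
    rw [e'.mk_symm hx.2]

variable (IB EG G P) in
/-- The local trivializations of `ad P`. -/
def adPrebundle [hP : IsHolomorphicPrincipalBundle IB EG G P] :
    VectorPrebundle ℂ (LieAlg EG G) (fun x => adFibre EG G P x) where
  pretrivializationAtlas := {a | ∃ (e : Trivialization G (π G P)) (_ : MemTrivializationAtlas e),
    a = adPretrivialization (IB := IB) (EG := EG) e}
  pretrivialization_linear' := by
    rintro _ ⟨e, he, rfl⟩
    exact ⟨fun b hb => ⟨fun _ _ => rfl, fun _ _ => rfl⟩⟩
  pretrivializationAt x := adPretrivialization (IB := IB) (EG := EG) (trivializationAt G P x)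
  mem_base_pretrivializationAt x := mem_baseSet_trivializationAt G P x
  pretrivialization_mem_atlas x := ⟨_, inferInstance, rfl⟩
  exists_coordChange := by
    rintro _ ⟨e, he, rfl⟩ _ ⟨e', he', rfl⟩
    obtain ⟨f, hf, h⟩ := ad_coordChange (IB := IB) (EG := EG) e e'
    exact ⟨f, hf.continuousOn, fun b hb v => h b hb v⟩
  totalSpaceMk_isInducing x := by
    let e := trivializationAt G P x
    have hx : x ∈ e.baseSet := mem_baseSet_trivializationAt G P x
    refine IsInducing.of_comp (g := fun y : B × LieAlg EG G => fun p : P x =>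
      (Ad EG (e ⟨x, p⟩).2⁻¹ y.2 : LieAlg EG G)) ?_ ?_ ?_
    · refine continuous_const.prodMk ?_
      exact (continuous_apply (e.symm x (1 : G))).comp continuous_subtype_val
    · exact continuous_pi fun p => (Ad EG (e ⟨x, p⟩).2⁻¹).continuous.comp continuous_snd
    · convert! (IsInducing.subtypeVal : IsInducing (fun ξ : adFibre EG G P x => ξ.1)) using 1
      funext ξ p
      conv_rhs => rw [eq_smul_sec (IB := IB) (EG := EG) e hx p]
      exact (ξ.2 _ _).symm


variable (EG G P) in
/-- The fibre of `ad P`. The argument `_IB` has no mathematical meaning: it only lets instance search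
find the model `IB` in the holomorphic structure of `ad P`. -/
def adBundle (_IB : ModelWithCorners ℂ EB HB) (x : B) : Type _ := adFibre EG G P x

instance (x : B) : AddCommGroup (adBundle EG G P IB x) := inferInstanceAs (AddCommGroup (adFibre EG G P x))
instance (x : B) : Module ℂ (adBundle EG G P IB x) := inferInstanceAs (Module ℂ (adFibre EG G P x))
instance (x : B) : TopologicalSpace (adBundle EG G P IB x) :=
  inferInstanceAs (TopologicalSpace (adFibre EG G P x))
instance (x : B) : IsTopologicalAddGroup (adBundle EG G P IB x) :=
  inferInstanceAs (IsTopologicalAddGroup (adFibre EG G P x))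
instance (x : B) : ContinuousSMul ℂ (adBundle EG G P IB x) :=
  inferInstanceAs (ContinuousSMul ℂ (adFibre EG G P x))

variable [hP : IsHolomorphicPrincipalBundle IB EG G P]

instance : TopologicalSpace (TotalSpace (LieAlg EG G) (adBundle EG G P IB)) :=
  (adPrebundle IB EG G P).totalSpaceTopology

instance : FiberBundle (LieAlg EG G) (adBundle EG G P IB) :=
  (adPrebundle IB EG G P).toFiberBundle

instance : VectorBundle ℂ (LieAlg EG G) (adBundle EG G P IB) :=
  (adPrebundle IB EG G P).toVectorBundle

instance : ContMDiffVectorBundle ω (LieAlg EG G) (adBundle EG G P IB) IB :=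
  have : (adPrebundle IB EG G P).IsContMDiff IB ω := ⟨by
    rintro _ ⟨e, he, rfl⟩ _ ⟨e', he', rfl⟩
    exact ad_coordChange (IB := IB) (EG := EG) e e'⟩
  VectorPrebundle.contMDiffVectorBundle (IB := IB) (n := ω) (adPrebundle IB EG G P)

end AdBundle

section CBundle
variable {EB : Type*} [NormedAddCommGroup EB] [NormedSpace ℂ EB] {HB : Type*} [TopologicalSpace HB]
  {IB : ModelWithCorners ℂ EB HB} {B : Type*} [TopologicalSpace B] [ChartedSpace HB B]
  {EG : Type*} [NormedAddCommGroup EG] [NormedSpace ℂ EG]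
  {G : Type*} [TopologicalSpace G] [ChartedSpace EG G] [Group G] [LieGroup 𝓘(ℂ, EG) ω G]
  {P : B → Type*} [TopologicalSpace (TotalSpace G P)] [∀ x, TopologicalSpace (P x)]
  [∀ x, Nonempty (P x)]
  [FiberBundle G P] [∀ x, MulAction Gᵐᵒᵖ (P x)]
  [hP : IsHolomorphicPrincipalBundle IB EG G P] [IsManifold IB ω B]

variable (IB EG) in
/-- The Lie algebra component, at the point where `e` takes the value `1`, of a tangent vector. -/
def theta (e : Trivialization G (π G P)) (x : B) :
    TangentSpace (IB.prod 𝓘(ℂ, EG)) (⟨x, e.symm x (1 : G)⟩ : TotalSpace G P) →L[ℂ] LieAlg EG G :=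
  mfderiv (IB.prod 𝓘(ℂ, EG)) 𝓘(ℂ, EG) (fun z : TotalSpace G P => (e z).2) ⟨x, e.symm x (1 : G)⟩

variable (IB EG) in
/-- The tangent vector with given components in the local trivialization `e`. -/
def thetaSymm (e : Trivialization G (π G P)) (x : B) :
    EB × LieAlg EG G →L[ℂ]
      TangentSpace (IB.prod 𝓘(ℂ, EG)) (⟨x, e.symm x (1 : G)⟩ : TotalSpace G P) :=
  mfderiv (IB.prod 𝓘(ℂ, EG)) (IB.prod 𝓘(ℂ, EG)) e.toOpenPartialHomeomorph.symm (x, (1 : G))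

theorem sec_eq (e : Trivialization G (π G P)) {x : B} (hx : x ∈ e.baseSet) :
    (⟨x, e.symm x (1 : G)⟩ : TotalSpace G P) = e.toOpenPartialHomeomorph.symm (x, 1) :=
  e.mk_symm hx 1

theorem mfderiv_triv (e : Trivialization G (π G P)) [MemTrivializationAtlas e] {x : B}
    (hx : x ∈ e.baseSet)
    (v : TangentSpace (IB.prod 𝓘(ℂ, EG)) (⟨x, e.symm x (1 : G)⟩ : TotalSpace G P)) :
    mfderiv (IB.prod 𝓘(ℂ, EG)) (IB.prod 𝓘(ℂ, EG)) e ⟨x, e.symm x (1 : G)⟩ v =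
      ((mfderiv (IB.prod 𝓘(ℂ, EG)) IB (π G P) ⟨x, e.symm x (1 : G)⟩ v, theta IB EG e x v) :
        EB × LieAlg EG G) := by
  have hd := (contMDiffAt_triv (IB := IB) (EG := EG) e
    (z := ⟨x, e.symm x (1 : G)⟩) hx).mdifferentiableAt (by simp)
  have h1 := mfderiv_comp (I' := IB.prod 𝓘(ℂ, EG)) (I'' := IB)
    (⟨x, e.symm x (1 : G)⟩ : TotalSpace G P) mdifferentiableAt_fst hd
  have h2 := mfderiv_comp (I' := IB.prod 𝓘(ℂ, EG)) (I'' := 𝓘(ℂ, EG))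
    (⟨x, e.symm x (1 : G)⟩ : TotalSpace G P) mdifferentiableAt_snd hd
  rw [mfderiv_fst] at h1
  rw [mfderiv_snd] at h2
  have h3 : (Prod.fst ∘ e : TotalSpace G P → B) =ᶠ[𝓝 ⟨x, e.symm x (1 : G)⟩] π G P := by
    filter_upwards [e.open_source.mem_nhds
      ((e.mem_source (x := ⟨x, e.symm x (1 : G)⟩)).2 hx)] with z hz
    exact e.coe_fst hz
  have h4 := h3.mfderiv_eq (I := IB.prod 𝓘(ℂ, EG)) (I' := IB)
  refine Prod.ext ?_ ?_
  · refine (congrArg (fun L => L v) h1).symm.trans ?_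
    exact congrArg (fun L : _ →L[ℂ] EB => L v) h4
  · exact (congrArg (fun L => L v) h2).symm

theorem thetaSymm_left (e : Trivialization G (π G P)) [MemTrivializationAtlas e] {x : B}
    (hx : x ∈ e.baseSet)
    (v : TangentSpace (IB.prod 𝓘(ℂ, EG)) (⟨x, e.symm x (1 : G)⟩ : TotalSpace G P)) :
    thetaSymm IB EG e x (mfderiv (IB.prod 𝓘(ℂ, EG)) IB (π G P) ⟨x, e.symm x (1 : G)⟩ v,
      theta IB EG e x v) = v := by
  have hd := (contMDiffAt_triv (IB := IB) (EG := EG) e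
    (z := ⟨x, e.symm x (1 : G)⟩) hx).mdifferentiableAt (by simp)
  have he : e ⟨x, e.symm x (1 : G)⟩ = (x, 1) := e.apply_mk_symm hx 1
  have hd' := (contMDiffAt_triv_symm (IB := IB) (EG := EG) e
    (z := e ⟨x, e.symm x (1 : G)⟩) (by rw [he]; exact hx)).mdifferentiableAt (by simp)
  have h1 := mfderiv_comp (I := IB.prod 𝓘(ℂ, EG)) (I' := IB.prod 𝓘(ℂ, EG))
    (I'' := IB.prod 𝓘(ℂ, EG)) (⟨x, e.symm x (1 : G)⟩ : TotalSpace G P) hd' hd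
  have h3 : (e.toOpenPartialHomeomorph.symm ∘ e : TotalSpace G P → TotalSpace G P)
      =ᶠ[𝓝 ⟨x, e.symm x (1 : G)⟩] id := by
    filter_upwards [e.open_source.mem_nhds
      ((e.mem_source (x := ⟨x, e.symm x (1 : G)⟩)).2 hx)] with z hz
    exact e.left_inv hz
  have h4 := h3.mfderiv_eq (I := IB.prod 𝓘(ℂ, EG)) (I' := IB.prod 𝓘(ℂ, EG))
  have h5 := congrArg (fun L : (EB × EG) →L[ℂ] (EB × EG) => L v) (h1.symm.trans h4)
  rw [mfderiv_id] at h5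
  have h6 : ∀ (w : B × G) (_ : w = (x, 1)) (u : EB × EG),
      (mfderiv (IB.prod 𝓘(ℂ, EG)) (IB.prod 𝓘(ℂ, EG)) e.toOpenPartialHomeomorph.symm w u : EB × EG) =
        thetaSymm IB EG e x u := by
    rintro _ rfl u; rfl
  have h7 := (h6 _ he (mfderiv (IB.prod 𝓘(ℂ, EG)) (IB.prod 𝓘(ℂ, EG)) e
    ⟨x, e.symm x (1 : G)⟩ v)).symm.trans h5
  have h8 := congrArg (fun u : EB × LieAlg EG G => thetaSymm IB EG e x u)
    (mfderiv_triv (IB := IB) (EG := EG) e hx v)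
  exact h8.symm.trans h7

theorem thetaSymm_right (e : Trivialization G (π G P)) [MemTrivializationAtlas e] {x : B}
    (hx : x ∈ e.baseSet) (u : EB × LieAlg EG G) :
    mfderiv (IB.prod 𝓘(ℂ, EG)) IB (π G P) ⟨x, e.symm x (1 : G)⟩ (thetaSymm IB EG e x u) = u.1 ∧
      theta IB EG e x (thetaSymm IB EG e x u) = u.2 := by
  have hs := sec_eq e hx
  have hd := (contMDiffAt_triv (IB := IB) (EG := EG) e
    (z := e.toOpenPartialHomeomorph.symm (x, 1)) (by rw [← hs]; exact hx)).mdifferentiableAt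
      (by simp)
  have hd' := (contMDiffAt_triv_symm (IB := IB) (EG := EG) e
    (z := (x, 1)) hx).mdifferentiableAt (by simp)
  have h1 := mfderiv_comp (I := IB.prod 𝓘(ℂ, EG)) (I' := IB.prod 𝓘(ℂ, EG))
    (I'' := IB.prod 𝓘(ℂ, EG)) (x, (1 : G)) hd hd'
  have h3 : (e ∘ e.toOpenPartialHomeomorph.symm : B × G → B × G) =ᶠ[𝓝 (x, 1)] id := by
    filter_upwards [e.open_target.mem_nhds (e.mem_target.2 (show (x, (1 : G)).1 ∈ e.baseSet from hx))]
      with z hz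
    exact e.right_inv hz
  have h4 := h3.mfderiv_eq (I := IB.prod 𝓘(ℂ, EG)) (I' := IB.prod 𝓘(ℂ, EG))
  have h5 := congrArg (fun L : (EB × EG) →L[ℂ] (EB × EG) => L u) (h1.symm.trans h4)
  rw [mfderiv_id] at h5
  have h6 : ∀ (w : TotalSpace G P) (_ : (⟨x, e.symm x (1 : G)⟩ : TotalSpace G P) = w) (u : EB × EG),
      (mfderiv (IB.prod 𝓘(ℂ, EG)) (IB.prod 𝓘(ℂ, EG)) e w u : EB × EG) =
      mfderiv (IB.prod 𝓘(ℂ, EG)) (IB.prod 𝓘(ℂ, EG)) e ⟨x, e.symm x (1 : G)⟩ u := by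
    rintro _ rfl u; rfl
  have h7 := (h6 _ hs (thetaSymm IB EG e x u)).symm.trans h5
  have h8 := (mfderiv_triv (IB := IB) (EG := EG) e hx (thetaSymm IB EG e x u)).symm.trans h7
  exact ⟨congrArg (fun u : EB × LieAlg EG G => u.1) h8,
    congrArg (fun u : EB × LieAlg EG G => u.2) h8⟩

theorem rightMulDeriv_congr {g : G} {z z' : TotalSpace G P} (h : z = z') (v : EB × EG) :
    (rightMulDeriv IB EG g z v : EB × EG) = (rightMulDeriv IB EG g z' v : EB × EG) := by
  subst h; rfl

theorem mfderiv_proj_rightMulDeriv (g : G) (z : TotalSpace G P)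
    (v : TangentSpace (IB.prod 𝓘(ℂ, EG)) z) :
    mfderiv (IB.prod 𝓘(ℂ, EG)) IB (π G P) (rightMul g z) (rightMulDeriv IB EG g z v) =
      mfderiv (IB.prod 𝓘(ℂ, EG)) IB (π G P) z v := by
  have h1 := mfderiv_comp (I := IB.prod 𝓘(ℂ, EG)) (I' := IB.prod 𝓘(ℂ, EG)) (I'' := IB) z
    ((contMDiff_projP (IB := IB) (EG := EG) (P := P)).mdifferentiableAt (by simp))
    ((contMDiff_rightMul (IB := IB) (EG := EG) (P := P) g).mdifferentiableAt (by simp))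
  exact (congrArg (fun L : _ →L[ℂ] EB => L v) h1).symm

/-- The invariant extension of a tangent vector to the fibre. -/
def atExtend (e : Trivialization G (π G P)) [MemTrivializationAtlas e] {x : B}
    (hx : x ∈ e.baseSet) :
    TangentSpace (IB.prod 𝓘(ℂ, EG)) (⟨x, e.symm x (1 : G)⟩ : TotalSpace G P) →ₗ[ℂ]
      atFibre IB EG (G := G) P x where
  toFun u := ⟨fun p => rightMulDeriv IB EG (e ⟨x, p⟩).2 ⟨x, e.symm x (1 : G)⟩ u, fun p g => by
    beta_reduce
    rw [hP.equivariant e x hx]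
    refine (rightMulDeriv_mul (IB := IB) (EG := EG) _ g _ u).trans ?_
    refine rightMulDeriv_congr (IB := IB) (EG := EG) ?_ _
    exact congrArg (TotalSpace.mk x) (eq_smul_sec (IB := IB) (EG := EG) e hx p).symm⟩
  map_add' u v := by
    apply Subtype.ext; funext p
    exact map_add (rightMulDeriv IB EG (e ⟨x, p⟩).2 ⟨x, e.symm x (1 : G)⟩) u v
  map_smul' c u := by
    apply Subtype.ext; funext p
    exact map_smul (rightMulDeriv IB EG (e ⟨x, p⟩).2 ⟨x, e.symm x (1 : G)⟩) c u

theorem atExtend_sec (e : Trivialization G (π G P)) [MemTrivializationAtlas e] {x : B}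
    (hx : x ∈ e.baseSet)
    (u : TangentSpace (IB.prod 𝓘(ℂ, EG)) (⟨x, e.symm x (1 : G)⟩ : TotalSpace G P)) :
    (atExtend e hx u).1 (e.symm x (1 : G)) = u := by
  have h1 : e ⟨x, e.symm x (1 : G)⟩ = (x, 1) := e.apply_mk_symm hx 1
  have h2 : ∀ k : G, k = 1 → (rightMulDeriv IB EG k ⟨x, e.symm x (1 : G)⟩ u : EB × EG) = u := by
    rintro _ rfl; exact rightMulDeriv_one (IB := IB) (EG := EG) _ u
  exact h2 _ (by rw [h1])

theorem atFibre_ext (e : Trivialization G (π G P)) [MemTrivializationAtlas e] {x : B}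
    (hx : x ∈ e.baseSet) {v w : atFibre IB EG (G := G) P x}
    (h : v.1 (e.symm x (1 : G)) = w.1 (e.symm x (1 : G))) : v = w := by
  apply Subtype.ext; funext p
  rw [eq_smul_sec (IB := IB) (EG := EG) e hx p, v.2, w.2, h]

theorem mfderiv_proj_atExtend (e : Trivialization G (π G P)) [MemTrivializationAtlas e] {x : B}
    (hx : x ∈ e.baseSet)
    (u : TangentSpace (IB.prod 𝓘(ℂ, EG)) (⟨x, e.symm x (1 : G)⟩ : TotalSpace G P)) (p : P x) :
    mfderiv (IB.prod 𝓘(ℂ, EG)) IB (π G P) ⟨x, p⟩ ((atExtend e hx u).1 p) =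
      mfderiv (IB.prod 𝓘(ℂ, EG)) IB (π G P) ⟨x, e.symm x (1 : G)⟩ u := by
  refine Eq.trans ?_ (mfderiv_proj_rightMulDeriv (IB := IB) (EG := EG) (e ⟨x, p⟩).2
    ⟨x, e.symm x (1 : G)⟩ u)
  have h6 : ∀ (z z' : TotalSpace G P) (_ : z = z') (u : EB × EG),
      (mfderiv (IB.prod 𝓘(ℂ, EG)) IB (π G P) z u : EB) =
        mfderiv (IB.prod 𝓘(ℂ, EG)) IB (π G P) z' u := by
    rintro _ _ rfl u; rfl
  exact h6 _ _ (congrArg (TotalSpace.mk x) (eq_smul_sec (IB := IB) (EG := EG) e hx p)) _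



variable [FiniteDimensional ℂ EB] {lam : ℂ}

/-- The local coordinate of an element `h` of `C_λ(P)_x` in `EB →L[ℂ] 𝔤`: the Lie algebra component
of `h` in the local trivialization `e` of `P`, where tangent vectors of `B` at `x` are read in the
trivialization of the tangent bundle at `x₀`. -/
def cCoord (e : Trivialization G (π G P)) (x₀ : B) {x : B} (h : CFibre IB EG G P lam x) :
    EB →L[ℂ] LieAlg EG G :=
  LinearMap.toContinuousLinearMap ((theta IB EG e x).toLinearMap ∘ₗ
    LinearMap.proj (R := ℂ)
      (φ := fun p : P x => TangentSpace (IB.prod 𝓘(ℂ, EG)) (⟨x, p⟩ : TotalSpace G P))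
      (e.symm x (1 : G)) ∘ₗ
    (atFibre IB EG (G := G) P x).subtype ∘ₗ h.1 ∘ₗ
      ((trivializationAt EB (TangentSpace IB) x₀).symmL ℂ x).toLinearMap)

theorem cCoord_apply (e : Trivialization G (π G P)) (x₀ : B) {x : B} (h : CFibre IB EG G P lam x)
    (w : EB) : cCoord e x₀ h w = theta IB EG e x
      ((h.1 ((trivializationAt EB (TangentSpace IB) x₀).symmL ℂ x w)).1 (e.symm x (1 : G))) := rfl

/-- The element of `C_λ(P)_x` with a given local coordinate. -/
def cOfCoord (lam : ℂ) (e : Trivialization G (π G P)) [MemTrivializationAtlas e] (x₀ : B) {x : B}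
    (hx : x ∈ e.baseSet) (a : EB →L[ℂ] LieAlg EG G) : CFibre IB EG G P lam x :=
  ⟨atExtend e hx ∘ₗ (thetaSymm IB EG e x).toLinearMap ∘ₗ
    LinearMap.prod (lam • (LinearMap.id : EB →ₗ[ℂ] EB))
      (a.comp ((trivializationAt EB (TangentSpace IB) x₀).continuousLinearMapAt ℂ x)).toLinearMap,
    fun w p => (mfderiv_proj_atExtend e hx _ p).trans (thetaSymm_right e hx _).1⟩

theorem cOfCoord_sec (e : Trivialization G (π G P)) [MemTrivializationAtlas e] (x₀ : B) {x : B}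
    (hx : x ∈ e.baseSet) (a : EB →L[ℂ] LieAlg EG G) (w : TangentSpace IB x) :
    ((cOfCoord lam e x₀ hx a).1 w).1 (e.symm x (1 : G)) = thetaSymm IB EG e x
      ((lam • w : EB), a ((trivializationAt EB (TangentSpace IB) x₀).continuousLinearMapAt ℂ x w)) :=
  atExtend_sec e hx _

theorem cCoord_cOfCoord (e : Trivialization G (π G P)) [MemTrivializationAtlas e] (x₀ : B) {x : B}
    (hx : x ∈ e.baseSet) (hx' : x ∈ (trivializationAt EB (TangentSpace IB) x₀).baseSet)
    (a : EB →L[ℂ] LieAlg EG G) :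
    cCoord e x₀ (cOfCoord (IB := IB) lam e x₀ hx a) = a := by
  ext w
  rw [cCoord_apply, cOfCoord_sec, (thetaSymm_right e hx _).2]
  exact congrArg a (Trivialization.continuousLinearMapAt_symmL _ hx' w)

theorem cOfCoord_cCoord (e : Trivialization G (π G P)) [MemTrivializationAtlas e] (x₀ : B) {x : B}
    (hx : x ∈ e.baseSet) (hx' : x ∈ (trivializationAt EB (TangentSpace IB) x₀).baseSet)
    (h : CFibre IB EG G P lam x) :
    cOfCoord lam e x₀ hx (cCoord e x₀ h) = h := by
  apply Subtype.ext
  apply LinearMap.ext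
  intro w
  apply atFibre_ext e hx
  rw [cOfCoord_sec, cCoord_apply, Trivialization.symmL_continuousLinearMapAt _ hx' w]
  have := h.2 w (e.symm x (1 : G))
  have h2 := thetaSymm_left (IB := IB) (EG := EG) e hx ((h.1 w).1 (e.symm x (1 : G)))
  rw [this] at h2
  exact h2

instance (x : B) : Nonempty (CFibre IB EG G P lam x) :=
  ⟨cOfCoord lam (trivializationAt G P x) x (mem_baseSet_trivializationAt G P x) 0⟩

open Classical in
/-- The local trivialization of `C_λ(P)` given by the local coordinate. -/
def cPretrivialization (lam : ℂ) (e : Trivialization G (π G P)) [he : MemTrivializationAtlas e]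
    (x₀ : B) :
    Pretrivialization (EB →L[ℂ] LieAlg EG G)
      (π (EB →L[ℂ] LieAlg EG G) (CFibre IB EG G P lam)) where
  toFun z := (z.1, cCoord e x₀ z.2)
  invFun y := ⟨y.1, if h : y.1 ∈ e.baseSet then cOfCoord lam e x₀ h y.2 else
    Classical.choice inferInstance⟩
  source := π (EB →L[ℂ] LieAlg EG G) (CFibre IB EG G P lam) ⁻¹'
    (e.baseSet ∩ (trivializationAt EB (TangentSpace IB) x₀).baseSet)
  target := (e.baseSet ∩ (trivializationAt EB (TangentSpace IB) x₀).baseSet) ×ˢ univ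
  map_source' z hz := ⟨hz, mem_univ _⟩
  map_target' y hy := hy.1
  left_inv' := by
    rintro ⟨x, h⟩ hx
    have hx' : x ∈ e.baseSet := hx.1
    simp only [dif_pos hx']
    congr 1
    exact cOfCoord_cCoord e x₀ hx' hx.2 h
  right_inv' := by
    rintro ⟨x, v⟩ ⟨hx, -⟩
    have hx' : x ∈ e.baseSet := hx.1
    simp only [dif_pos hx']
    exact Prod.ext rfl (cCoord_cOfCoord e x₀ hx' hx.2 v)
  open_target := (e.open_baseSet.inter (trivializationAt EB (TangentSpace IB) x₀).open_baseSet).prod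
    isOpen_univ
  baseSet := e.baseSet ∩ (trivializationAt EB (TangentSpace IB) x₀).baseSet
  open_baseSet := e.open_baseSet.inter (trivializationAt EB (TangentSpace IB) x₀).open_baseSet
  source_eq := rfl
  target_eq := rfl
  proj_toFun _ _ := rfl

theorem cPretrivialization_symm (e : Trivialization G (π G P)) [he : MemTrivializationAtlas e]
    (x₀ : B) {x : B} (hx : x ∈ e.baseSet) (a : EB →L[ℂ] LieAlg EG G) :
    (cPretrivialization (IB := IB) (EG := EG) lam e x₀).toPartialEquiv.symm (x, a) =
      ⟨x, cOfCoord lam e x₀ hx a⟩ := by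
  change TotalSpace.mk x _ = _
  simp only [dif_pos hx]

/-- The derivative of a transition function, right translated to the identity. -/
def maurer (e e' : Trivialization G (π G P)) (x : B) : TangentSpace IB x →L[ℂ] LieAlg EG G :=
  mfderiv IB 𝓘(ℂ, EG) (fun y => (e' (e.toOpenPartialHomeomorph.symm (y, 1))).2 *
    (e' (e.toOpenPartialHomeomorph.symm (x, 1))).2⁻¹) x

theorem triv_rightMul_eq [hP : IsHolomorphicPrincipalBundle IB EG G P] (e e' : Trivialization G (π G P)) [MemTrivializationAtlas e]
    [MemTrivializationAtlas e'] (k : G) {z : TotalSpace G P} (hz : z.1 ∈ e.baseSet)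
    (hz' : z.1 ∈ e'.baseSet) :
    (e' (rightMul k z)).2 = (e' (e.toOpenPartialHomeomorph.symm (z.1, 1))).2 * (e z).2 * k := by
  have h1 := hP.equivariant e' z.1 hz' z.2 k
  refine h1.trans ?_
  congr 1
  have h2 := trivChange_eq (IB := IB) (EG := EG) e e' hz hz' (e z).2
  have h3 : (z.1, (e z).2) = e z := Prod.ext (e.coe_fst' hz).symm rfl
  rw [h3] at h2
  have h4 : e.toOpenPartialHomeomorph.symm (e z) = z := e.left_inv (e.mem_source.2 hz)
  rw [h4] at h2
  exact congrArg Prod.snd h2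

theorem theta_change (e e' : Trivialization G (π G P)) [MemTrivializationAtlas e]
    [MemTrivializationAtlas e'] {x : B} (hx : x ∈ e.baseSet) (hx' : x ∈ e'.baseSet)
    (v : atFibre IB EG (G := G) P x) :
    theta IB EG e' x (v.1 (e'.symm x (1 : G))) =
      maurer (IB := IB) (EG := EG) e e' x (mfderiv (IB.prod 𝓘(ℂ, EG)) IB (π G P)
          ⟨x, e.symm x (1 : G)⟩ (v.1 (e.symm x (1 : G)))) +
        Ad EG (e' (e.toOpenPartialHomeomorph.symm (x, 1))).2
          (theta IB EG e x (v.1 (e.symm x (1 : G)))) := by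
  set g : B → G := fun y => (e' (e.toOpenPartialHomeomorph.symm (y, 1))).2 with hg
  have he1 : e ⟨x, e.symm x (1 : G)⟩ = (x, 1) := e.apply_mk_symm hx 1
  -- the second base point
  have hs : MulOpposite.op (g x)⁻¹ • e.symm x (1 : G) = e'.symm x (1 : G) := by
    have h1 := eq_smul_sec (IB := IB) (EG := EG) e' hx'
      (MulOpposite.op (g x)⁻¹ • e.symm x (1 : G))
    have h2 : (e' ⟨x, MulOpposite.op (g x)⁻¹ • e.symm x (1 : G)⟩).2 = 1 := by
      refine (hP.equivariant e' x hx' _ _).trans ?_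
      rw [sec_eq e hx]
      exact mul_inv_cancel _
    rw [h2, MulOpposite.op_one, one_smul] at h1
    exact h1
  have hv : ∀ q : P x, MulOpposite.op (g x)⁻¹ • e.symm x (1 : G) = q →
      (mfderiv (IB.prod 𝓘(ℂ, EG)) 𝓘(ℂ, EG) (fun z : TotalSpace G P => (e' z).2) ⟨x, q⟩ (v.1 q) : EG)
      = mfderiv (IB.prod 𝓘(ℂ, EG)) 𝓘(ℂ, EG) (fun z : TotalSpace G P => (e' z).2)
        (rightMul (g x)⁻¹ ⟨x, e.symm x (1 : G)⟩)
        (rightMulDeriv IB EG (g x)⁻¹ ⟨x, e.symm x (1 : G)⟩ (v.1 (e.symm x (1 : G)))) := by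
    rintro _ rfl
    rw [v.2]
    rfl
  refine (hv _ hs).trans ?_
  -- chain rule
  have hd1 : MDifferentiableAt (IB.prod 𝓘(ℂ, EG)) 𝓘(ℂ, EG) (fun z : TotalSpace G P => (e' z).2)
      (rightMul (g x)⁻¹ ⟨x, e.symm x (1 : G)⟩) :=
    (contMDiffAt_snd.comp _ (contMDiffAt_triv (IB := IB) (EG := EG) e'
      (z := rightMul (g x)⁻¹ ⟨x, e.symm x (1 : G)⟩) hx')).mdifferentiableAt (n := ω) (by simp)
  have c1 := mfderiv_comp (I := IB.prod 𝓘(ℂ, EG)) (I' := IB.prod 𝓘(ℂ, EG)) (I'' := 𝓘(ℂ, EG))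
    (⟨x, e.symm x (1 : G)⟩ : TotalSpace G P) hd1
    ((contMDiff_rightMul (IB := IB) (EG := EG) (P := P) (g x)⁻¹).mdifferentiableAt (by simp))
  refine (congrArg (fun L : (EB × EG) →L[ℂ] EG => L (v.1 (e.symm x (1 : G)))) c1).symm.trans ?_
  -- rewrite through `e`
  let Φ : B × G → G := fun a => g a.1 * a.2 * (g x)⁻¹
  have hΦ : (fun z : TotalSpace G P => (e' z).2) ∘ rightMul (g x)⁻¹
      =ᶠ[𝓝 ⟨x, e.symm x (1 : G)⟩] Φ ∘ e := by
    filter_upwards [e.open_source.mem_nhds ((e.mem_source (x := ⟨x, e.symm x (1 : G)⟩)).2 hx),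
      e'.open_source.mem_nhds ((e'.mem_source (x := ⟨x, e.symm x (1 : G)⟩)).2 hx')] with z hz hz'
    have h1 := triv_rightMul_eq (IB := IB) (EG := EG) e e' (g x)⁻¹ (e.mem_source.1 hz)
      (e'.mem_source.1 hz')
    refine h1.trans ?_
    simp only [Φ, Function.comp, hg]
    rw [e.coe_fst hz]
  have hgd : ContMDiffAt IB 𝓘(ℂ, EG) ω g x := (hP.holomorphic e e').contMDiffAt
    ((e.open_baseSet.inter e'.open_baseSet).mem_nhds ⟨hx, hx'⟩)
  have hΦd : MDifferentiableAt (IB.prod 𝓘(ℂ, EG)) 𝓘(ℂ, EG) Φ (x, (1 : G)) := by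
    have : ContMDiffAt (IB.prod 𝓘(ℂ, EG)) 𝓘(ℂ, EG) ω Φ (x, (1 : G)) :=
      ((ContMDiffAt.comp (x, (1 : G)) hgd contMDiffAt_fst).mul contMDiffAt_snd).mul contMDiffAt_const
    exact this.mdifferentiableAt (by simp)
  have hd := (contMDiffAt_triv (IB := IB) (EG := EG) e
    (z := ⟨x, e.symm x (1 : G)⟩) hx).mdifferentiableAt (by simp)
  have c2 := hΦ.mfderiv_eq (I := IB.prod 𝓘(ℂ, EG)) (I' := 𝓘(ℂ, EG))
  have c3 := mfderiv_comp_of_eq (I := IB.prod 𝓘(ℂ, EG)) (I' := IB.prod 𝓘(ℂ, EG))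
    (I'' := 𝓘(ℂ, EG)) hΦd hd he1
  refine (congrArg (fun L : (EB × EG) →L[ℂ] EG => L (v.1 (e.symm x (1 : G)))) (c2.trans c3)).trans ?_
  have c4 := mfderiv_triv (IB := IB) (EG := EG) e hx (v.1 (e.symm x (1 : G)))
  have c5 : ∀ (a : B × G) (_ : a = (x, 1)) (u : EB × EG),
      (mfderiv (IB.prod 𝓘(ℂ, EG)) 𝓘(ℂ, EG) Φ a u : EG) =
        mfderiv (IB.prod 𝓘(ℂ, EG)) 𝓘(ℂ, EG) Φ (x, (1 : G)) u := by
    rintro _ rfl u; rfl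
  refine (c5 _ he1 _).trans ?_
  refine (congrArg (fun u : EB × EG => (mfderiv (IB.prod 𝓘(ℂ, EG)) 𝓘(ℂ, EG) Φ (x, (1 : G)) u : EG))
    c4).trans ?_
  refine (mfderiv_prod_eq_add_apply hΦd).trans ?_
  have k1 : (fun y : B => Φ (y, (x, (1 : G)).2)) = fun y => g y * (g x)⁻¹ := by
    funext y; simp [Φ]
  have k2 : (fun k : G => Φ ((x, (1 : G)).1, k)) = fun k => g x * k * (g x)⁻¹ := rfl
  rw [k1, k2]
  rfl

theorem cCoord_change (e e' : Trivialization G (π G P)) [MemTrivializationAtlas e]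
    [MemTrivializationAtlas e'] (x₀ x₁ : B) {x : B} (hx : x ∈ e.baseSet) (hx' : x ∈ e'.baseSet)
    (a : EB →L[ℂ] LieAlg EG G) :
    cCoord e' x₁ (cOfCoord (IB := IB) lam e x₀ hx a) =
      lam • (maurer (IB := IB) (EG := EG) e e' x).comp
          ((trivializationAt EB (TangentSpace IB) x₁).symmL ℂ x) +
      (Ad EG (e' (e.toOpenPartialHomeomorph.symm (x, 1))).2).comp (a.comp
        (((trivializationAt EB (TangentSpace IB) x₀).continuousLinearMapAt ℂ x).comp
          ((trivializationAt EB (TangentSpace IB) x₁).symmL ℂ x))) := by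
  ext w
  rw [cCoord_apply, theta_change (IB := IB) (EG := EG) e e' hx hx', cOfCoord_sec,
    (thetaSymm_right e hx _).2, (thetaSymm_right e hx _).1]
  refine congrArg₂ (· + ·) ?_ rfl
  exact map_smul (maurer (IB := IB) (EG := EG) e e' x) lam _

theorem contMDiffOn_tangentChange (x₀ x₁ : B) :
    ContMDiffOn IB 𝓘(ℂ, EB →L[ℂ] EB) ω
      (fun x => (((trivializationAt EB (TangentSpace IB) x₀).continuousLinearMapAt ℂ x).comp
          ((trivializationAt EB (TangentSpace IB) x₁).symmL ℂ x) : EB →L[ℂ] EB))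
      ((trivializationAt EB (TangentSpace IB) x₀).baseSet ∩
        (trivializationAt EB (TangentSpace IB) x₁).baseSet) := by
  have : IsManifold IB (ω + 1) B := inferInstanceAs (IsManifold IB ω B)
  have : IsManifold IB 1 B := IsManifold.of_le (n := ω) le_top
  have : ContMDiffVectorBundle ω EB (TangentSpace IB : B → Type _) IB :=
    TangentBundle.contMDiffVectorBundle
  have h := contMDiffOn_coordChangeL (n := ω) (IB := IB)
    (trivializationAt EB (TangentSpace IB : B → Type _) x₁)
    (trivializationAt EB (TangentSpace IB) x₀)
  rw [inter_comm] at h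
  refine h.congr ?_
  intro x hx
  ext w
  refine Eq.trans ?_ (Trivialization.coordChangeL_apply (R := ℂ) _ _ ⟨hx.2, hx.1⟩ w).symm
  simp only [ContinuousLinearMap.comp_apply]
  rw [Trivialization.continuousLinearMapAt_apply, Trivialization.linearMapAt_apply, if_pos hx.1,
    Trivialization.symmL_apply _ hx.2]

theorem contMDiffOn_maurer (e e' : Trivialization G (π G P)) [MemTrivializationAtlas e]
    [MemTrivializationAtlas e'] (x₁ : B) :
    ContMDiffOn IB 𝓘(ℂ, EB →L[ℂ] LieAlg EG G) ω
      (fun x => (maurer (IB := IB) (EG := EG) e e' x).comp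
          ((trivializationAt EB (TangentSpace IB) x₁).symmL ℂ x))
      ((e.baseSet ∩ e'.baseSet) ∩ (trivializationAt EB (TangentSpace IB) x₁).baseSet) := by
  rintro y₀ ⟨hy, hy'⟩
  apply ContMDiffAt.contMDiffWithinAt
  have hgd : ContMDiffAt IB 𝓘(ℂ, EG) ω
      (fun y => (e' (e.toOpenPartialHomeomorph.symm (y, 1))).2) y₀ := (hP.holomorphic e e').contMDiffAt
    ((e.open_baseSet.inter e'.open_baseSet).mem_nhds hy)
  have h1 := contMDiffAt_mfderiv_toLie (IB := IB) (IN := IB) (EG := EG)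
    (f := fun x y => (e' (e.toOpenPartialHomeomorph.symm (y, 1))).2 *
      (e' (e.toOpenPartialHomeomorph.symm (x, 1))).2⁻¹) (g := fun x => x) (x₀ := y₀)
    ((ContMDiffAt.comp (y₀, y₀) hgd contMDiffAt_snd).mul
      (ContMDiffAt.comp (y₀, y₀) hgd contMDiffAt_fst).inv)
    contMDiffAt_id (fun x => mul_inv_cancel _)
    (fun x => (maurer (IB := IB) (EG := EG) e e' x : EB →L[ℂ] LieAlg EG G).comp
      ((tangentBundleCore IB B).coordChange (achart HB y₀) (achart HB x) x)) (fun x v => rfl)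
  have h0 : y₀ ∈ (trivializationAt EB (TangentSpace IB) y₀).baseSet :=
    mem_baseSet_trivializationAt EB (TangentSpace IB) y₀
  have h2 := (contMDiffOn_tangentChange (IB := IB) y₀ x₁).contMDiffAt
    (((trivializationAt EB (TangentSpace IB) y₀).open_baseSet.inter
      (trivializationAt EB (TangentSpace IB) x₁).open_baseSet).mem_nhds ⟨h0, hy'⟩)
  refine (h1.clm_comp h2).congr_of_eventuallyEq ?_
  filter_upwards [(trivializationAt EB (TangentSpace IB) y₀).open_baseSet.mem_nhds h0] with x hx
  have hx2 : x ∈ (chartAt HB y₀).source := by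
    rwa [TangentBundle.trivializationAt_baseSet] at hx
  ext w
  change maurer (IB := IB) (EG := EG) e e' x _ = maurer (IB := IB) (EG := EG) e e' x _
  congr 1
  have h3 := congrArg (fun L : EB →L[ℂ] EB => L
    ((trivializationAt EB (TangentSpace IB) y₀).continuousLinearMapAt ℂ x
      ((trivializationAt EB (TangentSpace IB) x₁).symmL ℂ x w)))
    (TangentBundle.symmL_trivializationAt_eq_core (I := IB) hx2)
  refine Eq.trans ?_ h3
  exact (Trivialization.symmL_continuousLinearMapAt _ hx _).symm

theorem cTriv_change (e e' : Trivialization G (π G P)) [MemTrivializationAtlas e]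
    [MemTrivializationAtlas e'] (x₀ x₁ : B) :
    ContMDiffOn (IB.prod 𝓘(ℂ, EB →L[ℂ] LieAlg EG G)) (IB.prod 𝓘(ℂ, EB →L[ℂ] LieAlg EG G)) ω
      (cPretrivialization (IB := IB) (EG := EG) lam e' x₁ ∘
        (cPretrivialization (IB := IB) (EG := EG) lam e x₀).toPartialEquiv.symm)
      ((cPretrivialization (IB := IB) (EG := EG) lam e x₀).target ∩
        (cPretrivialization (IB := IB) (EG := EG) lam e x₀).toPartialEquiv.symm ⁻¹'
          (cPretrivialization (IB := IB) (EG := EG) lam e' x₁).source) := by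
  have hA : ContMDiffOn IB 𝓘(ℂ, LieAlg EG G →L[ℂ] LieAlg EG G) ω
      (fun x => Ad EG (e' (e.toOpenPartialHomeomorph.symm (x, 1))).2) (e.baseSet ∩ e'.baseSet) :=
    (contMDiff_Ad (EG := EG) (G := G)).comp_contMDiffOn (hP.holomorphic e e')
  set S := (cPretrivialization (IB := IB) (EG := EG) lam e x₀).target ∩
        (cPretrivialization (IB := IB) (EG := EG) lam e x₀).toPartialEquiv.symm ⁻¹'
          (cPretrivialization (IB := IB) (EG := EG) lam e' x₁).source with hS
  have hS1 : ∀ z ∈ S, z.1 ∈ e.baseSet ∧ z.1 ∈ e'.baseSet ∧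
      z.1 ∈ (trivializationAt EB (TangentSpace IB) x₀).baseSet ∧
      z.1 ∈ (trivializationAt EB (TangentSpace IB) x₁).baseSet := by
    rintro ⟨x, a⟩ ⟨h1, h2⟩
    exact ⟨h1.1.1, h2.1, h1.1.2, h2.2⟩
  have key : ContMDiffOn (IB.prod 𝓘(ℂ, EB →L[ℂ] LieAlg EG G))
      (IB.prod 𝓘(ℂ, EB →L[ℂ] LieAlg EG G)) ω
      (fun z : B × (EB →L[ℂ] LieAlg EG G) => (z.1,
      lam • (maurer (IB := IB) (EG := EG) e e' z.1).comp
          ((trivializationAt EB (TangentSpace IB) x₁).symmL ℂ z.1) +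
      (Ad EG (e' (e.toOpenPartialHomeomorph.symm (z.1, 1))).2).comp (z.2.comp
        (((trivializationAt EB (TangentSpace IB) x₀).continuousLinearMapAt ℂ z.1).comp
          ((trivializationAt EB (TangentSpace IB) x₁).symmL ℂ z.1))))) S := by
    refine contMDiffOn_fst.prodMk (ContMDiffOn.add ?_ ?_)
    · have h := (contMDiffOn_maurer (IB := IB) (EG := EG) e e' x₁).comp
        (contMDiffOn_fst (I := IB) (J := 𝓘(ℂ, EB →L[ℂ] LieAlg EG G)) (s := S))
        (fun z hz => ⟨⟨(hS1 z hz).1, (hS1 z hz).2.1⟩, (hS1 z hz).2.2.2⟩)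
      exact (lam • ContinuousLinearMap.id ℂ (EB →L[ℂ] LieAlg EG G)).contMDiff.comp_contMDiffOn h
    · refine ContMDiffOn.clm_comp ?_ (ContMDiffOn.clm_comp contMDiffOn_snd ?_)
      · exact hA.comp contMDiffOn_fst (fun z hz => ⟨(hS1 z hz).1, (hS1 z hz).2.1⟩)
      · exact (contMDiffOn_tangentChange (IB := IB) x₀ x₁).comp contMDiffOn_fst
          (fun z hz => ⟨(hS1 z hz).2.2.1, (hS1 z hz).2.2.2⟩)
  refine key.congr ?_
  rintro ⟨x, a⟩ hz
  have hz' := hS1 _ hz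
  refine Prod.ext rfl ?_
  refine Eq.trans ?_ (cCoord_change (IB := IB) (EG := EG) e e' x₀ x₁ hz'.1 hz'.2.1 a)
  simp only [Function.comp]
  rw [cPretrivialization_symm (IB := IB) (EG := EG) e x₀ hz'.1 a]
  rfl

/-- The topology of the fibres of `C_λ(P)`. -/
instance cFibreTopology (x : B) : TopologicalSpace (CFibre IB EG G P lam x) :=
  .induced (cCoord (trivializationAt G P x) x) inferInstance

variable (IB EG G P) in
/-- The local trivializations of `C_λ(P)`, which define its topology and complex structure. -/
def cPrebundle (lam : ℂ) : FiberPrebundle (EB →L[ℂ] LieAlg EG G) (CFibre IB EG G P lam) where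
  pretrivializationAtlas := {a | ∃ (e : Trivialization G (π G P)) (_ : MemTrivializationAtlas e)
    (x₀ : B), a = cPretrivialization (IB := IB) (EG := EG) lam e x₀}
  pretrivializationAt x := cPretrivialization (IB := IB) (EG := EG) lam (trivializationAt G P x) x
  mem_base_pretrivializationAt x := ⟨mem_baseSet_trivializationAt G P x,
    mem_baseSet_trivializationAt EB (TangentSpace IB) x⟩
  pretrivialization_mem_atlas x := ⟨_, inferInstance, x, rfl⟩
  continuous_trivChange := by
    rintro _ ⟨e', he', x₁, rfl⟩ _ ⟨e, he, x₀, rfl⟩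
    exact (cTriv_change (IB := IB) (EG := EG) e e' x₀ x₁).continuousOn
  totalSpaceMk_isInducing x := by
    have h : IsInducing (cCoord (IB := IB) (EG := EG) (lam := lam) (trivializationAt G P x) x) :=
      ⟨rfl⟩
    exact (isEmbedding_prodMkRight x).isInducing.comp h

instance : TopologicalSpace (TotalSpace (EB →L[ℂ] LieAlg EG G) (CFibre IB EG G P lam)) :=
  (cPrebundle IB EG G P lam).totalSpaceTopology

instance : FiberBundle (EB →L[ℂ] LieAlg EG G) (CFibre IB EG G P lam) :=
  (cPrebundle IB EG G P lam).toFiberBundle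

instance : IsManifold (IB.prod 𝓘(ℂ, EB →L[ℂ] LieAlg EG G)) ω
    (TotalSpace (EB →L[ℂ] LieAlg EG G) (CFibre IB EG G P lam)) := by
  refine isManifold_comp (I := IB.prod 𝓘(ℂ, EB →L[ℂ] LieAlg EG G))
    (M := B × (EB →L[ℂ] LieAlg EG G)) ?_
  rintro _ ⟨_, ⟨_, ⟨e, he, x₀, rfl⟩, rfl⟩, rfl⟩ _ ⟨_, ⟨_, ⟨e', he', x₁, rfl⟩, rfl⟩, rfl⟩
  exact cTriv_change (IB := IB) (EG := EG) e e' x₀ x₁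

end CBundle

section Affine
variable {EB : Type*} [NormedAddCommGroup EB] [NormedSpace ℂ EB] {HB : Type*} [TopologicalSpace HB]
  (IB : ModelWithCorners ℂ EB HB) {B : Type*} [TopologicalSpace B] [ChartedSpace HB B]

/-- Let `A → B` be a holomorphic fibre bundle, `E → B` a holomorphic vector bundle, and let
`t x : E x → A x → A x` be given for all `x`. Then `A` is an affine bundle with bundle of
translations `E` if each `t x` is a simply transitive action of the additive group `E x` on the
nonempty fibre `A x`, and if locally on `B` there are biholomorphic maps from `A` to `E` over `B`
that commute with the translations. -/
structure IsAffineBundle (FE : Type*) [NormedAddCommGroup FE] [NormedSpace ℂ FE]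
    (E : B → Type*) [TopologicalSpace (TotalSpace FE E)] [∀ x, AddCommGroup (E x)]
    [∀ x, TopologicalSpace (E x)] [FiberBundle FE E]
    (FA : Type*) [NormedAddCommGroup FA] [NormedSpace ℂ FA]
    (A : B → Type*) [TopologicalSpace (TotalSpace FA A)] [∀ x, TopologicalSpace (A x)]
    [FiberBundle FA A] (t : ∀ x, E x → A x → A x) : Prop where
  nonempty : ∀ x, Nonempty (A x)
  zero_translate : ∀ x (a : A x), t x 0 a = a
  add_translate : ∀ x (u v : E x) (a : A x), t x (u + v) a = t x u (t x v a)
  existsUnique_translate : ∀ x (a a' : A x), ∃! u : E x, t x u a = a'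
  locally_trivial : ∀ x₀ : B, ∃ U : Set B, IsOpen U ∧ x₀ ∈ U ∧
    ∃ Φ : OpenPartialHomeomorph (TotalSpace FA A) (TotalSpace FE E),
      Φ.source = π FA A ⁻¹' U ∧ Φ.target = π FE E ⁻¹' U ∧
      ContMDiffOn (IB.prod 𝓘(ℂ, FA)) (IB.prod 𝓘(ℂ, FE)) ω Φ Φ.source ∧
      ContMDiffOn (IB.prod 𝓘(ℂ, FE)) (IB.prod 𝓘(ℂ, FA)) ω Φ.symm Φ.target ∧
      ∀ x ∈ U, ∀ a : A x, ∃ u : E x, Φ ⟨x, a⟩ = ⟨x, u⟩ ∧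
        ∀ v : E x, Φ ⟨x, t x v a⟩ = ⟨x, v + u⟩
end Affine

section Translate
variable {EB : Type*} [NormedAddCommGroup EB] [NormedSpace ℂ EB] {HB : Type*} [TopologicalSpace HB]
  {IB : ModelWithCorners ℂ EB HB} {B : Type*} [TopologicalSpace B] [ChartedSpace HB B]
  {EG : Type*} [NormedAddCommGroup EG] [NormedSpace ℂ EG]
  {G : Type*} [TopologicalSpace G] [ChartedSpace EG G] [Group G] [LieGroup 𝓘(ℂ, EG) ω G]
  {P : B → Type*} [TopologicalSpace (TotalSpace G P)] [∀ x, TopologicalSpace (P x)]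
  [FiberBundle G P] [∀ x, MulAction Gᵐᵒᵖ (P x)]
  [hP : IsHolomorphicPrincipalBundle IB EG G P] [IsManifold IB ω B]

theorem mfderiv_proj_vert (z : TotalSpace G P) (ξ : LieAlg EG G) :
    mfderiv (IB.prod 𝓘(ℂ, EG)) IB (π G P) z (vert IB EG z ξ) = 0 := by
  have h1 : rightMul (1 : G) z = z := rightMul_one z
  have c := mfderiv_comp_of_eq (I := 𝓘(ℂ, EG)) (I' := IB.prod 𝓘(ℂ, EG)) (I'' := IB)
    (x := (1 : G)) (f := fun g : G => rightMul g z) (g := π G P) (y := z)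
    ((contMDiff_projP (IB := IB) (EG := EG) (P := P)).mdifferentiableAt (by simp))
    ((contMDiff_orbit (IB := IB) (EG := EG) z).mdifferentiableAt (by simp)) h1
  have h2 : (π G P ∘ fun g : G => rightMul g z) = fun _ => z.1 := rfl
  rw [h2, mfderiv_const] at c
  have c5 : ∀ (a : TotalSpace G P) (_ : a = z) (u : EB × EG),
      (mfderiv (IB.prod 𝓘(ℂ, EG)) IB (π G P) a u : EB) =
        mfderiv (IB.prod 𝓘(ℂ, EG)) IB (π G P) z u := by
    rintro _ rfl u; rfl
  exact (c5 _ h1 _).symm.trans (congrArg (fun L : EG →L[ℂ] EB => L ξ) c).symm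

/-- The inclusion `ad P → At P`. -/
def adToAt (x : B) : adBundle EG G P IB x →ₗ[ℂ] atFibre IB EG (G := G) P x where
  toFun ξ := ⟨fun p => vert IB EG ⟨x, p⟩ (ξ.1 p), fun p g => by
    rw [rightMulDeriv_vert, ← ξ.2 p g]
    rfl⟩
  map_add' ξ η := Subtype.ext (funext fun p => map_add (vert IB EG ⟨x, p⟩) (ξ.1 p) (η.1 p))
  map_smul' c ξ := Subtype.ext (funext fun p => map_smul (vert IB EG ⟨x, p⟩) c (ξ.1 p))

/-- The translation of an element `h : T_x B → (At P)_x` of `C_λ(P)_x` by an element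
`φ : T_x B → (ad P)_x` of `(ad P ⊗ Ω)_x`: the sum `φ + h`. -/
def translate (lam : ℂ) (x : B) (φ : TangentSpace IB x →L[ℂ] adBundle EG G P IB x)
    (h : CFibre IB EG G P lam x) : CFibre IB EG G P lam x :=
  ⟨(adToAt x).comp φ.toLinearMap + h.1, fun w p => by
    have h1 := mfderiv_proj_vert (IB := IB) (EG := EG) (⟨x, p⟩ : TotalSpace G P) ((φ w).1 p)
    refine (map_add (mfderiv (IB.prod 𝓘(ℂ, EG)) IB (π G P) (⟨x, p⟩ : TotalSpace G P))
      (vert IB EG ⟨x, p⟩ ((φ w).1 p)) ((h.1 w).1 p)).trans ?_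
    rw [h1, h.2 w p]
    exact zero_add _⟩

end Translate

section Connection
variable {EB : Type*} [NormedAddCommGroup EB] [NormedSpace ℂ EB] {HB : Type*} [TopologicalSpace HB]
  (IB : ModelWithCorners ℂ EB HB) {B : Type*} [TopologicalSpace B] [ChartedSpace HB B]
  (EG : Type*) [NormedAddCommGroup EG] [NormedSpace ℂ EG]
  (G : Type*) [TopologicalSpace G] [ChartedSpace EG G] [Group G] [LieGroup 𝓘(ℂ, EG) ω G]
  (P : B → Type*) [TopologicalSpace (TotalSpace G P)] [∀ x, TopologicalSpace (P x)]
  [FiberBundle G P] [∀ x, MulAction Gᵐᵒᵖ (P x)]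

/-- Families of `ℂ`-linear maps from the tangent spaces of the total space of `P` to the Lie algebra
of `G`, without any regularity. -/
abbrev LieForm : Type _ :=
  ∀ z : TotalSpace G P, TangentSpace (IB.prod 𝓘(ℂ, EG)) z →L[ℂ] LieAlg EG G

/-- The bundle over the total space of `P` whose sections are the `LieForm`s, that is `Ω_P ⊗ 𝔤`. -/
abbrev FormBundle (z : TotalSpace G P) : Type _ :=
  TangentSpace (IB.prod 𝓘(ℂ, EG)) z →L[ℂ] Bundle.Trivial (TotalSpace G P) (LieAlg EG G) z

variable {IB EG G P}
variable [hP : IsHolomorphicPrincipalBundle IB EG G P] [IsManifold IB ω B]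

/-- A `λ`-connection on `P`, given by its `1`-form: a holomorphic `G`-equivariant `1`-form on the
total space of `P` with values in the Lie algebra, which is `λ` times the tautological
identification on vertical vectors. -/
structure IsLambdaConnection (lam : ℂ) (D : LieForm IB EG G P) : Prop where
  holomorphic : ContMDiff (IB.prod 𝓘(ℂ, EG))
    ((IB.prod 𝓘(ℂ, EG)).prod 𝓘(ℂ, (EB × EG) →L[ℂ] LieAlg EG G)) ω
    (fun z => (⟨z, D z⟩ : TotalSpace ((EB × EG) →L[ℂ] LieAlg EG G) (FormBundle IB EG G P)))
  equivariant : ∀ (g : G) (z : TotalSpace G P) (v : TangentSpace (IB.prod 𝓘(ℂ, EG)) z),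
    D (rightMul g z) (rightMulDeriv IB EG g z v) = Ad EG g⁻¹ (D z v)
  vertical : ∀ (z : TotalSpace G P) (ξ : LieAlg EG G), D z (vert IB EG z ξ) = lam • ξ

variable [∀ x, Nonempty (P x)]
variable {EC : Type*} [NormedAddCommGroup EC] [NormedSpace ℂ EC] {HC : Type*} [TopologicalSpace HC]
  {IC : ModelWithCorners ℂ EC HC} {C : Type*} [TopologicalSpace C] [ChartedSpace HC C]

/-- The differential of the canonical map `f^*P → P`. -/
def liftDeriv (f : C^ω⟮IC, C; IB, B⟯) (z : TotalSpace G ((f : C → B) *ᵖ P)) :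
    TangentSpace (IC.prod 𝓘(ℂ, EG)) z →L[ℂ]
      TangentSpace (IB.prod 𝓘(ℂ, EG)) (Pullback.lift f z : TotalSpace G P) :=
  mfderiv (IC.prod 𝓘(ℂ, EG)) (IB.prod 𝓘(ℂ, EG)) (Pullback.lift f) z

/-- The form `D` on `f^*P` is trivial on the fibres of `f`: it factors, through the differential of
`F : f^*P → P`, over a holomorphic `G`-equivariant homomorphism from `F^* T_P` to the trivial bundle
with fibre the Lie algebra, that is over a holomorphic homomorphism `f^* At P → f^* ad P`. -/
def TrivialOnFibres (f : C^ω⟮IC, C; IB, B⟯) (D : LieForm IC EG G ((f : C → B) *ᵖ P)) : Prop :=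
  ∃ s : ∀ z : TotalSpace G ((f : C → B) *ᵖ P),
      TangentSpace (IB.prod 𝓘(ℂ, EG)) (Pullback.lift f z : TotalSpace G P) →L[ℂ] LieAlg EG G,
    ContMDiff (IC.prod 𝓘(ℂ, EG))
      ((IB.prod 𝓘(ℂ, EG)).prod 𝓘(ℂ, (EB × EG) →L[ℂ] LieAlg EG G)) ω
      (fun z => (⟨Pullback.lift f z, s z⟩ :
        TotalSpace ((EB × EG) →L[ℂ] LieAlg EG G) (FormBundle IB EG G P))) ∧
    (∀ (g : G) (z : TotalSpace G ((f : C → B) *ᵖ P))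
      (w : TangentSpace (IB.prod 𝓘(ℂ, EG)) (Pullback.lift f z : TotalSpace G P)),
      s (rightMul g z) (rightMulDeriv IB EG g (Pullback.lift f z) w) = Ad EG g⁻¹ (s z w)) ∧
    ∀ (z : TotalSpace G ((f : C → B) *ᵖ P)) (v : TangentSpace (IC.prod 𝓘(ℂ, EG)) z),
      D z v = s z (liftDeriv f z v)

/-- The pullback of a form on `P` to `f^*P`. -/
def pullbackForm (f : C^ω⟮IC, C; IB, B⟯) (D : LieForm IB EG G P) :
    LieForm IC EG G ((f : C → B) *ᵖ P) :=
  fun z => (D (Pullback.lift f z)).comp (liftDeriv f z)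

variable (IB EG G P) in
/-- The projection `C_λ(P) → B`. -/
def cProj [FiniteDimensional ℂ EB] (lam : ℂ) :
    C^ω⟮IB.prod 𝓘(ℂ, EB →L[ℂ] LieAlg EG G),
      TotalSpace (EB →L[ℂ] LieAlg EG G) (CFibre IB EG G P lam); IB, B⟯ :=
  ⟨π (EB →L[ℂ] LieAlg EG G) (CFibre IB EG G P lam), Bundle.contMDiff_proj _⟩

variable [FiniteDimensional ℂ EB]

/-- The form on `q^*P`, for `q : C_λ(P) → B`, is the tautological one: at the point `(h, p)` of
`q^*P`, with `h` in `C_λ(P)_x` and `p` in `P_x`, and with `u = dF(v)` in `T_p P` for `F : q^*P → P`,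
the vertical vector defined by its value at `v` is `λ u - h(dπ(u))`. -/
def IsTautologicalForm (lam : ℂ) (D : LieForm (IB.prod 𝓘(ℂ, EB →L[ℂ] LieAlg EG G)) EG G
    (cProj IB EG G P lam *ᵖ P)) : Prop :=
  ∀ (x : B) (h : CFibre IB EG G P lam x) (p : P x)
    (v : TangentSpace ((IB.prod 𝓘(ℂ, EB →L[ℂ] LieAlg EG G)).prod 𝓘(ℂ, EG))
      (⟨⟨x, h⟩, p⟩ : TotalSpace G (cProj IB EG G P lam *ᵖ P)))
    (u : TangentSpace (IB.prod 𝓘(ℂ, EG)) (⟨x, p⟩ : TotalSpace G P)),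
    u = liftDeriv (EG := EG) (cProj IB EG G P lam) ⟨⟨x, h⟩, p⟩ v →
      vert IB EG (⟨x, p⟩ : TotalSpace G P) (D ⟨⟨x, h⟩, p⟩ v) =
        lam • u - (h.1 (mfderiv (IB.prod 𝓘(ℂ, EG)) IB (π G P) ⟨x, p⟩ u)).1 p

end Connection

section Iso
variable {EB : Type*} [NormedAddCommGroup EB] [NormedSpace ℂ EB] {HB : Type*} [TopologicalSpace HB]
  {IB : ModelWithCorners ℂ EB HB} {B : Type*} [TopologicalSpace B] [ChartedSpace HB B]
  {EG : Type*} [NormedAddCommGroup EG] [NormedSpace ℂ EG]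
  {G : Type*} [TopologicalSpace G] [ChartedSpace EG G] [Group G]
  {P Q : B → Type*} [TopologicalSpace (TotalSpace G P)] [∀ x, TopologicalSpace (P x)]
  [FiberBundle G P] [∀ x, MulAction Gᵐᵒᵖ (P x)]
  [TopologicalSpace (TotalSpace G Q)] [∀ x, TopologicalSpace (Q x)]
  [FiberBundle G Q] [∀ x, MulAction Gᵐᵒᵖ (Q x)]

/-- A biholomorphic map `Φ` between the total spaces of two holomorphic principal `G`-bundles on `B`
is an isomorphism between the bundles with forms `(P, D)` and `(Q, D')`: it is a `G`-equivariant map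
over `B` that pulls `D'` back to `D`. -/
structure IsIsoWithForms
    (Φ : TotalSpace G P ≃ₘ^ω⟮IB.prod 𝓘(ℂ, EG), IB.prod 𝓘(ℂ, EG)⟯ TotalSpace G Q)
    (D : LieForm IB EG G P) (D' : LieForm IB EG G Q) : Prop where
  proj_eq : ∀ z, (Φ z).proj = z.proj
  equivariant : ∀ (g : G) z, Φ (rightMul g z) = rightMul g (Φ z)
  form_eq : ∀ z (v : TangentSpace (IB.prod 𝓘(ℂ, EG)) z),
    D z v = D' (Φ z) (mfderiv (IB.prod 𝓘(ℂ, EG)) (IB.prod 𝓘(ℂ, EG)) Φ z v)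

end Iso

end HolPrin

end

open HolPrin

/-! A splitting of the Atiyah sequence can be given from the right or from the left. At a point `x`
the right version is `h : T_x X → (At P)_x` with `dπ ∘ h = λ`, that is a point of `C_λ(P)`. The left
version is `s : (At P)_x → (ad P)_x` with `s ∘ ι = λ`, that is an equivariant family of forms `T_p P
→ 𝔤` along the fibre of `P` that is `λ` on vertical vectors. The relation `ι ∘ s + h ∘ dπ = λ` makes
the two correspond bijectively: `λ u - h(dπ u)` is vertical, so it comes from a unique element of
`𝔤`, which is the value `tautForm h p u`. Thus `C_λ(P)` parametrizes the pointwise `λ`-splittings,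
and everything follows from this correspondence (`vert_tautForm`, `exists_tautForm_eq`,
`cFibre_eq_of_tautForm`).

The affine structure is the remark that two choices of `h` differ by a map into `ker dπ = ad P`. The
connection `∇` on `q^*P` is the form `tautForm h p`, composed with the differential of `q^*P → P`;
by construction it is trivial on the fibres of `q`. If `D = s ∘ dF` on `f^*P`, then `s` gives at
each `y` a left splitting at `f(y)`, hence a point `ψ(y)` of `C_λ(P)`, and `ψ^*∇ = D`. Conversely
`ψ^*∇ = D` prescribes the form of `ψ(y)` on the image of `dF`. This image is everything because `f`,
and with it `F`, is a submersion (`liftDeriv_surjective`), so `ψ` is unique.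

Holomorphy is checked locally. A local trivialization `e` of `P` has a flat connection form
`flatForm`. It inverts `vert` on vertical vectors and is equivariant (`flatForm_vert`,
`flatForm_rightMulDeriv`). In terms of it and of the local coordinate `cCoord` of `h`, the
tautological form is `λ · flatForm - Ad(e(p)⁻¹) ∘ cCoord ∘ dπ` (`tautForm_eq`). This formula shows
that `∇` is holomorphic (`contMDiff_tautHom`); solved for `cCoord`, it shows that `ψ` is holomorphic
(`contMDiff_of_tautForm`). -/

noncomputable section

namespace HolPrin

/-! ### The flat connection form of a local trivialization, and vertical vectors -/

section FlatForm
variable {EB : Type*} [NormedAddCommGroup EB] [NormedSpace ℂ EB] {HB : Type*} [TopologicalSpace HB]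
  {IB : ModelWithCorners ℂ EB HB} {B : Type*} [TopologicalSpace B] [ChartedSpace HB B]
  {EG : Type*} [NormedAddCommGroup EG] [NormedSpace ℂ EG]
  {G : Type*} [TopologicalSpace G] [ChartedSpace EG G] [Group G] [LieGroup 𝓘(ℂ, EG) ω G]
  {P : B → Type*} [TopologicalSpace (TotalSpace G P)] [∀ x, TopologicalSpace (P x)]
  [FiberBundle G P] [∀ x, MulAction Gᵐᵒᵖ (P x)]

variable (IB EG) in
/-- The derivative at `z` of the `G`-component of `e`, right translated to the identity. -/
def trivDeriv (e : Trivialization G (π G P)) (z : TotalSpace G P) :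
    TangentSpace (IB.prod 𝓘(ℂ, EG)) z →L[ℂ] LieAlg EG G :=
  mfderiv (IB.prod 𝓘(ℂ, EG)) 𝓘(ℂ, EG) (fun z' : TotalSpace G P => (e z').2 * (e z).2⁻¹) z

variable (IB EG) in
/-- The connection form of the flat connection given by the local trivialization `e`. -/
def flatForm (e : Trivialization G (π G P)) (z : TotalSpace G P) :
    TangentSpace (IB.prod 𝓘(ℂ, EG)) z →L[ℂ] LieAlg EG G :=
  (Ad EG (e z).2⁻¹).comp (trivDeriv IB EG e z)

theorem Ad_inv_Ad (g : G) (ξ : LieAlg EG G) : Ad EG g⁻¹ (Ad EG g ξ) = ξ := by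
  have h := Ad_mul (EG := EG) g⁻¹ g
  rw [inv_mul_cancel, Ad_one] at h
  exact (congrArg (fun L : LieAlg EG G →L[ℂ] LieAlg EG G => L ξ) h).symm

variable [IsManifold IB ω B] [hP : IsHolomorphicPrincipalBundle IB EG G P]

theorem contMDiffAt_triv_snd (e : Trivialization G (π G P)) [MemTrivializationAtlas e]
    {z : TotalSpace G P} (hz : z.1 ∈ e.baseSet) :
    ContMDiffAt (IB.prod 𝓘(ℂ, EG)) 𝓘(ℂ, EG) ω (fun z' : TotalSpace G P => (e z').2) z :=
  contMDiffAt_snd.comp z (contMDiffAt_triv (IB := IB) e hz)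

/-- Along the orbit of `z` the `G`-component is `e(z) g`. Right translated by `e(z)⁻¹` it becomes
conjugation by `e(z)`, whose derivative `Ad (e z)` is cancelled by the factor in `flatForm`. -/
theorem flatForm_vert (e : Trivialization G (π G P)) [MemTrivializationAtlas e]
    {z : TotalSpace G P} (hz : z.1 ∈ e.baseSet) (ξ : LieAlg EG G) :
    flatForm IB EG e z (vert IB EG z ξ) = ξ := by
  have hd : MDifferentiableAt (IB.prod 𝓘(ℂ, EG)) 𝓘(ℂ, EG)
      (fun z' : TotalSpace G P => (e z').2 * (e z).2⁻¹) z :=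
    ((contMDiffAt_triv_snd (IB := IB) (EG := EG) e hz).mul contMDiffAt_const).mdifferentiableAt
      (n := ω) (by simp)
  have h1 : rightMul (1 : G) z = z := rightMul_one z
  have c := mfderiv_comp_of_eq (I := 𝓘(ℂ, EG)) (I' := IB.prod 𝓘(ℂ, EG)) (I'' := 𝓘(ℂ, EG))
    (x := (1 : G)) (f := fun g : G => rightMul g z) (y := z) hd
    ((contMDiff_orbit (IB := IB) (EG := EG) z).mdifferentiableAt (by simp)) h1
  have h2 : ((fun z' : TotalSpace G P => (e z').2 * (e z).2⁻¹) ∘ fun g : G => rightMul g z) =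
      fun g : G => (e z).2 * g * (e z).2⁻¹ := by
    funext g
    exact congrArg (· * (e z).2⁻¹) (hP.equivariant e z.1 hz z.2 g)
  rw [h2] at c
  -- The chain rule gives the outer derivative at `rightMul 1 z`, which equals `z` only
  -- propositionally. Vectors are therefore taken in the model space `EB × EG` while the base point
  -- is moved.
  have c5 : ∀ (a : TotalSpace G P) (_ : a = z) (u : EB × EG),
      (mfderiv (IB.prod 𝓘(ℂ, EG)) 𝓘(ℂ, EG)
        (fun z' : TotalSpace G P => (e z').2 * (e z).2⁻¹) a u : EG) = trivDeriv IB EG e z u := by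
    rintro _ rfl u; rfl
  have c6 : trivDeriv IB EG e z (vert IB EG z ξ) = Ad EG (e z).2 ξ :=
    (c5 _ h1 _).symm.trans (congrArg (fun L : EG →L[ℂ] EG => L ξ) c).symm
  exact (congrArg (Ad EG (e z).2⁻¹) c6).trans (Ad_inv_Ad _ ξ)

/-- The right translated derivative `trivDeriv` is invariant, since `e(z'g) e(zg)⁻¹ = e(z') e(z)⁻¹`.
Only the factor `Ad (e(z) g)⁻¹` changes, and it contributes `Ad g⁻¹`. -/
theorem flatForm_rightMulDeriv (e : Trivialization G (π G P)) [MemTrivializationAtlas e]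
    {z : TotalSpace G P} (hz : z.1 ∈ e.baseSet) (g : G)
    (u : TangentSpace (IB.prod 𝓘(ℂ, EG)) z) :
    flatForm IB EG e (rightMul g z) (rightMulDeriv IB EG g z u) =
      Ad EG g⁻¹ (flatForm IB EG e z u) := by
  have he : ∀ {z' : TotalSpace G P}, z'.1 ∈ e.baseSet → (e (rightMul g z')).2 = (e z').2 * g :=
    fun {z'} hz' => hP.equivariant e z'.1 hz' z'.2 g
  have hd : MDifferentiableAt (IB.prod 𝓘(ℂ, EG)) 𝓘(ℂ, EG)
      (fun z' : TotalSpace G P => (e z').2 * (e (rightMul g z)).2⁻¹) (rightMul g z) :=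
    ((contMDiffAt_triv_snd (IB := IB) (EG := EG) e
      (z := rightMul g z) hz).mul contMDiffAt_const).mdifferentiableAt (n := ω) (by simp)
  have c := mfderiv_comp (I := IB.prod 𝓘(ℂ, EG)) (I' := IB.prod 𝓘(ℂ, EG)) (I'' := 𝓘(ℂ, EG)) z
    hd ((contMDiff_rightMul (IB := IB) (EG := EG) (P := P) g).mdifferentiableAt (by simp))
  have h2 : ((fun z' : TotalSpace G P => (e z').2 * (e (rightMul g z)).2⁻¹) ∘ rightMul g)
      =ᶠ[𝓝 z] fun z' => (e z').2 * (e z).2⁻¹ := by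
    filter_upwards [e.open_source.mem_nhds (e.mem_source.2 hz)] with z' hz'
    simp only [Function.comp]
    rw [he (e.mem_source.1 hz'), he hz]
    group
  have c2 := h2.mfderiv_eq (I := IB.prod 𝓘(ℂ, EG)) (I' := 𝓘(ℂ, EG))
  have c3 : trivDeriv IB EG e (rightMul g z) (rightMulDeriv IB EG g z u) = trivDeriv IB EG e z u :=
    (congrArg (fun L : (EB × EG) →L[ℂ] EG => L u) c).symm.trans
      (congrArg (fun L : (EB × EG) →L[ℂ] EG => L u) c2)
  change Ad EG (e (rightMul g z)).2⁻¹ (trivDeriv IB EG e (rightMul g z) _) = _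
  rw [c3, he hz, mul_inv_rev, Ad_mul]
  rfl

variable [∀ x, Nonempty (P x)]

/-- On the section where `e` is `1` both the right translation and the factor `Ad` are trivial. This
ties the form to `theta`, and through it to the coordinates of `C_λ(P)`. -/
theorem flatForm_sec (e : Trivialization G (π G P)) [MemTrivializationAtlas e] {x : B}
    (hx : x ∈ e.baseSet)
    (u : TangentSpace (IB.prod 𝓘(ℂ, EG)) (⟨x, e.symm x (1 : G)⟩ : TotalSpace G P)) :
    flatForm IB EG e ⟨x, e.symm x (1 : G)⟩ u = theta IB EG e x u := by
  have h1 : e ⟨x, e.symm x (1 : G)⟩ = (x, 1) := e.apply_mk_symm hx 1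
  have h2 : (fun z' : TotalSpace G P => (e z').2 * (e ⟨x, e.symm x (1 : G)⟩).2⁻¹) =
      fun z' => (e z').2 := by
    funext z'; simp [h1]
  have h3 : trivDeriv IB EG e ⟨x, e.symm x (1 : G)⟩ u = theta IB EG e x u := by
    have h4 : ∀ f : TotalSpace G P → G, f = (fun z' => (e z').2) →
      (mfderiv (IB.prod 𝓘(ℂ, EG)) 𝓘(ℂ, EG) f ⟨x, e.symm x (1 : G)⟩ u : EG) =
        theta IB EG e x u := by
      rintro _ rfl; rfl
    exact h4 _ h2
  change Ad EG (e ⟨x, e.symm x (1 : G)⟩).2⁻¹ (trivDeriv IB EG e ⟨x, e.symm x (1 : G)⟩ u) = _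
  rw [h3, h1, inv_one, Ad_one]
  rfl

theorem exists_eq_rightMul_sec [hP : IsHolomorphicPrincipalBundle IB EG G P]
    (e : Trivialization G (π G P)) [MemTrivializationAtlas e]
    {z : TotalSpace G P} (hz : z.1 ∈ e.baseSet) :
    z = rightMul (e z).2 ⟨z.1, e.symm z.1 (1 : G)⟩ :=
  congrArg (TotalSpace.mk z.1) (eq_smul_sec (IB := IB) (EG := EG) e hz z.2)

/-- A tangent vector is determined by its projection and its value under the flat form. -/
theorem eq_of_proj_of_flatForm (e : Trivialization G (π G P)) [MemTrivializationAtlas e]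
    {z : TotalSpace G P} (hz : z.1 ∈ e.baseSet) {u u' : TangentSpace (IB.prod 𝓘(ℂ, EG)) z}
    (h1 : mfderiv (IB.prod 𝓘(ℂ, EG)) IB (π G P) z u =
      mfderiv (IB.prod 𝓘(ℂ, EG)) IB (π G P) z u')
    (h2 : flatForm IB EG e z u = flatForm IB EG e z u') : u = u' := by
  -- On the section the two data are the components of the vector in `e`, so `thetaSymm` recovers
  -- it. A general `z` is moved there by right multiplication with `(e z).2⁻¹`; the point `s` is a
  -- variable because the moved point is only propositionally on the section.
  have key : ∀ s : TotalSpace G P, s.1 ∈ e.baseSet → s = ⟨s.1, e.symm s.1 (1 : G)⟩ →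
      ∀ u u' : TangentSpace (IB.prod 𝓘(ℂ, EG)) s,
      mfderiv (IB.prod 𝓘(ℂ, EG)) IB (π G P) s u =
        mfderiv (IB.prod 𝓘(ℂ, EG)) IB (π G P) s u' →
      flatForm IB EG e s u = flatForm IB EG e s u' → u = u' := by
    rintro ⟨x, p⟩ hx hs u u' h1 h2
    obtain rfl : p = e.symm x (1 : G) := eq_of_heq (TotalSpace.mk.inj hs).2
    rw [flatForm_sec e hx, flatForm_sec e hx] at h2
    have a1 := thetaSymm_left (IB := IB) (EG := EG) e hx u
    rw [h1, h2, thetaSymm_left (IB := IB) (EG := EG) e hx u'] at a1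
    exact a1.symm
  have hs : rightMul (e z).2⁻¹ z = ⟨z.1, e.symm z.1 (1 : G)⟩ := by
    conv_lhs => rw [exists_eq_rightMul_sec (IB := IB) (EG := EG) e hz]
    have : e (rightMul (e z).2 ⟨z.1, e.symm z.1 (1 : G)⟩) = e z := by
      rw [← exists_eq_rightMul_sec (IB := IB) (EG := EG) e hz]
    rw [this, ← rightMul_mul, mul_inv_cancel, rightMul_one]
  have a := key (rightMul (e z).2⁻¹ z) hz hs (rightMulDeriv IB EG (e z).2⁻¹ z u)
    (rightMulDeriv IB EG (e z).2⁻¹ z u')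
    (by rw [mfderiv_proj_rightMulDeriv, mfderiv_proj_rightMulDeriv, h1])
    (by rw [flatForm_rightMulDeriv e hz, flatForm_rightMulDeriv e hz, h2])
  have b : ∀ w : TangentSpace (IB.prod 𝓘(ℂ, EG)) z,
      (rightMulDeriv IB EG (e z).2 (rightMul (e z).2⁻¹ z)
        (rightMulDeriv IB EG (e z).2⁻¹ z w) : EB × EG) = w := by
    intro w
    refine (rightMulDeriv_mul (IB := IB) (EG := EG) _ _ z w).symm.trans ?_
    rw [inv_mul_cancel]
    exact rightMulDeriv_one z w
  exact (b u).symm.trans ((congrArg (rightMulDeriv IB EG (e z).2 (rightMul (e z).2⁻¹ z)) a).trans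
    (b u'))

/-- Both sides project to `0` and have the same flat form, so they agree. Hence on vertical vectors
every flat form is the inverse of `vert`, whatever the trivialization. -/
theorem vert_flatForm (e : Trivialization G (π G P)) [MemTrivializationAtlas e]
    {z : TotalSpace G P} (hz : z.1 ∈ e.baseSet) {u : TangentSpace (IB.prod 𝓘(ℂ, EG)) z}
    (hu : mfderiv (IB.prod 𝓘(ℂ, EG)) IB (π G P) z u = 0) :
    vert IB EG z (flatForm IB EG e z u) = u :=
  eq_of_proj_of_flatForm e hz ((mfderiv_proj_vert z _).trans hu.symm) (flatForm_vert e hz _)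

theorem vert_injective (z : TotalSpace G P) : Function.Injective (vert IB EG z) := fun ξ η h => by
  have hz := mem_baseSet_trivializationAt G P z.1
  have h2 := congrArg (flatForm IB EG (trivializationAt G P z.1) z) h
  rwa [flatForm_vert _ hz, flatForm_vert _ hz] at h2

theorem mfderiv_proj_surjective (z : TotalSpace G P) :
    Function.Surjective (mfderiv (IB.prod 𝓘(ℂ, EG)) IB (π G P) z) := by
  intro w
  set e := trivializationAt G P z.1
  have hz : z.1 ∈ e.baseSet := mem_baseSet_trivializationAt G P z.1
  have h1 := thetaSymm_right (IB := IB) (EG := EG) e hz (w, 0)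
  refine ⟨(atExtend (IB := IB) (EG := EG) e hz (thetaSymm IB EG e z.1 (w, 0))).1 z.2, ?_⟩
  exact (mfderiv_proj_atExtend e hz _ z.2).trans h1.1

end FlatForm

/-! ### Holomorphy of differentials and of forms in local coordinates -/

section Coordinates
variable {E H M : Type*} [NormedAddCommGroup E] [NormedSpace ℂ E] [TopologicalSpace H]
  {I : ModelWithCorners ℂ E H} [TopologicalSpace M] [ChartedSpace H M] [IsManifold I ω M]
  {E' H' M' : Type*} [NormedAddCommGroup E'] [NormedSpace ℂ E'] [TopologicalSpace H']
  {I' : ModelWithCorners ℂ E' H'} [TopologicalSpace M'] [ChartedSpace H' M'] [IsManifold I' ω M']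
  {EN HN N : Type*} [NormedAddCommGroup EN] [NormedSpace ℂ EN] [TopologicalSpace HN]
  {IN : ModelWithCorners ℂ EN HN} [TopologicalSpace N] [ChartedSpace HN N] [IsManifold IN ω N]

/-- The differential of a holomorphic map, read in the trivializations of the tangent bundles,
depends holomorphically on the point. -/
theorem contMDiffAt_coord_mfderiv {φ : M → M'} {b : N → M} {n₀ : N}
    (hφ : ContMDiffAt I I' ω φ (b n₀)) (hb : ContMDiffAt IN I ω b n₀) :
    ContMDiffAt IN 𝓘(ℂ, E →L[ℂ] E') ω
      (fun n => (((trivializationAt E' (TangentSpace I') (φ (b n₀))).continuousLinearMapAt ℂ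
        (φ (b n))).comp ((mfderiv I I' φ (b n)).comp
          ((trivializationAt E (TangentSpace I) (b n₀)).symmL ℂ (b n))) : E →L[ℂ] E')) n₀ := by
  have : IsManifold I 1 M := IsManifold.of_le (n := ω) le_top
  have : IsManifold I' 1 M' := IsManifold.of_le (n := ω) le_top
  have : IsManifold IN 1 N := IsManifold.of_le (n := ω) le_top
  -- The family of maps is constant in the parameter, which only moves the base point.
  exact ContMDiffAt.mfderiv (m := ω) (n := ω) (fun _ => φ) b
    (ContMDiffAt.comp (n₀, b n₀) (by exact hφ) contMDiffAt_snd) hb (by simp)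

variable {FL : Type*} [NormedAddCommGroup FL] [NormedSpace ℂ FL]

/-- The target bundle is trivial, so only the source needs a trivialization. This reduces holomorphy
of a form along `b` to that of a map into the fixed space `E →L[ℂ] FL`. -/
theorem contMDiffAt_hom_trivial_iff {b : N → M} {s : ∀ n, TangentSpace I (b n) →L[ℂ] FL} {n₀ : N} :
    ContMDiffAt IN (I.prod 𝓘(ℂ, E →L[ℂ] FL)) ω (fun n => (⟨b n, s n⟩ : TotalSpace (E →L[ℂ] FL)
      (fun z : M => TangentSpace I z →L[ℂ] Bundle.Trivial M FL z))) n₀ ↔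
    ContMDiffAt IN I ω b n₀ ∧ ContMDiffAt IN 𝓘(ℂ, E →L[ℂ] FL) ω
      (fun n => ((s n).comp ((trivializationAt E (TangentSpace I) (b n₀)).symmL ℂ (b n)) :
        E →L[ℂ] FL)) n₀ := by
  have : IsManifold I 1 M := IsManifold.of_le (n := ω) le_top
  rw [contMDiffAt_hom_bundle]
  refine and_congr Iff.rfl (iff_of_eq ?_)
  congr 1
  funext n
  ext w
  simp only [ContinuousLinearMap.inCoordinates, ContinuousLinearMap.comp_apply]
  exact congrArg (fun L : FL →L[ℂ] FL => L _)
    (Bundle.Trivial.continuousLinearMapAt_trivialization ℂ M FL (b n))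

end Coordinates

/-! ### Holomorphy of the flat form -/

section FlatForm
variable {EB : Type*} [NormedAddCommGroup EB] [NormedSpace ℂ EB] {HB : Type*} [TopologicalSpace HB]
  {IB : ModelWithCorners ℂ EB HB} {B : Type*} [TopologicalSpace B] [ChartedSpace HB B]
  {EG : Type*} [NormedAddCommGroup EG] [NormedSpace ℂ EG]
  {G : Type*} [TopologicalSpace G] [ChartedSpace EG G] [Group G] [LieGroup 𝓘(ℂ, EG) ω G]
  {P : B → Type*} [TopologicalSpace (TotalSpace G P)] [∀ x, TopologicalSpace (P x)]
  [FiberBundle G P] [∀ x, MulAction Gᵐᵒᵖ (P x)]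
  [IsManifold IB ω B] [hP : IsHolomorphicPrincipalBundle IB EG G P]
  {EN HN N : Type*} [NormedAddCommGroup EN] [NormedSpace ℂ EN] [TopologicalSpace HN]
  {IN : ModelWithCorners ℂ EN HN} [TopologicalSpace N] [ChartedSpace HN N] [IsManifold IN ω N]

/-- After right translation all derivatives take values in the one tangent space at `1`, so
`contMDiffAt_mfderiv_toLie` applies to the family `(n, z) ↦ e(z) e(b n)⁻¹`. The remaining factor is
`Ad`, which is holomorphic on `G`. -/
theorem contMDiffAt_coord_flatForm (e : Trivialization G (π G P)) [MemTrivializationAtlas e]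
    {b : N → TotalSpace G P} {n₀ : N} (hb : ContMDiffAt IN (IB.prod 𝓘(ℂ, EG)) ω b n₀)
    (hn : (b n₀).1 ∈ e.baseSet) :
    ContMDiffAt IN 𝓘(ℂ, (EB × EG) →L[ℂ] LieAlg EG G) ω
      (fun n => ((flatForm IB EG e (b n)).comp
        ((trivializationAt (EB × EG) (TangentSpace (IB.prod 𝓘(ℂ, EG))) (b n₀)).symmL ℂ (b n)) :
          (EB × EG) →L[ℂ] LieAlg EG G)) n₀ := by
  have : IsManifold (IB.prod 𝓘(ℂ, EG)) 1 (TotalSpace G P) := IsManifold.of_le (n := ω) le_top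
  have he := contMDiffAt_triv_snd (IB := IB) (EG := EG) e hn
  have heb : ContMDiffAt IN 𝓘(ℂ, EG) ω (fun n => (e (b n)).2) n₀ :=
    ContMDiffAt.comp (g := fun z : TotalSpace G P => (e z).2) n₀ he hb
  have h1 := contMDiffAt_mfderiv_toLie (IB := IB.prod 𝓘(ℂ, EG)) (IN := IN) (EG := EG)
    (f := fun n z => (e z).2 * (e (b n)).2⁻¹) (g := b) (x₀ := n₀)
    ((ContMDiffAt.comp (n₀, b n₀) he contMDiffAt_snd).mul
      (ContMDiffAt.comp (n₀, b n₀) heb contMDiffAt_fst).inv)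
    hb (fun x => mul_inv_cancel _)
    (fun n => (trivDeriv IB EG e (b n) : (EB × EG) →L[ℂ] LieAlg EG G).comp
      ((tangentBundleCore (IB.prod 𝓘(ℂ, EG)) (TotalSpace G P)).coordChange
        (achart (ModelProd HB EG) (b n₀)) (achart (ModelProd HB EG) (b n)) (b n)))
    (fun x v => rfl)
  have hA : ContMDiffAt IN 𝓘(ℂ, LieAlg EG G →L[ℂ] LieAlg EG G) ω
      (fun n => Ad EG (e (b n)).2⁻¹) n₀ :=
    (contMDiff_Ad (EG := EG) (G := G)).contMDiffAt.comp n₀ heb.inv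
  refine (hA.clm_comp h1).congr_of_eventuallyEq ?_
  filter_upwards [hb.continuousAt.preimage_mem_nhds
    ((chartAt (ModelProd HB EG) (b n₀)).open_source.mem_nhds
      (mem_chart_source (ModelProd HB EG) (b n₀)))] with n hn'
  have h3 := TangentBundle.symmL_trivializationAt_eq_core (I := IB.prod 𝓘(ℂ, EG))
    (show b n ∈ (chartAt (ModelProd HB EG) (b n₀)).source from hn')
  refine ContinuousLinearMap.ext fun w => ?_
  exact congrArg (fun L : (EB × EG) →L[ℂ] (EB × EG) => flatForm IB EG e (b n) (L w)) h3

end FlatForm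

/-! ### The canonical map `F : f^*P → P` and its differential -/

section Pullback
variable {EB : Type*} [NormedAddCommGroup EB] [NormedSpace ℂ EB] {HB : Type*} [TopologicalSpace HB]
  {IB : ModelWithCorners ℂ EB HB} {B : Type*} [TopologicalSpace B] [ChartedSpace HB B]
  {EG : Type*} [NormedAddCommGroup EG] [NormedSpace ℂ EG]
  {G : Type*} [TopologicalSpace G] [ChartedSpace EG G] [Group G] [LieGroup 𝓘(ℂ, EG) ω G]
  {P : B → Type*} [TopologicalSpace (TotalSpace G P)] [∀ x, TopologicalSpace (P x)]
  [∀ x, Nonempty (P x)]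
  [FiberBundle G P] [∀ x, MulAction Gᵐᵒᵖ (P x)]
  [IsManifold IB ω B] [hP : IsHolomorphicPrincipalBundle IB EG G P]
  {EC : Type*} [NormedAddCommGroup EC] [NormedSpace ℂ EC] {HC : Type*} [TopologicalSpace HC]
  {IC : ModelWithCorners ℂ EC HC} {C : Type*} [TopologicalSpace C] [ChartedSpace HC C]
  [IsManifold IC ω C]
  {EN HN N : Type*} [NormedAddCommGroup EN] [NormedSpace ℂ EN] [TopologicalSpace HN]
  {IN : ModelWithCorners ℂ EN HN} [TopologicalSpace N] [ChartedSpace HN N]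

/-- The canonical map `f^*P → P` is holomorphic. -/
theorem contMDiff_lift (f : C^ω⟮IC, C; IB, B⟯) :
    ContMDiff (IC.prod 𝓘(ℂ, EG)) (IB.prod 𝓘(ℂ, EG)) ω
      (Pullback.lift f : TotalSpace G ((f : C → B) *ᵖ P) → TotalSpace G P) := by
  intro z
  let e := trivializationAt G P (f z.1)
  have hz : f z.1 ∈ e.baseSet := mem_baseSet_trivializationAt G P (f z.1)
  have : MemTrivializationAtlas (e.pullback f) := ⟨⟨e, inferInstance, rfl⟩⟩
  have h1 : ContMDiffAt (IC.prod 𝓘(ℂ, EG)) (IC.prod 𝓘(ℂ, EG)) ω (e.pullback f) z :=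
    contMDiffAt_triv (IB := IC) (e.pullback f) hz
  -- Read in `e.pullback f` and `e`, the canonical map is `(y, g) ↦ (f y, g)`.
  have h2 : ContMDiffAt (IC.prod 𝓘(ℂ, EG)) (IB.prod 𝓘(ℂ, EG)) ω
      (fun y : TotalSpace G ((f : C → B) *ᵖ P) => (f y.1, (e.pullback f y).2)) z :=
    (f.contMDiff.contMDiffAt.comp z
      (contMDiff_projP (IB := IC) (EG := EG) (P := (f : C → B) *ᵖ P) z)).prodMk
      (contMDiffAt_snd.comp z h1)
  have h3 : ContMDiffAt (IB.prod 𝓘(ℂ, EG)) (IB.prod 𝓘(ℂ, EG)) ω e.toOpenPartialHomeomorph.symm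
      (f z.1, (e.pullback f z).2) := contMDiffAt_triv_symm e hz
  refine (ContMDiffAt.comp z h3 h2).congr_of_eventuallyEq ?_
  filter_upwards [(e.pullback f).open_source.mem_nhds ((e.pullback f).mem_source.2 hz)] with y hy
  have hy' : f y.1 ∈ e.baseSet := (e.pullback f).mem_source.1 hy
  have h4 : e (Pullback.lift f y) = (f y.1, (e.pullback f y).2) :=
    Prod.ext (e.coe_fst' (x := Pullback.lift f y) hy') rfl
  change _ = e.toOpenPartialHomeomorph.symm (f y.1, (e.pullback f y).2)
  rw [← h4]
  exact (e.left_inv (x := Pullback.lift f y) (e.mem_source.2 hy')).symm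

/-- A map to `f^*P` is holomorphic if its components in the base and in `P` are. -/
theorem contMDiff_toPullback (f : C^ω⟮IC, C; IB, B⟯) {g : N → TotalSpace G ((f : C → B) *ᵖ P)}
    (h1 : ContMDiff IN IC ω (fun n => (g n).1))
    (h2 : ContMDiff IN (IB.prod 𝓘(ℂ, EG)) ω (fun n => (Pullback.lift f (g n) : TotalSpace G P))) :
    ContMDiff IN (IC.prod 𝓘(ℂ, EG)) ω g := by
  intro n
  let e := trivializationAt G P (f (g n).1)
  have hz : f (g n).1 ∈ e.baseSet := mem_baseSet_trivializationAt G P (f (g n).1)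
  have : MemTrivializationAtlas (e.pullback f) := ⟨⟨e, inferInstance, rfl⟩⟩
  have h3 : ContMDiffAt IN (IC.prod 𝓘(ℂ, EG)) ω
      (fun m => ((g m).1, (e (Pullback.lift f (g m))).2)) n :=
    (h1 n).prodMk (contMDiffAt_snd.comp n ((contMDiffAt_triv (IB := IB) (EG := EG) e
      (z := Pullback.lift f (g n)) hz).comp n (h2 n)))
  have h4 : ContMDiffAt (IC.prod 𝓘(ℂ, EG)) (IC.prod 𝓘(ℂ, EG)) ω
      (e.pullback f).toOpenPartialHomeomorph.symm ((g n).1, (e (Pullback.lift f (g n))).2) :=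
    contMDiffAt_triv_symm (IB := IC) (e.pullback f) hz
  refine (ContMDiffAt.comp n h4 h3).congr_of_eventuallyEq ?_
  have h5 : ∀ᶠ m in 𝓝 n, (g m).1 ∈ (e.pullback f).baseSet :=
    (h1 n).continuousAt.eventually ((e.pullback f).open_baseSet.mem_nhds hz)
  filter_upwards [h5] with m hm
  exact ((e.pullback f).left_inv ((e.pullback f).mem_source.2 hm)).symm

/-- The canonical map sends the orbit map of `z` to the orbit map of its image; differentiate at
`1`. -/
theorem liftDeriv_vert (f : C^ω⟮IC, C; IB, B⟯) (z : TotalSpace G ((f : C → B) *ᵖ P))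
    (ξ : LieAlg EG G) :
    liftDeriv (IB := IB) f z (vert IC EG z ξ) = vert IB EG (Pullback.lift f z : TotalSpace G P) ξ := by
  have c := mfderiv_comp_of_eq (I := 𝓘(ℂ, EG)) (I' := IC.prod 𝓘(ℂ, EG)) (I'' := IB.prod 𝓘(ℂ, EG))
    (x := (1 : G)) (f := fun g : G => rightMul g z) (y := z)
    ((contMDiff_lift (IB := IB) (EG := EG) (G := G) (P := P) f).mdifferentiableAt (by simp))
    ((contMDiff_orbit (IB := IC) (EG := EG) z).mdifferentiableAt (by simp)) (rightMul_one z)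
  have c5 : ∀ (a : TotalSpace G ((f : C → B) *ᵖ P)) (_ : a = z) (u : EC × EG),
      (mfderiv (IC.prod 𝓘(ℂ, EG)) (IB.prod 𝓘(ℂ, EG))
        (Pullback.lift f : TotalSpace G ((f : C → B) *ᵖ P) → TotalSpace G P) a u : EB × EG) =
      liftDeriv (IB := IB) f z u := by
    rintro _ rfl u; rfl
  exact (c5 _ (rightMul_one z) _).symm.trans
    (congrArg (fun L : EG →L[ℂ] (EB × EG) => L ξ) c).symm

theorem liftDeriv_rightMulDeriv (f : C^ω⟮IC, C; IB, B⟯) (g : G)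
    (z : TotalSpace G ((f : C → B) *ᵖ P)) (v : TangentSpace (IC.prod 𝓘(ℂ, EG)) z) :
    liftDeriv (IB := IB) f (rightMul g z) (rightMulDeriv IC EG g z v) =
      rightMulDeriv IB EG g (Pullback.lift f z : TotalSpace G P) (liftDeriv (IB := IB) f z v) := by
  have hF := contMDiff_lift (IB := IB) (EG := EG) (G := G) (P := P) f
  have c1 := mfderiv_comp (I := IC.prod 𝓘(ℂ, EG)) (I' := IC.prod 𝓘(ℂ, EG))
    (I'' := IB.prod 𝓘(ℂ, EG)) z (hF.mdifferentiableAt (x := rightMul g z) (by simp))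
    ((contMDiff_rightMul (IB := IC) (EG := EG) (P := (f : C → B) *ᵖ P) g).mdifferentiableAt
      (by simp))
  have c2 := mfderiv_comp (I := IC.prod 𝓘(ℂ, EG)) (I' := IB.prod 𝓘(ℂ, EG))
    (I'' := IB.prod 𝓘(ℂ, EG)) z
    ((contMDiff_rightMul (IB := IB) (EG := EG) (P := P) g).mdifferentiableAt
      (x := Pullback.lift f z) (by simp)) (hF.mdifferentiableAt (by simp))
  exact (congrArg (fun L : (EC × EG) →L[ℂ] (EB × EG) => L v) c1).symm.trans
    (congrArg (fun L : (EC × EG) →L[ℂ] (EB × EG) => L v) c2)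

theorem mfderiv_proj_liftDeriv (f : C^ω⟮IC, C; IB, B⟯) (z : TotalSpace G ((f : C → B) *ᵖ P))
    (v : TangentSpace (IC.prod 𝓘(ℂ, EG)) z) :
    mfderiv (IB.prod 𝓘(ℂ, EG)) IB (π G P) (Pullback.lift f z) (liftDeriv (IB := IB) f z v) =
      mfderiv IC IB f z.1 (mfderiv (IC.prod 𝓘(ℂ, EG)) IC (π G ((f : C → B) *ᵖ P)) z v) := by
  have c1 := mfderiv_comp (I := IC.prod 𝓘(ℂ, EG)) (I' := IB.prod 𝓘(ℂ, EG)) (I'' := IB) z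
    ((contMDiff_projP (IB := IB) (EG := EG) (P := P)).mdifferentiableAt
      (x := Pullback.lift f z) (by simp))
    ((contMDiff_lift (IB := IB) (EG := EG) (G := G) (P := P) f).mdifferentiableAt (by simp))
  have c2 := mfderiv_comp (I := IC.prod 𝓘(ℂ, EG)) (I' := IC) (I'' := IB) z
    (f.contMDiff.mdifferentiableAt (x := z.1) (by simp))
    ((contMDiff_projP (IB := IC) (EG := EG) (P := (f : C → B) *ᵖ P)).mdifferentiableAt (by simp))
  exact (congrArg (fun L : (EC × EG) →L[ℂ] EB => L v) c1).symm.trans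
    (congrArg (fun L : (EC × EG) →L[ℂ] EB => L v) c2)

/-- If `f` is a submersion, then so is the canonical map `f^*P → P`. -/
theorem liftDeriv_surjective (f : C^ω⟮IC, C; IB, B⟯)
    (hf : ∀ y, Function.Surjective (mfderiv IC IB f y)) (z : TotalSpace G ((f : C → B) *ᵖ P)) :
    Function.Surjective (liftDeriv (IB := IB) f z :
      TangentSpace (IC.prod 𝓘(ℂ, EG)) z →L[ℂ]
        TangentSpace (IB.prod 𝓘(ℂ, EG)) (Pullback.lift f z : TotalSpace G P)) := by
  intro u
  obtain ⟨w, hw⟩ := hf z.1 (mfderiv (IB.prod 𝓘(ℂ, EG)) IB (π G P) (Pullback.lift f z) u)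
  obtain ⟨v, hv⟩ := mfderiv_proj_surjective (IB := IC) (EG := EG) z w
  let e := trivializationAt G P (f z.1)
  have hz : (Pullback.lift f z : TotalSpace G P).1 ∈ e.baseSet :=
    mem_baseSet_trivializationAt G P (f z.1)
  -- The vector `v` has the right image in the tangent space of the base, so the error `u'` is
  -- vertical. Vertical vectors of `P` are images of vertical vectors of `f^*P`.
  let u' : TangentSpace (IB.prod 𝓘(ℂ, EG)) (Pullback.lift f z : TotalSpace G P) :=
    u - liftDeriv (IB := IB) f z v
  have hu' : mfderiv (IB.prod 𝓘(ℂ, EG)) IB (π G P) (Pullback.lift f z) u' = 0 := by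
    have h1 := map_sub (mfderiv (IB.prod 𝓘(ℂ, EG)) IB (π G P) (Pullback.lift f z)) u
      (liftDeriv (IB := IB) f z v)
    refine h1.trans (sub_eq_zero.2 ?_)
    rw [mfderiv_proj_liftDeriv, hv, hw]
  refine ⟨v + vert IC EG z (flatForm IB EG e (Pullback.lift f z) u'), ?_⟩
  rw [map_add, liftDeriv_vert, vert_flatForm e hz hu']
  exact add_sub_cancel _ _

end Pullback

/-! ### The form on the fibres of `P` defined by a point of `C_λ(P)` -/

section Tautological
variable {EB : Type*} [NormedAddCommGroup EB] [NormedSpace ℂ EB] {HB : Type*} [TopologicalSpace HB]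
  {IB : ModelWithCorners ℂ EB HB} {B : Type*} [TopologicalSpace B] [ChartedSpace HB B]
  {EG : Type*} [NormedAddCommGroup EG] [NormedSpace ℂ EG]
  {G : Type*} [TopologicalSpace G] [ChartedSpace EG G] [Group G] [LieGroup 𝓘(ℂ, EG) ω G]
  {P : B → Type*} [TopologicalSpace (TotalSpace G P)] [∀ x, TopologicalSpace (P x)]
  [∀ x, Nonempty (P x)]
  [FiberBundle G P] [∀ x, MulAction Gᵐᵒᵖ (P x)]
  [hP : IsHolomorphicPrincipalBundle IB EG G P] [IsManifold IB ω B]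
  [FiniteDimensional ℂ EB] {lam : ℂ}

/-- The lift of tangent vectors of `B` to the point `p` of `P` defined by an element of `C_λ(P)`. -/
def CFibre.lift {x : B} (h : CFibre IB EG G P lam x) (p : P x) :
    TangentSpace IB x →L[ℂ] TangentSpace (IB.prod 𝓘(ℂ, EG)) (⟨x, p⟩ : TotalSpace G P) :=
  have : FiniteDimensional ℂ (TangentSpace IB x) := inferInstanceAs (FiniteDimensional ℂ EB)
  have : T2Space (TangentSpace IB x) := inferInstanceAs (T2Space EB)
  LinearMap.toContinuousLinearMap (LinearMap.proj (R := ℂ)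
      (φ := fun p : P x => TangentSpace (IB.prod 𝓘(ℂ, EG)) (⟨x, p⟩ : TotalSpace G P)) p ∘ₗ
    (atFibre IB EG (G := G) P x).subtype ∘ₗ h.1)

/-- The `𝔤`-valued linear form on the tangent space of `P` at `p` defined by an element of
`C_λ(P)`. -/
def tautForm {x : B} (h : CFibre IB EG G P lam x) (p : P x) :
    TangentSpace (IB.prod 𝓘(ℂ, EG)) (⟨x, p⟩ : TotalSpace G P) →L[ℂ] LieAlg EG G :=
  (flatForm IB EG (trivializationAt G P x) (⟨x, p⟩ : TotalSpace G P)).comp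
    (lam • ContinuousLinearMap.id ℂ _ -
      (h.lift p).comp (mfderiv (IB.prod 𝓘(ℂ, EG)) IB (π G P) (⟨x, p⟩ : TotalSpace G P)))

/-- Both terms project to `λ dπ(u)`, the second by the condition that defines `C_λ(P)`. Hence the
difference is vertical and comes from an element of `𝔤`. -/
theorem mfderiv_proj_sub_lift {x : B} (h : CFibre IB EG G P lam x) (p : P x)
    (u : TangentSpace (IB.prod 𝓘(ℂ, EG)) (⟨x, p⟩ : TotalSpace G P)) :
    mfderiv (IB.prod 𝓘(ℂ, EG)) IB (π G P) (⟨x, p⟩ : TotalSpace G P)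
      (lam • u - (h.1 (mfderiv (IB.prod 𝓘(ℂ, EG)) IB (π G P) ⟨x, p⟩ u)).1 p) = 0 := by
  refine (map_sub (mfderiv (IB.prod 𝓘(ℂ, EG)) IB (π G P) (⟨x, p⟩ : TotalSpace G P)) _ _).trans ?_
  rw [h.2, map_smul]
  exact sub_self _

/-- The trivialization chosen in the definition of `tautForm` is irrelevant, as all flat forms agree
on vertical vectors. This allows one fixed `e` for all points near a given one. -/
theorem tautForm_eq_flatForm (e : Trivialization G (π G P)) [MemTrivializationAtlas e] {x : B}
    (hx : x ∈ e.baseSet) (h : CFibre IB EG G P lam x) (p : P x)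
    (u : TangentSpace (IB.prod 𝓘(ℂ, EG)) (⟨x, p⟩ : TotalSpace G P)) :
    tautForm h p u = flatForm IB EG e ⟨x, p⟩
      (lam • u - (h.1 (mfderiv (IB.prod 𝓘(ℂ, EG)) IB (π G P) ⟨x, p⟩ u)).1 p) := by
  apply vert_injective (IB := IB) (⟨x, p⟩ : TotalSpace G P)
  refine Eq.trans ?_ (vert_flatForm e (z := ⟨x, p⟩) hx (mfderiv_proj_sub_lift h p u)).symm
  exact vert_flatForm (trivializationAt G P x) (z := ⟨x, p⟩)
    (mem_baseSet_trivializationAt G P x) (mfderiv_proj_sub_lift h p u)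

theorem vert_tautForm {x : B} (h : CFibre IB EG G P lam x) (p : P x)
    (u : TangentSpace (IB.prod 𝓘(ℂ, EG)) (⟨x, p⟩ : TotalSpace G P)) :
    vert IB EG ⟨x, p⟩ (tautForm h p u) =
      lam • u - (h.1 (mfderiv (IB.prod 𝓘(ℂ, EG)) IB (π G P) ⟨x, p⟩ u)).1 p :=
  vert_flatForm (trivializationAt G P x) (z := ⟨x, p⟩)
    (mem_baseSet_trivializationAt G P x) (mfderiv_proj_sub_lift h p u)

theorem tautForm_vert {x : B} (h : CFibre IB EG G P lam x) (p : P x) (ξ : LieAlg EG G) :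
    tautForm h p (vert IB EG ⟨x, p⟩ ξ) = lam • ξ := by
  apply vert_injective (IB := IB) (⟨x, p⟩ : TotalSpace G P)
  rw [vert_tautForm, mfderiv_proj_vert, map_smul, map_zero]
  exact sub_zero _

/-- Compare after the injective map `vert`. Right translation carries `λ u - h(dπ u)` at `p` to the
same expression at `p g`, because `h` has values in invariant families and `dπ` is invariant; `vert`
turns right translation into `Ad g⁻¹`. -/
theorem tautForm_rightMulDeriv {x : B} (h : CFibre IB EG G P lam x) (p : P x) (g : G)
    (u : TangentSpace (IB.prod 𝓘(ℂ, EG)) (⟨x, p⟩ : TotalSpace G P)) :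
    tautForm h (MulOpposite.op g • p) (rightMulDeriv IB EG g ⟨x, p⟩ u) =
      Ad EG g⁻¹ (tautForm h p u) := by
  apply vert_injective (IB := IB) (⟨x, MulOpposite.op g • p⟩ : TotalSpace G P)
  refine Eq.trans ?_ (rightMulDeriv_vert g (⟨x, p⟩ : TotalSpace G P) (tautForm h p u))
  rw [vert_tautForm h p u]
  refine (vert_tautForm h (MulOpposite.op g • p) _).trans ?_
  refine Eq.trans ?_ (map_sub (rightMulDeriv IB EG g (⟨x, p⟩ : TotalSpace G P)) _ _).symm
  have h1 := mfderiv_proj_rightMulDeriv (IB := IB) (EG := EG) g (⟨x, p⟩ : TotalSpace G P) u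
  have h2 : mfderiv (IB.prod 𝓘(ℂ, EG)) IB (π G P)
      (⟨x, MulOpposite.op g • p⟩ : TotalSpace G P) (rightMulDeriv IB EG g ⟨x, p⟩ u) =
      mfderiv (IB.prod 𝓘(ℂ, EG)) IB (π G P) (⟨x, p⟩ : TotalSpace G P) u := h1
  rw [h2, (h.1 _).2 p g, map_smul]
  rfl

/-- On the section of `e` this is the definition of `cCoord`. Elsewhere it follows from the
invariance of `h w` and the equivariance of the flat form. -/
theorem flatForm_lift (e : Trivialization G (π G P)) [MemTrivializationAtlas e] (x₀ : B) {x : B}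
    (hx : x ∈ e.baseSet) (hx' : x ∈ (trivializationAt EB (TangentSpace IB) x₀).baseSet)
    (h : CFibre IB EG G P lam x) (p : P x) (w : TangentSpace IB x) :
    flatForm IB EG e ⟨x, p⟩ ((h.1 w).1 p) = Ad EG (e ⟨x, p⟩).2⁻¹
      (cCoord e x₀ h ((trivializationAt EB (TangentSpace IB) x₀).continuousLinearMapAt ℂ x w)) := by
  rw [cCoord_apply, Trivialization.symmL_continuousLinearMapAt _ hx' w,
    ← flatForm_sec (IB := IB) (EG := EG) e hx]
  obtain ⟨g, hg, rfl⟩ : ∃ g : G, g = (e ⟨x, p⟩).2 ∧ p = MulOpposite.op g • e.symm x (1 : G) :=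
    ⟨_, rfl, eq_smul_sec (IB := IB) (EG := EG) e hx p⟩
  rw [← hg, (h.1 w).2]
  exact flatForm_rightMulDeriv e (z := ⟨x, e.symm x (1 : G)⟩) hx g _

/-- The formula in local coordinates behind both holomorphy proofs: each factor on the right depends
holomorphically on `p`, `x` and the coordinate of `h`. -/
theorem tautForm_eq (e : Trivialization G (π G P)) [MemTrivializationAtlas e] (x₀ : B) {x : B}
    (hx : x ∈ e.baseSet) (hx' : x ∈ (trivializationAt EB (TangentSpace IB) x₀).baseSet)
    (h : CFibre IB EG G P lam x) (p : P x)
    (u : TangentSpace (IB.prod 𝓘(ℂ, EG)) (⟨x, p⟩ : TotalSpace G P)) :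
    tautForm h p u = lam • flatForm IB EG e ⟨x, p⟩ u - Ad EG (e ⟨x, p⟩).2⁻¹
      (cCoord e x₀ h ((trivializationAt EB (TangentSpace IB) x₀).continuousLinearMapAt ℂ x
        (mfderiv (IB.prod 𝓘(ℂ, EG)) IB (π G P) ⟨x, p⟩ u))) := by
  rw [tautForm_eq_flatForm e hx, ← flatForm_lift e x₀ hx hx' h p]
  refine (map_sub (flatForm IB EG e (⟨x, p⟩ : TotalSpace G P)) _ _).trans ?_
  rw [map_smul]

end Tautological

/-! ### Forms on `f^*P` that factor through `dF` -/

section Forms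
variable {EB : Type*} [NormedAddCommGroup EB] [NormedSpace ℂ EB] {HB : Type*} [TopologicalSpace HB]
  {IB : ModelWithCorners ℂ EB HB} {B : Type*} [TopologicalSpace B] [ChartedSpace HB B]
  {EG : Type*} [NormedAddCommGroup EG] [NormedSpace ℂ EG]
  {G : Type*} [TopologicalSpace G] [ChartedSpace EG G] [Group G] [LieGroup 𝓘(ℂ, EG) ω G]
  {P : B → Type*} [TopologicalSpace (TotalSpace G P)] [∀ x, TopologicalSpace (P x)]
  [∀ x, Nonempty (P x)]
  [FiberBundle G P] [∀ x, MulAction Gᵐᵒᵖ (P x)]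
  [hP : IsHolomorphicPrincipalBundle IB EG G P] [IsManifold IB ω B]
  {EC : Type*} [NormedAddCommGroup EC] [NormedSpace ℂ EC] {HC : Type*} [TopologicalSpace HC]
  {IC : ModelWithCorners ℂ EC HC} {C : Type*} [TopologicalSpace C] [ChartedSpace HC C]
  [IsManifold IC ω C]

/-- The form on `f^*P` defined by a holomorphic homomorphism from `F^* T_P` is holomorphic. -/
theorem contMDiff_form_comp_liftDeriv (f : C^ω⟮IC, C; IB, B⟯)
    {s : ∀ z : TotalSpace G ((f : C → B) *ᵖ P),
      TangentSpace (IB.prod 𝓘(ℂ, EG)) (Pullback.lift f z : TotalSpace G P) →L[ℂ] LieAlg EG G}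
    (hs : ContMDiff (IC.prod 𝓘(ℂ, EG))
      ((IB.prod 𝓘(ℂ, EG)).prod 𝓘(ℂ, (EB × EG) →L[ℂ] LieAlg EG G)) ω
      (fun z => (⟨Pullback.lift f z, s z⟩ :
        TotalSpace ((EB × EG) →L[ℂ] LieAlg EG G) (FormBundle IB EG G P)))) :
    ContMDiff (IC.prod 𝓘(ℂ, EG))
      ((IC.prod 𝓘(ℂ, EG)).prod 𝓘(ℂ, (EC × EG) →L[ℂ] LieAlg EG G)) ω
      (fun z => (⟨z, (s z).comp (liftDeriv (IB := IB) f z)⟩ :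
        TotalSpace ((EC × EG) →L[ℂ] LieAlg EG G) (FormBundle IC EG G ((f : C → B) *ᵖ P)))) := by
  intro z₀
  have hF := contMDiff_lift (IB := IB) (EG := EG) (G := G) (P := P) f
  have h1 := (contMDiffAt_hom_trivial_iff.1 (hs z₀)).2
  have h2 := contMDiffAt_coord_mfderiv (b := id) (n₀ := z₀) (hF z₀) contMDiffAt_id
  refine contMDiffAt_hom_trivial_iff.2 ⟨contMDiffAt_id, ?_⟩
  refine (h1.clm_comp h2).congr_of_eventuallyEq ?_
  have : IsManifold (IB.prod 𝓘(ℂ, EG)) 1 (TotalSpace G P) := IsManifold.of_le (n := ω) le_top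
  let T := trivializationAt (EB × EG) (TangentSpace (IB.prod 𝓘(ℂ, EG)))
    (Pullback.lift f z₀ : TotalSpace G P)
  filter_upwards [hF.continuous.continuousAt.preimage_mem_nhds (T.open_baseSet.mem_nhds
    (mem_baseSet_trivializationAt (EB × EG) (TangentSpace (IB.prod 𝓘(ℂ, EG)))
      (Pullback.lift f z₀ : TotalSpace G P)))] with z hz
  refine ContinuousLinearMap.ext fun w => ?_
  -- In the product of the two coordinate expressions the trivialization `T` and its inverse cancel
  -- over the base set of `T`.
  exact congrArg (s z) (T.symmL_continuousLinearMapAt (R := ℂ) hz _).symm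

end Forms

/-! ### The universal `λ`-connection on `q^*P` -/

section Nabla
variable {EB : Type*} [NormedAddCommGroup EB] [NormedSpace ℂ EB] {HB : Type*} [TopologicalSpace HB]
  {IB : ModelWithCorners ℂ EB HB} {B : Type*} [TopologicalSpace B] [ChartedSpace HB B]
  {EG : Type*} [NormedAddCommGroup EG] [NormedSpace ℂ EG]
  {G : Type*} [TopologicalSpace G] [ChartedSpace EG G] [Group G] [LieGroup 𝓘(ℂ, EG) ω G]
  {P : B → Type*} [TopologicalSpace (TotalSpace G P)] [∀ x, TopologicalSpace (P x)]
  [∀ x, Nonempty (P x)]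
  [FiberBundle G P] [∀ x, MulAction Gᵐᵒᵖ (P x)]
  [hP : IsHolomorphicPrincipalBundle IB EG G P] [IsManifold IB ω B]
  [FiniteDimensional ℂ EB] {lam : ℂ}

variable (IB EG G P lam) in
/-- The tautological homomorphism `Q^* T_P → 𝔤` for the canonical map `Q : q^*P → P`. -/
def tautHom (z : TotalSpace G (cProj IB EG G P lam *ᵖ P)) :
    TangentSpace (IB.prod 𝓘(ℂ, EG)) (Pullback.lift (cProj IB EG G P lam) z : TotalSpace G P) →L[ℂ]
      LieAlg EG G :=
  tautForm (P := P) z.1.2 z.2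

variable (IB EG G P lam) in
/-- The tautological `λ`-connection on `q^*P`. -/
def tautConnection : LieForm (IB.prod 𝓘(ℂ, EB →L[ℂ] LieAlg EG G)) EG G
    (cProj IB EG G P lam *ᵖ P) :=
  fun z => (tautHom IB EG G P lam z).comp (liftDeriv (EG := EG) (cProj IB EG G P lam) z)

theorem isTautologicalForm_tautConnection :
    IsTautologicalForm lam (tautConnection IB EG G P lam) := by
  rintro x h p v u rfl
  exact vert_tautForm h p _

/-- By `tautForm_eq`, with `e` and `T` fixed at the base point of `z₀`, the homomorphism is a
combination of `flatForm`, `Ad`, `cCoord` and `dπ`, and each of these is holomorphic. -/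
theorem contMDiff_tautHom : ContMDiff ((IB.prod 𝓘(ℂ, EB →L[ℂ] LieAlg EG G)).prod 𝓘(ℂ, EG))
      ((IB.prod 𝓘(ℂ, EG)).prod 𝓘(ℂ, (EB × EG) →L[ℂ] LieAlg EG G)) ω
      (fun z => (⟨Pullback.lift (cProj IB EG G P lam) z, tautHom IB EG G P lam z⟩ :
        TotalSpace ((EB × EG) →L[ℂ] LieAlg EG G) (FormBundle IB EG G P))) := by
  intro z₀
  have : IsManifold IB 1 B := IsManifold.of_le (n := ω) le_top
  have hF := contMDiff_lift (IB := IB) (EG := EG) (G := G) (P := P) (cProj IB EG G P lam)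
  let x₀ : B := z₀.1.1
  let e := trivializationAt G P x₀
  have he : x₀ ∈ e.baseSet := mem_baseSet_trivializationAt G P x₀
  let T := trivializationAt EB (TangentSpace IB) x₀
  have hT : x₀ ∈ T.baseSet := mem_baseSet_trivializationAt EB (TangentSpace IB) x₀
  have h1 := contMDiffAt_coord_flatForm (IB := IB) e (hF z₀) he
  have h2 := contMDiffAt_coord_mfderiv (φ := π G P) (b := Pullback.lift (cProj IB EG G P lam))
    (n₀ := z₀) (contMDiff_projP (IB := IB) (EG := EG) (P := P) _) (hF z₀)
  have h3 : ContMDiffAt ((IB.prod 𝓘(ℂ, EB →L[ℂ] LieAlg EG G)).prod 𝓘(ℂ, EG))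
      𝓘(ℂ, LieAlg EG G →L[ℂ] LieAlg EG G) ω
      (fun z : TotalSpace G (cProj IB EG G P lam *ᵖ P) =>
        Ad EG (e (Pullback.lift (cProj IB EG G P lam) z)).2⁻¹) z₀ :=
    (contMDiff_Ad (EG := EG) (G := G)).contMDiffAt.comp z₀
      (ContMDiffAt.inv (ContMDiffAt.comp (g := fun z : TotalSpace G P => (e z).2) z₀
        (contMDiffAt_triv_snd (IB := IB) (EG := EG) e he) (hF z₀)))
  -- `cCoord e x₀` is by definition the fibre component of the local trivialization of `C_λ(P)` at
  -- `x₀`, so it is holomorphic along the projection `q^*P → C_λ(P)`.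
  have h4 : ContMDiffAt ((IB.prod 𝓘(ℂ, EB →L[ℂ] LieAlg EG G)).prod 𝓘(ℂ, EG))
      𝓘(ℂ, EB →L[ℂ] LieAlg EG G) ω
      (fun z : TotalSpace G (cProj IB EG G P lam *ᵖ P) => cCoord e x₀ z.1.2) z₀ :=
    ((contMDiffAt_totalSpace (F := EB →L[ℂ] LieAlg EG G) (E := CFibre IB EG G P lam)).1
      (contMDiff_projP (IB := IB.prod 𝓘(ℂ, EB →L[ℂ] LieAlg EG G)) (EG := EG)
        (P := cProj IB EG G P lam *ᵖ P) z₀)).2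
  have h5 : ContMDiffAt ((IB.prod 𝓘(ℂ, EB →L[ℂ] LieAlg EG G)).prod 𝓘(ℂ, EG)) 𝓘(ℂ, ℂ) ω
      (fun z : TotalSpace G (cProj IB EG G P lam *ᵖ P) => lam) z₀ := contMDiffAt_const
  refine contMDiffAt_hom_trivial_iff.2 ⟨hF z₀, ?_⟩
  refine ((h5.smul h1).sub (h3.clm_comp (h4.clm_comp h2))).congr_of_eventuallyEq ?_
  have hb : ContinuousAt (fun z : TotalSpace G (cProj IB EG G P lam *ᵖ P) => z.1.1) z₀ :=
    ((contMDiff_projP (IB := IB) (EG := EG) (P := P)).continuous.comp hF.continuous).continuousAt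
  filter_upwards [hb.preimage_mem_nhds (e.open_baseSet.mem_nhds he),
    hb.preimage_mem_nhds (T.open_baseSet.mem_nhds hT)] with z hz hz'
  refine ContinuousLinearMap.ext fun w => ?_
  exact tautForm_eq e x₀ hz hz' z.1.2 z.2 _

theorem trivialOnFibres_tautConnection :
    TrivialOnFibres (cProj IB EG G P lam) (tautConnection IB EG G P lam) :=
  ⟨tautHom IB EG G P lam, contMDiff_tautHom,
    fun g z w => tautForm_rightMulDeriv (P := P) z.1.2 z.2 g w, fun _ _ => rfl⟩

theorem isLambdaConnection_tautConnection :
    IsLambdaConnection lam (tautConnection IB EG G P lam) where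
  holomorphic := contMDiff_form_comp_liftDeriv _ contMDiff_tautHom
  equivariant g z v := by
    refine Eq.trans ?_ (tautForm_rightMulDeriv (P := P) z.1.2 z.2 g _)
    exact congrArg (tautForm (P := P) z.1.2 (MulOpposite.op g • z.2 : P z.1.1))
      (liftDeriv_rightMulDeriv (cProj IB EG G P lam) g z v)
  vertical z ξ := by
    refine Eq.trans ?_ (tautForm_vert (P := P) z.1.2 z.2 ξ)
    exact congrArg (tautForm (P := P) z.1.2 z.2) (liftDeriv_vert (cProj IB EG G P lam) z ξ)

end Nabla

/-! ### Separation and countability of total spaces -/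

section FiberBundle
variable {B F : Type*} [TopologicalSpace B] [TopologicalSpace F] {E : B → Type*}
  [TopologicalSpace (TotalSpace F E)] [∀ x, TopologicalSpace (E x)] [FiberBundle F E]

/-- Points in one fibre are separated inside a common trivialization, points in different fibres by
their projections. -/
theorem t2Space_totalSpace [T2Space B] [T2Space F] : T2Space (TotalSpace F E) := by
  refine ⟨fun z z' hz => ?_⟩
  by_cases h : z.1 = z'.1
  · let e := trivializationAt F E z.1
    have h1 : z ∈ e.source := e.mem_source.2 (mem_baseSet_trivializationAt F E z.1)
    have h2 : z' ∈ e.source := e.mem_source.2 (h ▸ mem_baseSet_trivializationAt F E z.1)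
    obtain ⟨u, v, hu, hv, h3, h4, h5⟩ := t2_separation (fun h3 => hz (e.injOn h1 h2 h3))
    exact ⟨e.source ∩ e ⁻¹' u, e.source ∩ e ⁻¹' v,
      e.continuousOn_toFun.isOpen_inter_preimage e.open_source hu,
      e.continuousOn_toFun.isOpen_inter_preimage e.open_source hv, ⟨h1, h3⟩, ⟨h2, h4⟩,
      (h5.preimage e).mono inter_subset_right inter_subset_right⟩
  · exact separated_by_continuous (FiberBundle.continuous_proj F E) h

/-- Countably many trivializing open sets cover the base, and over each of them the total space is
homeomorphic to an open subset of `B × F`. -/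
theorem secondCountableTopology_totalSpace [SecondCountableTopology B]
    [SecondCountableTopology F] : SecondCountableTopology (TotalSpace F E) := by
  obtain ⟨s, hs, hc⟩ := TopologicalSpace.countable_cover_nhds (fun x : B =>
    (trivializationAt F E x).open_baseSet.mem_nhds (mem_baseSet_trivializationAt F E x))
  have : Countable s := hs.to_subtype
  have : ∀ x : s, SecondCountableTopology (trivializationAt F E x.1).source := fun x =>
    (trivializationAt F E x.1).toOpenPartialHomeomorph.secondCountableTopology_source
  refine TopologicalSpace.secondCountableTopology_of_countable_cover
    (U := fun x : s => (trivializationAt F E x.1).source)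
    (fun x => (trivializationAt F E x.1).open_source) (eq_univ_of_forall fun z => ?_)
  have hz : z.1 ∈ ⋃ x ∈ s, (trivializationAt F E x).baseSet := hc ▸ mem_univ z.1
  obtain ⟨x, hx, hz⟩ := mem_iUnion₂.1 hz
  exact mem_iUnion.2 ⟨⟨x, hx⟩, (trivializationAt F E x).mem_source.2 hz⟩

end FiberBundle

/-! ### The affine structure of `C_λ(P)` -/

section Translations
variable {EB : Type*} [NormedAddCommGroup EB] [NormedSpace ℂ EB] {HB : Type*} [TopologicalSpace HB]
  {IB : ModelWithCorners ℂ EB HB} {B : Type*} [TopologicalSpace B] [ChartedSpace HB B]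
  {EG : Type*} [NormedAddCommGroup EG] [NormedSpace ℂ EG]
  {G : Type*} [TopologicalSpace G] [ChartedSpace EG G] [Group G] [LieGroup 𝓘(ℂ, EG) ω G]
  {P : B → Type*} [TopologicalSpace (TotalSpace G P)] [∀ x, TopologicalSpace (P x)]
  [∀ x, Nonempty (P x)]
  [FiberBundle G P] [∀ x, MulAction Gᵐᵒᵖ (P x)]
  [hP : IsHolomorphicPrincipalBundle IB EG G P] [IsManifold IB ω B]
  {lam : ℂ}

theorem translate_apply {x : B} (φ : TangentSpace IB x →L[ℂ] adBundle EG G P IB x)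
    (h : CFibre IB EG G P lam x) (w : TangentSpace IB x) (p : P x) :
    ((translate lam x φ h).1 w).1 p = vert IB EG ⟨x, p⟩ ((φ w).1 p) + (h.1 w).1 p := rfl

theorem cFibre_ext {x : B} {h h' : CFibre IB EG G P lam x}
    (H : ∀ w p, (h.1 w).1 p = (h'.1 w).1 p) : h = h' :=
  Subtype.ext (LinearMap.ext fun w => Subtype.ext (funext fun p => H w p))

variable [FiniteDimensional ℂ EB]

/-- The translation that maps `h` to `h'`. -/
def cFibreSub {x : B} (h h' : CFibre IB EG G P lam x) :
    TangentSpace IB x →L[ℂ] adBundle EG G P IB x :=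
  have : FiniteDimensional ℂ (TangentSpace IB x) := inferInstanceAs (FiniteDimensional ℂ EB)
  have : T2Space (TangentSpace IB x) := inferInstanceAs (T2Space EB)
  LinearMap.toContinuousLinearMap
    { toFun := fun w => ⟨fun p => flatForm IB EG (trivializationAt G P x) ⟨x, p⟩
          ((h'.1 w - h.1 w).1 p), fun p g => by
        beta_reduce
        rw [(h'.1 w - h.1 w).2 p g]
        exact flatForm_rightMulDeriv (trivializationAt G P x) (z := ⟨x, p⟩)
          (mem_baseSet_trivializationAt G P x) g _⟩
      map_add' := fun v w => Subtype.ext (funext fun p => by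
        refine Eq.trans ?_ (map_add (flatForm IB EG (trivializationAt G P x) ⟨x, p⟩) _ _)
        rw [map_add, map_add, add_sub_add_comm]
        rfl)
      map_smul' := fun c w => Subtype.ext (funext fun p => by
        refine Eq.trans ?_ (map_smul (flatForm IB EG (trivializationAt G P x) ⟨x, p⟩) c _)
        rw [map_smul, map_smul]
        exact congrArg (flatForm IB EG (trivializationAt G P x) ⟨x, p⟩)
          (smul_sub c ((h'.1 w).1 p) ((h.1 w).1 p)).symm) }

/-- `h w` and `h' w` both project to `λ w`, so their difference is vertical, where the flat form
inverts `vert`. -/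
theorem vert_cFibreSub {x : B} (h h' : CFibre IB EG G P lam x) (w : TangentSpace IB x) (p : P x) :
    vert IB EG ⟨x, p⟩ ((cFibreSub h h' w).1 p) = (h'.1 w).1 p - (h.1 w).1 p := by
  refine vert_flatForm (trivializationAt G P x) (z := ⟨x, p⟩)
    (mem_baseSet_trivializationAt G P x) (u := (h'.1 w).1 p - (h.1 w).1 p) ?_
  refine (map_sub (mfderiv (IB.prod 𝓘(ℂ, EG)) IB (π G P) (⟨x, p⟩ : TotalSpace G P)) _ _).trans ?_
  rw [h'.2, h.2]
  exact sub_self _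

theorem existsUnique_translate {x : B} (h h' : CFibre IB EG G P lam x) :
    ∃! φ : TangentSpace IB x →L[ℂ] adBundle EG G P IB x, translate lam x φ h = h' := by
  refine ⟨cFibreSub h h', cFibre_ext fun w p => ?_, ?_⟩
  · rw [translate_apply, vert_cFibreSub]
    exact sub_add_cancel _ _
  · rintro φ rfl
    refine ContinuousLinearMap.ext fun w => Subtype.ext (funext fun p => ?_)
    apply vert_injective (IB := IB) (⟨x, p⟩ : TotalSpace G P)
    refine Eq.trans ?_ (vert_cFibreSub h (translate lam x φ h) w p).symm
    rw [translate_apply]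
    exact (add_sub_cancel_right _ _).symm

/-- At the section `theta` is the flat form, which reads off the element of `𝔤` that defines a
vertical vector. So in coordinates a translation is an addition. -/
theorem cCoord_translate (e : Trivialization G (π G P)) [MemTrivializationAtlas e] (x₀ : B) {x : B}
    (hx : x ∈ e.baseSet) (φ : TangentSpace IB x →L[ℂ] adBundle EG G P IB x)
    (h : CFibre IB EG G P lam x) (w : EB) :
    cCoord e x₀ (translate lam x φ h) w =
      (φ ((trivializationAt EB (TangentSpace IB) x₀).symmL ℂ x w)).1 (e.symm x (1 : G)) +
        cCoord e x₀ h w := by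
  rw [cCoord_apply, cCoord_apply, translate_apply]
  refine (map_add (theta IB EG e x) _ _).trans ?_
  rw [← flatForm_sec (IB := IB) (EG := EG) e hx, flatForm_vert e (z := ⟨x, e.symm x (1 : G)⟩) hx]

/-- `ad P` is trivialized by evaluation on the section where the trivialization of `P` is `1`, the
section that also defines `cCoord`. Thus the coordinates of the two bundles match without a
transition function. -/
theorem hom_coord_apply (x₀ : B) {x : B} (hx : x ∈ (trivializationAt G P x₀).baseSet)
    (φ : TangentSpace IB x →L[ℂ] adBundle EG G P IB x) (w : EB) :
    (trivializationAt (EB →L[ℂ] LieAlg EG G)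
      (fun x => TangentSpace IB x →L[ℂ] adBundle EG G P IB x) x₀ ⟨x, φ⟩).2 w =
    (φ ((trivializationAt EB (TangentSpace IB) x₀).symmL ℂ x w)).1
      ((trivializationAt G P x₀).symm x (1 : G)) := by
  have hx' : x ∈ (trivializationAt (LieAlg EG G) (adBundle EG G P IB) x₀).baseSet := hx
  rw [hom_trivializationAt_apply]
  exact congrFun (Trivialization.coe_linearMapAt_of_mem (R := ℂ)
    (trivializationAt (LieAlg EG G) (adBundle EG G P IB) x₀) hx') _

theorem isAffineBundle_cFibre : IsAffineBundle IB (EB →L[ℂ] LieAlg EG G)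
    (fun x => TangentSpace IB x →L[ℂ] adBundle EG G P IB x)
    (EB →L[ℂ] LieAlg EG G) (CFibre IB EG G P lam) (translate lam) where
  nonempty x := inferInstance
  zero_translate x h := cFibre_ext fun w p => by
    rw [translate_apply]
    exact (congrArg (· + (h.1 w).1 p) (map_zero (vert IB EG ⟨x, p⟩))).trans (zero_add _)
  add_translate x φ φ' h := cFibre_ext fun w p => by
    rw [translate_apply, translate_apply, translate_apply, ← add_assoc]
    exact congrArg (· + (h.1 w).1 p) (map_add (vert IB EG ⟨x, p⟩) ((φ w).1 p) ((φ' w).1 p))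
  existsUnique_translate x h h' := existsUnique_translate h h'
  locally_trivial x₀ := by
    have : IsManifold IB 1 B := IsManifold.of_le (n := ω) le_top
    -- The tangent bundle loses one degree of differentiability, and `ω + 1` is `ω`.
    have : IsManifold IB (ω + 1) B := inferInstanceAs (IsManifold IB ω B)
    have : ContMDiffVectorBundle ω EB (TangentSpace IB : B → Type _) IB :=
      TangentBundle.contMDiffVectorBundle
    let S := trivializationAt (EB →L[ℂ] LieAlg EG G) (CFibre IB EG G P lam) x₀
    let T := trivializationAt (EB →L[ℂ] LieAlg EG G)
      (fun x => TangentSpace IB x →L[ℂ] adBundle EG G P IB x) x₀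
    have hS := contMDiffOn_of_mem_atlas_comp (I := IB.prod 𝓘(ℂ, EB →L[ℂ] LieAlg EG G)) (n := ω)
      (M := B × (EB →L[ℂ] LieAlg EG G)) (e := S.toOpenPartialHomeomorph) rfl
      ⟨S, FiberBundle.trivialization_mem_atlas' x₀, rfl⟩
    have hT := contMDiffOn_of_mem_atlas_comp (I := IB.prod 𝓘(ℂ, EB →L[ℂ] LieAlg EG G)) (n := ω)
      (M := B × (EB →L[ℂ] LieAlg EG G)) (e := T.toOpenPartialHomeomorph) rfl
      ⟨T, FiberBundle.trivialization_mem_atlas' x₀, rfl⟩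
    refine ⟨S.baseSet ∩ T.baseSet, S.open_baseSet.inter T.open_baseSet,
      ⟨FiberBundle.mem_baseSet_trivializationAt' x₀, FiberBundle.mem_baseSet_trivializationAt' x₀⟩,
      -- The local isomorphism identifies points that have equal coordinates in the trivializations
      -- of `C_λ(P)` and of `Hom(T_X, ad P)` at `x₀`.
      S.toOpenPartialHomeomorph ≫ₕ T.toOpenPartialHomeomorph.symm, ?_, ?_, ?_, ?_, ?_⟩
    · ext z
      simp only [OpenPartialHomeomorph.trans_source, OpenPartialHomeomorph.symm_source]
      refine ⟨fun hz => ?_, fun hz => ?_⟩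
      · have h1 : z.1 ∈ S.baseSet := S.mem_source.1 hz.1
        have h2 := T.mem_target.1 hz.2
        exact ⟨h1, (S.coe_fst' h1).symm ▸ h2⟩
      · exact ⟨S.mem_source.2 hz.1, T.mem_target.2 ((S.coe_fst' hz.1).symm ▸ hz.2)⟩
    · ext z
      simp only [OpenPartialHomeomorph.trans_target, OpenPartialHomeomorph.symm_target,
        OpenPartialHomeomorph.symm_symm]
      refine ⟨fun hz => ?_, fun hz => ?_⟩
      · have h1 : z.1 ∈ T.baseSet := T.mem_source.1 hz.1
        have h2 := S.mem_target.1 hz.2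
        exact ⟨(T.coe_fst' h1).symm ▸ h2, h1⟩
      · exact ⟨T.mem_source.2 hz.2, S.mem_target.2 ((T.coe_fst' hz.2).symm ▸ hz.1)⟩
    · rw [OpenPartialHomeomorph.trans_source]
      exact hT.2.comp (hS.1.mono inter_subset_left) (fun z hz => hz.2)
    · rw [OpenPartialHomeomorph.trans_target]
      exact hS.2.comp (hT.1.mono inter_subset_left) (fun z hz => hz.2)
    · intro x hx h
      have key : ∀ (h : CFibre IB EG G P lam x) (u : TangentSpace IB x →L[ℂ] adBundle EG G P IB x),
          (T ⟨x, u⟩).2 = (S ⟨x, h⟩).2 →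
          (S.toOpenPartialHomeomorph ≫ₕ T.toOpenPartialHomeomorph.symm) ⟨x, h⟩ = ⟨x, u⟩ := by
        intro h u hu
        have h1 : S ⟨x, h⟩ = T ⟨x, u⟩ := Prod.ext
          ((S.coe_fst' (x := ⟨x, h⟩) hx.1).trans (T.coe_fst' (x := ⟨x, u⟩) hx.2).symm) hu.symm
        change T.toOpenPartialHomeomorph.symm (S ⟨x, h⟩) = _
        rw [h1]
        exact T.left_inv (x := ⟨x, u⟩) (T.mem_source.2 hx.2)
      have hu : (T ⟨x, T.symm x (S ⟨x, h⟩).2⟩).2 = (S ⟨x, h⟩).2 :=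
        congrArg Prod.snd (T.apply_mk_symm hx.2 (S ⟨x, h⟩).2)
      refine ⟨T.symm x (S ⟨x, h⟩).2, key _ _ hu, fun v => key _ _ ?_⟩
      -- `T` is linear on fibres, so equivariance amounts to the statement that `S` turns
      -- translation by `v` into addition of the coordinate of `v`.
      refine ((T.linear ℂ hx.2).map_add v _).trans ?_
      rw [hu]
      refine ContinuousLinearMap.ext fun w => ?_
      refine Eq.trans ?_ (cCoord_translate (trivializationAt G P x₀) x₀ hx.1.1 v h w).symm
      exact congrArg (· + cCoord (trivializationAt G P x₀) x₀ h w) (hom_coord_apply x₀ hx.1.1 v w)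

end Translations

/-! ### Recovering a point of `C_λ(P)` from its form -/

section FormToFibre
variable {EB : Type*} [NormedAddCommGroup EB] [NormedSpace ℂ EB] {HB : Type*} [TopologicalSpace HB]
  {IB : ModelWithCorners ℂ EB HB} {B : Type*} [TopologicalSpace B] [ChartedSpace HB B]
  {EG : Type*} [NormedAddCommGroup EG] [NormedSpace ℂ EG]
  {G : Type*} [TopologicalSpace G] [ChartedSpace EG G] [Group G] [LieGroup 𝓘(ℂ, EG) ω G]
  {P : B → Type*} [TopologicalSpace (TotalSpace G P)] [∀ x, TopologicalSpace (P x)]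
  [∀ x, Nonempty (P x)]
  [FiberBundle G P] [∀ x, MulAction Gᵐᵒᵖ (P x)]
  [hP : IsHolomorphicPrincipalBundle IB EG G P] [IsManifold IB ω B]
  [FiniteDimensional ℂ EB] {lam : ℂ}

/-- An element of `C_λ(P)` is determined by the form that it defines. -/
theorem cFibre_eq_of_tautForm {x : B} {h h' : CFibre IB EG G P lam x}
    (H : ∀ p u, tautForm h p u = tautForm h' p u) : h = h' := by
  refine cFibre_ext fun w p => ?_
  obtain ⟨u, rfl⟩ := mfderiv_proj_surjective (IB := IB) (EG := EG) (⟨x, p⟩ : TotalSpace G P) w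
  have h1 := vert_tautForm h p u
  rw [H p u, vert_tautForm] at h1
  exact (sub_right_injective h1).symm

/-- Every equivariant family of forms along a fibre of `P` that is `λ` on vertical vectors is defined
by an element of `C_λ(P)`. -/
theorem exists_tautForm_eq {x : B}
    (s : ∀ p : P x, TangentSpace (IB.prod 𝓘(ℂ, EG)) (⟨x, p⟩ : TotalSpace G P) →L[ℂ] LieAlg EG G)
    (hs : ∀ (g : G) (p : P x) (u : TangentSpace (IB.prod 𝓘(ℂ, EG)) (⟨x, p⟩ : TotalSpace G P)),
      s (MulOpposite.op g • p) (rightMulDeriv IB EG g ⟨x, p⟩ u) = Ad EG g⁻¹ (s p u))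
    (hv : ∀ (p : P x) (ξ : LieAlg EG G), s p (vert IB EG ⟨x, p⟩ ξ) = lam • ξ) :
    ∃ h : CFibre IB EG G P lam x, ∀ p u, tautForm h p u = s p u := by
  let e := trivializationAt G P x
  have hx : x ∈ e.baseSet := mem_baseSet_trivializationAt G P x
  -- The coordinate is forced: on the section, the horizontal vector `(w, 0)` of `e` has flat form
  -- `0`, so `tautForm_eq` leaves only minus the coordinate at `w`.
  let a : EB →L[ℂ] LieAlg EG G := -(s (e.symm x (1 : G))).comp ((thetaSymm IB EG e x).comp
    ((ContinuousLinearMap.inl ℂ EB (LieAlg EG G)).comp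
      ((trivializationAt EB (TangentSpace IB) x).symmL ℂ x)))
  have hx' : x ∈ (trivializationAt EB (TangentSpace IB) x).baseSet :=
    mem_baseSet_trivializationAt EB (TangentSpace IB) x
  have ha : ∀ w : TangentSpace IB x,
      a ((trivializationAt EB (TangentSpace IB) x).continuousLinearMapAt ℂ x w) =
        -(s (e.symm x (1 : G)) (thetaSymm IB EG e x (w, 0))) := fun w =>
    congrArg (fun w : EB => -(s (e.symm x (1 : G)) (thetaSymm IB EG e x (w, 0))))
      (Trivialization.symmL_continuousLinearMapAt (R := ℂ) _ hx' w)
  have hvert : ∀ ξ : LieAlg EG G,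
      thetaSymm IB EG e x (0, ξ) = vert IB EG ⟨x, e.symm x (1 : G)⟩ ξ := fun ξ => by
    have h1 := thetaSymm_left (IB := IB) (EG := EG) e hx (vert IB EG ⟨x, e.symm x (1 : G)⟩ ξ)
    rw [mfderiv_proj_vert, ← flatForm_sec (IB := IB) (EG := EG) e hx,
      flatForm_vert e (z := ⟨x, e.symm x (1 : G)⟩) hx] at h1
    exact h1
  refine ⟨cOfCoord lam e x hx a, ?_⟩
  -- On the section `u` splits as `(w, 0) + (0, θ)`. The first part is matched by the choice of `a`,
  -- the second is vertical and both forms are `λ` on it.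
  have hsec : ∀ u, tautForm (cOfCoord lam e x hx a) (e.symm x (1 : G)) u =
      s (e.symm x (1 : G)) u := by
    intro u
    have he : e ⟨x, e.symm x (1 : G)⟩ = (x, 1) := e.apply_mk_symm hx 1
    rw [tautForm_eq e x hx hx', cCoord_cOfCoord e x hx hx', ha, he, inv_one, Ad_one,
      flatForm_sec e hx]
    set w := mfderiv (IB.prod 𝓘(ℂ, EG)) IB (π G P) ⟨x, e.symm x (1 : G)⟩ u with hw
    have h1 : thetaSymm IB EG e x (w, 0) + thetaSymm IB EG e x (0, theta IB EG e x u) = u := by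
      refine Eq.trans (map_add (thetaSymm IB EG e x) _ _).symm ?_
      refine Eq.trans ?_ (thetaSymm_left (IB := IB) (EG := EG) e hx u)
      exact congrArg (thetaSymm IB EG e x) (Prod.ext (add_zero _) (zero_add _))
    conv_rhs => rw [← h1]
    refine Eq.trans ?_ (map_add (s (e.symm x (1 : G))) _ _).symm
    rw [hvert, hv, add_comm]
    exact sub_neg_eq_add _ _
  intro p u
  obtain ⟨g, rfl⟩ : ∃ g : G, p = MulOpposite.op g • e.symm x (1 : G) :=
    ⟨_, eq_smul_sec (IB := IB) (EG := EG) e hx p⟩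
  -- Every tangent vector at `p` is the right translate of one on the section, so the equivariance
  -- of both forms extends the equality to the whole fibre.
  obtain ⟨u₀, rfl⟩ : ∃ u₀ : TangentSpace (IB.prod 𝓘(ℂ, EG))
      (⟨x, e.symm x (1 : G)⟩ : TotalSpace G P), rightMulDeriv IB EG g _ u₀ = u := by
    have h2 : rightMul g⁻¹ (⟨x, MulOpposite.op g • e.symm x (1 : G)⟩ : TotalSpace G P) =
        ⟨x, e.symm x (1 : G)⟩ := by
      refine (rightMul_mul g g⁻¹ (⟨x, e.symm x (1 : G)⟩ : TotalSpace G P)).symm.trans ?_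
      rw [mul_inv_cancel, rightMul_one]
    refine ⟨rightMulDeriv IB EG g⁻¹ _ u, ?_⟩
    refine (rightMulDeriv_congr (IB := IB) (EG := EG) h2.symm _).trans ?_
    refine (rightMulDeriv_mul (IB := IB) (EG := EG) g⁻¹ g
      (⟨x, MulOpposite.op g • e.symm x (1 : G)⟩ : TotalSpace G P) u).symm.trans ?_
    rw [inv_mul_cancel]
    exact rightMulDeriv_one _ u
  exact (tautForm_rightMulDeriv _ _ g u₀).trans
    ((congrArg (Ad EG g⁻¹) (hsec u₀)).trans (hs g _ u₀).symm)

/-- The local coordinate of an element of `C_λ(P)` in terms of the form that it defines. -/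
theorem cCoord_eq_neg_tautForm (e : Trivialization G (π G P)) [MemTrivializationAtlas e] (x₀ : B)
    {x : B} (hx : x ∈ e.baseSet) (hx' : x ∈ (trivializationAt EB (TangentSpace IB) x₀).baseSet)
    (h : CFibre IB EG G P lam x) (w : EB) :
    cCoord e x₀ h w = -tautForm h (e.symm x (1 : G)) (thetaSymm IB EG e x
      ((trivializationAt EB (TangentSpace IB) x₀).symmL ℂ x w, 0)) := by
  have he : e ⟨x, e.symm x (1 : G)⟩ = (x, 1) := e.apply_mk_symm hx 1
  rw [tautForm_eq e x₀ hx hx', he, inv_one, Ad_one, flatForm_sec e hx, (thetaSymm_right e hx _).1,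
    (thetaSymm_right e hx _).2, smul_zero, zero_sub, neg_neg]
  exact congrArg (cCoord e x₀ h) (Trivialization.continuousLinearMapAt_symmL _ hx' w).symm

theorem contMDiffAt_sec (e : Trivialization G (π G P)) [MemTrivializationAtlas e] {x : B}
    (hx : x ∈ e.baseSet) :
    ContMDiffAt IB (IB.prod 𝓘(ℂ, EG)) ω
      (fun y => (⟨y, e.symm y (1 : G)⟩ : TotalSpace G P)) x := by
  refine (ContMDiffAt.comp x (contMDiffAt_triv_symm (IB := IB) (EG := EG) e (z := (x, (1 : G))) hx)
    (contMDiffAt_id.prodMk contMDiffAt_const)).congr_of_eventuallyEq ?_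
  filter_upwards [e.open_baseSet.mem_nhds hx] with y hy
  exact sec_eq e hy

/-- The section has constant `G`-component `1` and projects to the identity. Writing horizontal
vectors as derivatives of a holomorphic map makes their holomorphic dependence on the point
available. -/
theorem mfderiv_sec (e : Trivialization G (π G P)) [MemTrivializationAtlas e] {x : B}
    (hx : x ∈ e.baseSet) (w : TangentSpace IB x) :
    mfderiv IB (IB.prod 𝓘(ℂ, EG)) (fun y => (⟨y, e.symm y (1 : G)⟩ : TotalSpace G P)) x w =
      thetaSymm IB EG e x (w, 0) := by
  have hd := (contMDiffAt_sec (IB := IB) (EG := EG) e hx).mdifferentiableAt (by simp)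
  have c := mfderiv_comp (I := IB) (I' := IB.prod 𝓘(ℂ, EG)) (I'' := IB) x
    ((contMDiff_projP (IB := IB) (EG := EG) (P := P)).mdifferentiableAt
      (x := ⟨x, e.symm x (1 : G)⟩) (by simp)) hd
  have h1 : (π G P ∘ fun y => (⟨y, e.symm y (1 : G)⟩ : TotalSpace G P)) = id := rfl
  rw [h1, mfderiv_id] at c
  have hd' := (contMDiffAt_triv_snd (IB := IB) (EG := EG) e (z := ⟨x, e.symm x (1 : G)⟩)
    hx).mdifferentiableAt (by simp)
  have c' := mfderiv_comp (I := IB) (I' := IB.prod 𝓘(ℂ, EG)) (I'' := 𝓘(ℂ, EG)) x hd' hd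
  have h2 : ((fun z : TotalSpace G P => (e z).2) ∘
      fun y => (⟨y, e.symm y (1 : G)⟩ : TotalSpace G P)) =ᶠ[𝓝 x] fun _ => (1 : G) := by
    filter_upwards [e.open_baseSet.mem_nhds hx] with y hy
    exact congrArg Prod.snd (e.apply_mk_symm hy 1)
  have c2 := h2.mfderiv_eq (I := IB) (I' := 𝓘(ℂ, EG))
  rw [mfderiv_const] at c2
  refine Eq.trans (thetaSymm_left (IB := IB) (EG := EG) e hx _).symm ?_
  exact congrArg (thetaSymm IB EG e x) (Prod.ext
    (congrArg (fun L : EB →L[ℂ] EB => L w) c).symm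
    (congrArg (fun L : EB →L[ℂ] EG => L w) (c'.symm.trans c2)))

end FormToFibre

/-! ### The classifying map and the universal property -/

section Universal
variable {EB : Type*} [NormedAddCommGroup EB] [NormedSpace ℂ EB] {HB : Type*} [TopologicalSpace HB]
  {IB : ModelWithCorners ℂ EB HB} {B : Type*} [TopologicalSpace B] [ChartedSpace HB B]
  {EG : Type*} [NormedAddCommGroup EG] [NormedSpace ℂ EG]
  {G : Type*} [TopologicalSpace G] [ChartedSpace EG G] [Group G] [LieGroup 𝓘(ℂ, EG) ω G]
  {P : B → Type*} [TopologicalSpace (TotalSpace G P)] [∀ x, TopologicalSpace (P x)]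
  [∀ x, Nonempty (P x)]
  [FiberBundle G P] [∀ x, MulAction Gᵐᵒᵖ (P x)]
  [hP : IsHolomorphicPrincipalBundle IB EG G P] [IsManifold IB ω B]
  [FiniteDimensional ℂ EB] {lam : ℂ}
  {EC : Type*} [NormedAddCommGroup EC] [NormedSpace ℂ EC] {HC : Type*} [TopologicalSpace HC]
  {IC : ModelWithCorners ℂ EC HC} {C : Type*} [TopologicalSpace C] [ChartedSpace HC C]
  [IsManifold IC ω C]

/-- A map to `C_λ(P)` is holomorphic if the form that it defines is. -/
theorem contMDiff_of_tautForm (f : C^ω⟮IC, C; IB, B⟯) (h : ∀ y, CFibre IB EG G P lam (f y))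
    {s : ∀ z : TotalSpace G ((f : C → B) *ᵖ P),
      TangentSpace (IB.prod 𝓘(ℂ, EG)) (Pullback.lift f z : TotalSpace G P) →L[ℂ] LieAlg EG G}
    (hs : ContMDiff (IC.prod 𝓘(ℂ, EG))
      ((IB.prod 𝓘(ℂ, EG)).prod 𝓘(ℂ, (EB × EG) →L[ℂ] LieAlg EG G)) ω
      (fun z => (⟨Pullback.lift f z, s z⟩ :
        TotalSpace ((EB × EG) →L[ℂ] LieAlg EG G) (FormBundle IB EG G P))))
    (H : ∀ (y : C) (p : P (f y)) (u : TangentSpace (IB.prod 𝓘(ℂ, EG)) (⟨f y, p⟩ : TotalSpace G P)),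
      tautForm (h y) p u = s ⟨y, p⟩ u) :
    ContMDiff IC (IB.prod 𝓘(ℂ, EB →L[ℂ] LieAlg EG G)) ω
      (fun y => (⟨f y, h y⟩ : TotalSpace (EB →L[ℂ] LieAlg EG G) (CFibre IB EG G P lam))) := by
  intro y₀
  have : IsManifold IB 1 B := IsManifold.of_le (n := ω) le_top
  have : IsManifold (IB.prod 𝓘(ℂ, EG)) 1 (TotalSpace G P) := IsManifold.of_le (n := ω) le_top
  refine (contMDiffAt_totalSpace (F := EB →L[ℂ] LieAlg EG G) (E := CFibre IB EG G P lam)).2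
    ⟨f.contMDiff y₀, ?_⟩
  let e := trivializationAt G P (f y₀)
  have he : f y₀ ∈ e.baseSet := mem_baseSet_trivializationAt G P (f y₀)
  let T := trivializationAt EB (TangentSpace IB) (f y₀)
  have hT : f y₀ ∈ T.baseSet := mem_baseSet_trivializationAt EB (TangentSpace IB) (f y₀)
  have : MemTrivializationAtlas (e.pullback f) := ⟨⟨e, inferInstance, rfl⟩⟩
  -- The section of `f^*P` induced by `e`. By `cCoord_eq_neg_tautForm` the coordinate of `h y` is
  -- minus `s` at `σ y`, applied to the derivative of the section of `P` at `f y`; `h1` and `h2` are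
  -- the holomorphy of these two factors.
  let σ : C → TotalSpace G ((f : C → B) *ᵖ P) := fun y => ⟨y, e.symm (f y) (1 : G)⟩
  have hσ : ContMDiffAt IC (IC.prod 𝓘(ℂ, EG)) ω σ y₀ :=
    ContMDiffAt.comp y₀ (contMDiffAt_triv_symm (IB := IC) (EG := EG) (e.pullback f)
      (z := (y₀, (1 : G))) he) (contMDiffAt_id.prodMk contMDiffAt_const)
  have h1 := (contMDiffAt_hom_trivial_iff.1 (ContMDiffAt.comp
    (g := fun z => (⟨Pullback.lift f z, s z⟩ :
      TotalSpace ((EB × EG) →L[ℂ] LieAlg EG G) (FormBundle IB EG G P))) y₀ (hs (σ y₀)) hσ)).2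
  have h2 := contMDiffAt_coord_mfderiv (b := f) (n₀ := y₀)
    (contMDiffAt_sec (IB := IB) (EG := EG) e he) (f.contMDiff y₀)
  refine (h1.clm_comp h2).neg.congr_of_eventuallyEq ?_
  let S := trivializationAt (EB × EG) (TangentSpace (IB.prod 𝓘(ℂ, EG)))
    (Pullback.lift f (σ y₀) : TotalSpace G P)
  have hF : ContinuousAt (fun y => (Pullback.lift f (σ y) : TotalSpace G P)) y₀ :=
    ((contMDiff_lift (IB := IB) (EG := EG) (G := G) (P := P) f).continuous.continuousAt).comp
      hσ.continuousAt
  filter_upwards [f.contMDiff.continuous.continuousAt.preimage_mem_nhds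
      (e.open_baseSet.mem_nhds he),
    f.contMDiff.continuous.continuousAt.preimage_mem_nhds (T.open_baseSet.mem_nhds hT),
    hF.preimage_mem_nhds (S.open_baseSet.mem_nhds
      (mem_baseSet_trivializationAt (EB × EG) (TangentSpace (IB.prod 𝓘(ℂ, EG)))
        (Pullback.lift f (σ y₀) : TotalSpace G P)))] with y hy hy' hy''
  refine ContinuousLinearMap.ext fun w => ?_
  refine (cCoord_eq_neg_tautForm e (f y₀) hy hy' (h y) w).trans ?_
  refine congrArg Neg.neg ((H y _ _).trans (congrArg (s (σ y)) ?_))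
  rw [← mfderiv_sec (IB := IB) (EG := EG) e hy]
  exact (S.symmL_continuousLinearMapAt (R := ℂ) hy'' _).symm

theorem eq_mk_of_lift_eq {z : TotalSpace G (cProj IB EG G P lam *ᵖ P)} {x : B}
    {h : CFibre IB EG G P lam x} {p : P x} (h1 : z.1 = ⟨x, h⟩)
    (h2 : (Pullback.lift (cProj IB EG G P lam) z : TotalSpace G P) = ⟨x, p⟩) :
    z = ⟨⟨x, h⟩, p⟩ := by
  obtain ⟨c, q⟩ := z
  obtain rfl : c = ⟨x, h⟩ := h1
  have h3 : (⟨x, q⟩ : TotalSpace G P) = ⟨x, p⟩ := h2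
  obtain rfl : q = p := eq_of_heq (TotalSpace.mk.inj h3).2
  rfl

variable {f : C^ω⟮IC, C; IB, B⟯}
  {ψ : C^ω⟮IC, C; IB.prod 𝓘(ℂ, EB →L[ℂ] LieAlg EG G),
    TotalSpace (EB →L[ℂ] LieAlg EG G) (CFibre IB EG G P lam)⟯}
  {Φ : TotalSpace G (f *ᵖ P) → TotalSpace G (ψ *ᵖ (cProj IB EG G P lam *ᵖ P))}

/-- The differential of the compatibility `hc` of `Φ` with the maps to `P`. It brings the pullback
of the tautological form back to `dF`. -/
theorem liftDeriv_liftDeriv_mfderiv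
    (hΦ : ContMDiff (IC.prod 𝓘(ℂ, EG)) (IC.prod 𝓘(ℂ, EG)) ω Φ)
    (hc : ∀ z, (Pullback.lift (cProj IB EG G P lam) (Pullback.lift ψ (Φ z)) : TotalSpace G P) =
      Pullback.lift f z) (z : TotalSpace G (f *ᵖ P)) (v : EC × EG) :
    (liftDeriv (IB := IB) (EG := EG) (cProj IB EG G P lam) (Pullback.lift ψ (Φ z))
      (liftDeriv (EG := EG) ψ (Φ z)
        (mfderiv (IC.prod 𝓘(ℂ, EG)) (IC.prod 𝓘(ℂ, EG)) Φ z v)) : EB × EG) =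
      liftDeriv (IB := IB) (EG := EG) f z v := by
  have d1 := (contMDiff_lift (IB := IB) (EG := EG) (G := G) (P := P)
    (cProj IB EG G P lam)).mdifferentiableAt (x := Pullback.lift ψ (Φ z)) (by simp)
  have d2 := (contMDiff_lift (IB := IB.prod 𝓘(ℂ, EB →L[ℂ] LieAlg EG G)) (EG := EG) (G := G)
    (P := cProj IB EG G P lam *ᵖ P) ψ).mdifferentiableAt (x := Φ z) (by simp)
  have d3 := hΦ.mdifferentiableAt (x := z) (by simp)
  have c1 := mfderiv_comp z d2 d3
  have c2 := mfderiv_comp z d1 (d2.comp z d3)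
  have h1 : (Pullback.lift (cProj IB EG G P lam) ∘ (Pullback.lift ψ ∘ Φ) :
      TotalSpace G (f *ᵖ P) → TotalSpace G P) = Pullback.lift f := funext hc
  rw [h1] at c2
  have e1 := congrArg (fun L : (EC × EG) →L[ℂ] (EB × EG) => L v) c2
  refine Eq.trans ?_ e1.symm
  exact congrArg (liftDeriv (IB := IB) (EG := EG) (cProj IB EG G P lam) (Pullback.lift ψ (Φ z)))
    (congrArg (fun L : (EC × EG) →L[ℂ] ((EB × (EB →L[ℂ] LieAlg EG G)) × EG) => L v) c1).symm

/-- The form at `z` of the pullback of the tautological connection by `ψ`, if `ψ` is `h` at `z`. -/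
theorem pullbackForm_tautConnection
    (hΦ : ContMDiff (IC.prod 𝓘(ℂ, EG)) (IC.prod 𝓘(ℂ, EG)) ω Φ)
    (hp : ∀ z, (Φ z).proj = z.proj)
    (hc : ∀ z, (Pullback.lift (cProj IB EG G P lam) (Pullback.lift ψ (Φ z)) : TotalSpace G P) =
      Pullback.lift f z) {y : C} (p : P (f y)) {h : CFibre IB EG G P lam (f y)}
    (hy : ψ y = ⟨f y, h⟩)
    (v : TangentSpace (IC.prod 𝓘(ℂ, EG)) (⟨y, p⟩ : TotalSpace G (f *ᵖ P))) :
    pullbackForm ψ (tautConnection IB EG G P lam) (Φ ⟨y, p⟩)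
      (mfderiv (IC.prod 𝓘(ℂ, EG)) (IC.prod 𝓘(ℂ, EG)) Φ ⟨y, p⟩ v) =
      tautForm h p (liftDeriv (IB := IB) (EG := EG) f ⟨y, p⟩ v) := by
  have h1 : Pullback.lift ψ (Φ ⟨y, p⟩) = ⟨⟨f y, h⟩, p⟩ := by
    refine eq_mk_of_lift_eq ?_ (hc ⟨y, p⟩)
    exact (congrArg ψ (hp ⟨y, p⟩)).trans hy
  have h2 : ∀ (w : TotalSpace G (cProj IB EG G P lam *ᵖ P)) (_ : w = ⟨⟨f y, h⟩, p⟩) (u : EB × EG),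
      tautHom IB EG G P lam w u = tautForm h p u := by
    rintro _ rfl u; rfl
  exact (h2 _ h1 _).trans (congrArg (tautForm h p) (liftDeriv_liftDeriv_mfderiv hΦ hc ⟨y, p⟩ v))

/-- The homomorphism `s` through which `D` factors is, at each `y`, the form of exactly one point of
`C_λ(P)` over `f y`. That point has to be `ψ y`. -/
theorem existsUnique_classifying_map (f : C^ω⟮IC, C; IB, B⟯)
    (hf : ∀ y, Function.Surjective (mfderiv IC IB f y)) (D : LieForm IC EG G (f *ᵖ P))
    (hD : IsLambdaConnection lam D) (hD' : TrivialOnFibres f D) :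
    ∃! ψ : C^ω⟮IC, C; IB.prod 𝓘(ℂ, EB →L[ℂ] LieAlg EG G),
        TotalSpace (EB →L[ℂ] LieAlg EG G) (CFibre IB EG G P lam)⟯,
      (∀ y, cProj IB EG G P lam (ψ y) = f y) ∧
      ∃ Φ : TotalSpace G (f *ᵖ P) ≃ₘ^ω⟮IC.prod 𝓘(ℂ, EG), IC.prod 𝓘(ℂ, EG)⟯
          TotalSpace G (ψ *ᵖ (cProj IB EG G P lam *ᵖ P)),
        IsIsoWithForms Φ D (pullbackForm ψ (tautConnection IB EG G P lam)) ∧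
        ∀ z, (Pullback.lift (cProj IB EG G P lam) (Pullback.lift ψ (Φ z)) :
          TotalSpace G P) = Pullback.lift f z := by
  obtain ⟨s, hs, hs', hDs⟩ := hD'
  -- The value of `s` on vertical vectors of `P` is known from `D`, since `dF` maps the vertical
  -- vector of `ξ` in `f^*P` to that of `ξ` in `P`.
  have hex : ∀ y, ∃ h : CFibre IB EG G P lam (f y), ∀ p u, tautForm h p u = s ⟨y, p⟩ u := fun y =>
    exists_tautForm_eq (IB := IB) (P := P) (fun p => s ⟨y, p⟩) (fun g p u => hs' g ⟨y, p⟩ u) fun p ξ => by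
      refine Eq.trans ?_ (hD.vertical ⟨y, p⟩ ξ)
      rw [hDs, liftDeriv_vert]
      rfl
  choose h hh using hex
  let ψ : C^ω⟮IC, C; IB.prod 𝓘(ℂ, EB →L[ℂ] LieAlg EG G),
      TotalSpace (EB →L[ℂ] LieAlg EG G) (CFibre IB EG G P lam)⟯ :=
    ⟨fun y => ⟨f y, h y⟩, contMDiff_of_tautForm f h hs hh⟩
  refine ⟨ψ, ⟨fun y => rfl, ?_⟩, ?_⟩
  -- As `q ∘ ψ` is `f` by definition, the fibres of both bundles at `y` are `P (f y)` and the
  -- isomorphism is the identity on them. Only its holomorphy for the two complex structures needs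
  -- proof.
  · let Φ : TotalSpace G (f *ᵖ P) ≃ₘ^ω⟮IC.prod 𝓘(ℂ, EG), IC.prod 𝓘(ℂ, EG)⟯
        TotalSpace G (ψ *ᵖ (cProj IB EG G P lam *ᵖ P)) :=
      { toFun := fun z => ⟨z.1, z.2⟩
        invFun := fun z => ⟨z.1, z.2⟩
        left_inv := fun _ => rfl
        right_inv := fun _ => rfl
        contMDiff_toFun := by
          have h1 := contMDiff_projP (IB := IC) (EG := EG) (G := G) (P := (f : C → B) *ᵖ P)
          refine contMDiff_toPullback (IB := IB.prod 𝓘(ℂ, EB →L[ℂ] LieAlg EG G))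
            (P := cProj IB EG G P lam *ᵖ P) ψ h1 ?_
          refine contMDiff_toPullback (IB := IB) (P := P) (cProj IB EG G P lam)
            (ψ.contMDiff.comp h1) ?_
          exact contMDiff_lift (IB := IB) (EG := EG) (P := P) f
        contMDiff_invFun := by
          refine contMDiff_toPullback (IB := IB) (P := P) f
            (contMDiff_projP (IB := IC) (EG := EG) (P := ψ *ᵖ (cProj IB EG G P lam *ᵖ P))) ?_
          exact (contMDiff_lift (IB := IB) (EG := EG) (P := P) (cProj IB EG G P lam)).comp
            (contMDiff_lift (EG := EG) (P := cProj IB EG G P lam *ᵖ P) ψ) }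
    refine ⟨Φ, ⟨fun _ => rfl, fun _ _ => rfl, ?_⟩, fun _ => rfl⟩
    rintro ⟨y, p⟩ v
    refine Eq.trans ?_ (pullbackForm_tautConnection (ψ := ψ) (Φ := Φ) Φ.contMDiff (fun _ => rfl)
      (fun _ => rfl) p rfl v).symm
    exact (hDs _ _).trans (hh y p _).symm
  · rintro ψ' ⟨hq, Φ, hΦ, hc⟩
    refine ContMDiffMap.ext fun y => ?_
    -- For a competitor `ψ'` the equation `q (ψ' y) = f y` is only propositional, so its value is
    -- first rewritten as an element of the fibre over `f y`.
    obtain ⟨h', hh'⟩ : ∃ h' : CFibre IB EG G P lam (f y), ψ' y = ⟨f y, h'⟩ := by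
      have h1 : (ψ' y).1 = f y := hq y
      generalize ψ' y = c at h1
      obtain ⟨x, h'⟩ := c
      obtain rfl : x = f y := h1
      exact ⟨h', rfl⟩
    refine hh'.trans (congrArg (TotalSpace.mk (f y)) (cFibre_eq_of_tautForm fun p u => ?_))
    -- Here the submersion is needed: the forms of `ψ' y` and of `h y` are known to agree only on
    -- the image of `dF`.
    obtain ⟨v, rfl⟩ := liftDeriv_surjective (EG := EG) f hf (⟨y, p⟩ : TotalSpace G (f *ᵖ P)) u
    rw [← pullbackForm_tautConnection (ψ := ψ') (Φ := Φ) Φ.contMDiff hΦ.proj_eq hc p hh' v]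
    exact (hΦ.form_eq ⟨y, p⟩ v).symm.trans ((hDs _ _).trans (hh y p _).symm)

end Universal

end HolPrin

end

/-! ### The theorem -/

open HolPrin
theorem proposition3p2
    {EX : Type*} [NormedAddCommGroup EX] [NormedSpace ℂ EX] [FiniteDimensional ℂ EX]
    {X : Type*} [TopologicalSpace X] [ChartedSpace EX X] [IsManifold 𝓘(ℂ, EX) ω X]
    {EG : Type*} [NormedAddCommGroup EG] [NormedSpace ℂ EG] [FiniteDimensional ℂ EG]
    {G : Type*} [TopologicalSpace G] [ChartedSpace EG G] [Group G] [LieGroup 𝓘(ℂ, EG) ω G]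
    (P : X → Type*) [TopologicalSpace (TotalSpace G P)] [∀ x, TopologicalSpace (P x)]
    [∀ x, Nonempty (P x)] [FiberBundle G P] [∀ x, MulAction Gᵐᵒᵖ (P x)]
    [IsHolomorphicPrincipalBundle 𝓘(ℂ, EX) EG G P] (lam : ℂ) :
    ((T2Space X → T2Space (TotalSpace (EX →L[ℂ] LieAlg EG G) (CFibre 𝓘(ℂ, EX) EG G P lam))) ∧
      (SecondCountableTopology X → SecondCountableTopology
        (TotalSpace (EX →L[ℂ] LieAlg EG G) (CFibre 𝓘(ℂ, EX) EG G P lam)))) ∧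
    IsAffineBundle 𝓘(ℂ, EX)
      (EX →L[ℂ] LieAlg EG G)
      (fun x => TangentSpace 𝓘(ℂ, EX) x →L[ℂ] adBundle EG G P 𝓘(ℂ, EX) x)
      (EX →L[ℂ] LieAlg EG G) (CFibre 𝓘(ℂ, EX) EG G P lam) (translate lam) ∧
    ∃ nabla : LieForm (𝓘(ℂ, EX).prod 𝓘(ℂ, EX →L[ℂ] LieAlg EG G)) EG G
        (cProj 𝓘(ℂ, EX) EG G P lam *ᵖ P),
      IsTautologicalForm lam nabla ∧
      IsLambdaConnection lam nabla ∧
      TrivialOnFibres (cProj 𝓘(ℂ, EX) EG G P lam) nabla ∧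
      ∀ {EY : Type*} [NormedAddCommGroup EY] [NormedSpace ℂ EY] [FiniteDimensional ℂ EY]
        {Y : Type*} [TopologicalSpace Y] [ChartedSpace EY Y] [IsManifold 𝓘(ℂ, EY) ω Y]
        (f : C^ω⟮𝓘(ℂ, EY), Y; 𝓘(ℂ, EX), X⟯),
        (∀ y, Function.Surjective (mfderiv 𝓘(ℂ, EY) 𝓘(ℂ, EX) f y)) →
        ∀ D : LieForm 𝓘(ℂ, EY) EG G (f *ᵖ P), IsLambdaConnection lam D → TrivialOnFibres f D →
        ∃! ψ : C^ω⟮𝓘(ℂ, EY), Y; 𝓘(ℂ, EX).prod 𝓘(ℂ, EX →L[ℂ] LieAlg EG G),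
            TotalSpace (EX →L[ℂ] LieAlg EG G) (CFibre 𝓘(ℂ, EX) EG G P lam)⟯,
          (∀ y, cProj 𝓘(ℂ, EX) EG G P lam (ψ y) = f y) ∧
          ∃ Φ : TotalSpace G (f *ᵖ P) ≃ₘ^ω⟮𝓘(ℂ, EY).prod 𝓘(ℂ, EG), 𝓘(ℂ, EY).prod 𝓘(ℂ, EG)⟯
              TotalSpace G (ψ *ᵖ (cProj 𝓘(ℂ, EX) EG G P lam *ᵖ P)),
            IsIsoWithForms Φ D (pullbackForm ψ nabla) ∧
            ∀ z, (Pullback.lift (cProj 𝓘(ℂ, EX) EG G P lam) (Pullback.lift ψ (Φ z)) :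
              TotalSpace G P) = Pullback.lift f z := by
  -- The model fibre of `C_λ(P)` is finite-dimensional, hence proper, hence second countable.
  have : SecondCountableTopology (EX →L[ℂ] LieAlg EG G) :=
    have := FiniteDimensional.proper ℂ (EX →L[ℂ] LieAlg EG G)
    inferInstance
  refine ⟨⟨fun _ => t2Space_totalSpace, fun _ => secondCountableTopology_totalSpace⟩,
    isAffineBundle_cFibre, tautConnection 𝓘(ℂ, EX) EG G P lam, isTautologicalForm_tautConnection,
    isLambdaConnection_tautConnection, trivialOnFibres_tautConnection, ?_⟩
  intro EY _ _ _ Y _ _ _ f hf D hD hD'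
  exact existsUnique_classifying_map f hf D hD hD'
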